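/- A \emph{curve} is a noetherian scheme of pure dimension $1$: every irreducible component has dimension $1$ and there are no embedded points. For a curve $X$ let $\mathcal K_X$ be the sheaf of total quotient rings. A \emph{generalized divisor} $D$ on $X$ is a coherent $\mathcal O_X$-submodule $\mathcal I_D\subseteq\mathcal K_X$ with $(\mathcal I_D)_\eta=\mathcal K_{X,\eta}$ at every generic point $\eta$ of $X$. It is \emph{effective} if $\mathcal I_D\subseteq\mathcal O_X$, \emph{Cartier} if $\mathcal I_D$ is invertible (locally generated by an invertible section of $\mathcal K_X$), and \emph{principal}, written $(f)$, if $\mathcal I_D=\mathcal O_X\cdot f$ with $f\in\Gamma(X,\mathcal K_X^*)$. The sum $D+E$ is defined by $\mathcal I_D\cdot\mathcal I_E$, the inverse $-D$ by $\mathcal I_D^{-1}=\{f\in\mathcal K_X : f\cdot\mathcal I_D\subseteq\mathcal O_X\}$, and $D-E:=D+(-E)$. Write $D\sim D'$ if $D'=D+(f)$ for some principal $(f)$, let $\mathrm{GDiv}(X)$ be the set of generalized divisors and $\mathrm{GPic}(X)=\mathrm{GDiv}(X)/\!\sim$. Let $\pi:X\to Y$ be a finite flat morphism of curves. (i) If $D$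 is an effective generalized divisor on $X$ with ideal sheaf $\mathcal I$, then the $0$-th Fitting ideal $\mathrm{Fitt}_0(\pi_*(\mathcal O_X/\mathcal I))\subseteq\mathcal O_Y$ defines an effective generalized divisor $\pi_*(D)$ on $Y$. (ii) Every $D\in\mathrm{GDiv}(X)$ can be written as $D=D'-E$ with $D'$ an effective generalized divisor and $E$ an effective Cartier divisor, and the generalized divisor $\pi_*(D):=\pi_*(D')-\pi_*(E)$ does not depend on the choice of $D'$ and $E$; for $D$ effective it agrees with (i). (iii) If $D$ is Cartier, then $\pi_*(D)$ is Cartier, $\pi_*(-D)=-\pi_*(D)$, and $\pi_*(D)$ is the classical direct image of $D$: the Cartier divisor on $Y$ generated on $V$ by $N(f)/N(g)$ whenever $V$ runs through an affine open cover of $Y$ such that $\pi_*\mathcal O_X|_V$ is free and $\mathcal I_D|_{\pi^{-1}(V)}$ is generated by $f/g$ with $f,g\in\Gamma(\pi^{-1}(V),\mathcal O_X)$ regular, where $N(s)$ is the determinant of multiplication by $s$ on $\pi_*\mathcal O_X$. Such covers exist. (iv) If $D,E\in\mathrm{GDiv}(X)$ and $E$ is Cartier, then $\pi_*(D+E)=\pi_*(D)+\pi_*(E)$.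 (v) If $V\subseteq Y$ is open, $U=\pi^{-1}(V)$ and $\pi_U:U\to V$ is the restriction of $\pi$, then $(\pi_U)_*(D|_U)=\pi_*(D)|_V$ for every $D\in\mathrm{GDiv}(X)$. (vi) If $D\sim D'$, then $\pi_*(D)\sim\pi_*(D')$. Hence $[D]\mapsto[\pi_*(D)]$ is a well-defined map $\mathrm{GPic}(X)\to\mathrm{GPic}(Y)$. -/

import Mathlib

open AlgebraicGeometry CategoryTheory

universe u

/-! ### Curves -/

/-- A noetherian scheme of pure dimension one: every irreducible component has dimension one, and
the structure sheaf is pure, i.e. every associated point is the generic point of an irreducible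
component (there are no embedded points). -/
structure IsPureCurve (X : Scheme.{u}) : Prop where
  isNoetherian : AlgebraicGeometry.IsNoetherian X
  dim_eq_one : ∀ Z ∈ irreducibleComponents X, topologicalKrullDim Z = 1
  no_embedded : ∀ x : X,
    IsLocalRing.maximalIdeal (X.presheaf.stalk x) ∈
      associatedPrimes (X.presheaf.stalk x) (X.presheaf.stalk x) →
    closure {x} ∈ irreducibleComponents X

/-! ### The sheaf of total quotient rings -/

/-- The total ring of fractions of the local ring `𝒪_{X,x}`. -/
abbrev FracStalk (X : Scheme.{u}) (x : X) : Type u := FractionRing (X.presheaf.stalk x)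

/-- The germ at `x` of a section of `𝒪_X`, seen in the total ring of fractions of `𝒪_{X,x}`. -/
noncomputable def germFrac (X : Scheme.{u}) (U : X.Opens) (x : X) (hx : x ∈ U) :
    Γ(X, U) →+* FracStalk X x :=
  (algebraMap (X.presheaf.stalk x) (FracStalk X x)).comp (X.presheaf.germ U x hx).hom

/-- A section of `𝒪_X` over `U` is regular if all its germs are nonzerodivisors. -/
def IsRegularSection (X : Scheme.{u}) (U : X.Opens) (b : Γ(X, U)) : Prop :=
  ∀ (x : X) (hx : x ∈ U), (X.presheaf.germ U x hx).hom b ∈ nonZeroDivisors (X.presheaf.stalk x)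

lemma IsRegularSection.res {X : Scheme.{u}} {U V : X.Opens} (h : V ≤ U) {b : Γ(X, U)}
    (hb : IsRegularSection X U b) :
    IsRegularSection X V ((X.presheaf.map (homOfLE h).op).hom b) := by
  intro x hx
  have := hb x (h hx)
  rwa [← TopCat.Presheaf.germ_res_apply X.presheaf (homOfLE h) x hx b] at this

lemma germFrac_res {X : Scheme.{u}} {U V : X.Opens} (h : V ≤ U) (a : Γ(X, U)) (x : X)
    (hx : x ∈ V) :
    germFrac X V x hx ((X.presheaf.map (homOfLE h).op).hom a) = germFrac X U x (h hx) a := by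
  simp only [germFrac, RingHom.comp_apply]
  congr 1
  exact TopCat.Presheaf.germ_res_apply X.presheaf (homOfLE h) x hx a

/-- The ring `Γ(U, 𝒦_X)` of sections of the sheaf of total quotient rings, i.e. of the sheaf
associated with `V ↦ S(V)⁻¹ 𝒪_X(V)`, where `S(V)` is the set of regular sections over `V`.
Concretely: families of elements of `Frac 𝒪_{X,x}`, `x ∈ U`, which are locally of the form `a / b`
with `b` regular. -/
noncomputable def merSections (X : Scheme.{u}) (U : X.Opens) :
    Subring (∀ x : U, FracStalk X x.1) where
  carrier := {s | ∀ x : U, ∃ (V : X.Opens) (_ : x.1 ∈ V) (hVU : V ≤ U) (a b : Γ(X, V)),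
    IsRegularSection X V b ∧
      ∀ (y : X) (hy : y ∈ V), s ⟨y, hVU hy⟩ * germFrac X V y hy b = germFrac X V y hy a}
  one_mem' := fun x => ⟨U, x.2, le_rfl, 1, 1, fun y hy => by simp [one_mem], by simp⟩
  zero_mem' := fun x => ⟨U, x.2, le_rfl, 0, 1, fun y hy => by simp [one_mem], by simp⟩
  neg_mem' := by
    intro s hs x
    obtain ⟨V, hx, hV, a, b, hb, h⟩ := hs x
    exact ⟨V, hx, hV, -a, b, hb, fun y hy => by simp [← h y hy]⟩
  add_mem' := by
    intro s t hs ht x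
    obtain ⟨V, hx, hV, a, b, hb, h⟩ := hs x
    obtain ⟨W, hx', hW, c, d, hd, h'⟩ := ht x
    refine ⟨V ⊓ W, ⟨hx, hx'⟩, inf_le_left.trans hV,
      (X.presheaf.map (homOfLE (inf_le_left : V ⊓ W ≤ V)).op).hom a *
        (X.presheaf.map (homOfLE (inf_le_right : V ⊓ W ≤ W)).op).hom d +
      (X.presheaf.map (homOfLE (inf_le_left : V ⊓ W ≤ V)).op).hom b *
        (X.presheaf.map (homOfLE (inf_le_right : V ⊓ W ≤ W)).op).hom c,
      (X.presheaf.map (homOfLE (inf_le_left : V ⊓ W ≤ V)).op).hom b *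
        (X.presheaf.map (homOfLE (inf_le_right : V ⊓ W ≤ W)).op).hom d, ?_, ?_⟩
    · intro y hy
      rw [map_mul]
      exact mul_mem (hb.res inf_le_left y hy) (hd.res inf_le_right y hy)
    · intro y hy
      simp only [map_mul, map_add, germFrac_res, Pi.add_apply]
      rw [← h y hy.1, ← h' y hy.2]
      ring
  mul_mem' := by
    intro s t hs ht x
    obtain ⟨V, hx, hV, a, b, hb, h⟩ := hs x
    obtain ⟨W, hx', hW, c, d, hd, h'⟩ := ht x
    refine ⟨V ⊓ W, ⟨hx, hx'⟩, inf_le_left.trans hV,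
      (X.presheaf.map (homOfLE (inf_le_left : V ⊓ W ≤ V)).op).hom a *
        (X.presheaf.map (homOfLE (inf_le_right : V ⊓ W ≤ W)).op).hom c,
      (X.presheaf.map (homOfLE (inf_le_left : V ⊓ W ≤ V)).op).hom b *
        (X.presheaf.map (homOfLE (inf_le_right : V ⊓ W ≤ W)).op).hom d, ?_, ?_⟩
    · intro y hy
      rw [map_mul]
      exact mul_mem (hb.res inf_le_left y hy) (hd.res inf_le_right y hy)
    · intro y hy
      simp only [map_mul, germFrac_res, Pi.mul_apply]
      rw [← h y hy.1, ← h' y hy.2]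
      ring

/-- Restriction of sections of `𝒦_X`. -/
noncomputable def merRes {X : Scheme.{u}} {U V : X.Opens} (h : V ≤ U) :
    merSections X U →+* merSections X V where
  toFun s := ⟨fun x => s.1 ⟨x.1, h x.2⟩, by
    intro x
    obtain ⟨W, hx, hW, a, b, hb, e⟩ := s.2 ⟨x.1, h x.2⟩
    refine ⟨W ⊓ V, ⟨hx, x.2⟩, inf_le_right,
      (X.presheaf.map (homOfLE (inf_le_left : W ⊓ V ≤ W)).op).hom a,
      (X.presheaf.map (homOfLE (inf_le_left : W ⊓ V ≤ W)).op).hom b, hb.res inf_le_left, ?_⟩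
    intro y hy
    simp only [germFrac_res]
    exact e y hy.1⟩
  map_one' := rfl
  map_zero' := rfl
  map_add' _ _ := rfl
  map_mul' _ _ := rfl

/-- The canonical map `Γ(U, 𝒪_X) → Γ(U, 𝒦_X)`. -/
noncomputable def toMer (X : Scheme.{u}) (U : X.Opens) : Γ(X, U) →+* merSections X U where
  toFun a := ⟨fun x => germFrac X U x.1 x.2 a, fun x =>
    ⟨U, x.2, le_rfl, a, 1, fun y hy => by simp [one_mem], fun y hy => by simp⟩⟩
  map_one' := by ext x; simp
  map_zero' := by ext x; simp
  map_add' a b := by ext x; simp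
  map_mul' a b := by ext x; simp

lemma toMer_res {X : Scheme.{u}} {U V : X.Opens} (h : V ≤ U) (a : Γ(X, U)) :
    merRes h (toMer X U a) = toMer X V ((X.presheaf.map (homOfLE h).op).hom a) := by
  ext x
  exact (germFrac_res h a x.1 x.2).symm

/-- Two sections of `𝒦_X` with the same value at `x` agree near `x`. -/
lemma exists_merRes_eq {X : Scheme.{u}} {U : X.Opens} (s t : merSections X U) (x : X)
    (hx : x ∈ U) (h : s.1 ⟨x, hx⟩ = t.1 ⟨x, hx⟩) :
    ∃ (V : X.Opens) (_ : x ∈ V) (hV : V ≤ U), merRes hV s = merRes hV t := by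
  obtain ⟨W, hxW, hW, a, b, hb, e⟩ := (s - t).2 ⟨x, hx⟩
  have h0 : germFrac X W x hxW a = 0 := by
    rw [← e x hxW]
    have : (s - t).1 ⟨x, hx⟩ = 0 := by
      change s.1 ⟨x, hx⟩ - t.1 ⟨x, hx⟩ = 0
      rw [h, sub_self]
    rw [this, zero_mul]
  have h1 : (X.presheaf.germ W x hxW).hom a = (X.presheaf.germ W x hxW).hom 0 := by
    rw [map_zero]
    exact (IsFractionRing.injective (X.presheaf.stalk x) (FracStalk X x))
      (by rw [map_zero]; exact h0)
  obtain ⟨V, hxV, i, j, hij⟩ := X.presheaf.germ_eq x hxW hxW a 0 h1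
  have hVW : V ≤ W := i.le
  refine ⟨V, hxV, hVW.trans hW, ?_⟩
  ext ⟨y, hy⟩
  have hz : germFrac X W y (hVW hy) a = 0 := by
    rw [← germFrac_res hVW a y hy]
    have : (X.presheaf.map (homOfLE hVW).op).hom a = 0 := by
      have := hij
      rw [map_zero] at this
      exact this
    rw [this, map_zero]
  have hm := e y (hVW hy)
  rw [hz] at hm
  have hreg : germFrac X W y (hVW hy) b ∈ nonZeroDivisors (FracStalk X y) :=
    (IsLocalization.map_units (FracStalk X y) (⟨_, hb y (hVW hy)⟩ :
      nonZeroDivisors (X.presheaf.stalk y))).mem_nonZeroDivisors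
  have := (mul_right_mem_nonZeroDivisors_eq_zero_iff hreg).1 hm
  exact sub_eq_zero.1 this

/-! ### Subsheaves of `𝒪_X`-modules of `𝒦_X` -/

/-- A subsheaf of `𝒪_X`-modules of `𝒦_X`. -/
@[ext]
structure MerSubsheaf (X : Scheme.{u}) where
  /-- The sections over an open subset. -/
  sec : (U : X.Opens) → AddSubgroup (merSections X U)
  smul_mem : ∀ (U : X.Opens) (a : Γ(X, U)) (s : merSections X U), s ∈ sec U →
    toMer X U a * s ∈ sec U
  res_mem : ∀ {U V : X.Opens} (h : V ≤ U) (s : merSections X U), s ∈ sec U → merRes h s ∈ sec V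
  glue : ∀ (U : X.Opens) (s : merSections X U),
    (∀ x ∈ U, ∃ (V : X.Opens) (_ : x ∈ V) (h : V ≤ U), merRes h s ∈ sec V) → s ∈ sec U

namespace MerSubsheaf

/-- The stalk `I_x`, as a submodule of `Frac 𝒪_{X,x}`. -/
noncomputable def stalk {X : Scheme.{u}} (I : MerSubsheaf X) (x : X) :
    Submodule (X.presheaf.stalk x) (FracStalk X x) where
  carrier := {z | ∃ (U : X.Opens) (hx : x ∈ U) (s : merSections X U),
    s ∈ I.sec U ∧ s.1 ⟨x, hx⟩ = z}
  zero_mem' := ⟨⊤, trivial, 0, zero_mem _, rfl⟩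
  add_mem' := by
    rintro _ _ ⟨U, hx, s, hs, rfl⟩ ⟨V, hx', t, ht, rfl⟩
    exact ⟨U ⊓ V, ⟨hx, hx'⟩, merRes inf_le_left s + merRes inf_le_right t,
      add_mem (I.res_mem _ _ hs) (I.res_mem _ _ ht), rfl⟩
  smul_mem' := by
    rintro c _ ⟨U, hx, s, hs, rfl⟩
    obtain ⟨V, hx', a, rfl⟩ := X.presheaf.exists_germ_eq c
    refine ⟨U ⊓ V, ⟨hx, hx'⟩, toMer X (U ⊓ V)
      ((X.presheaf.map (homOfLE (inf_le_right : U ⊓ V ≤ V)).op).hom a) * merRes inf_le_left s,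
      I.smul_mem _ _ _ (I.res_mem _ _ hs), ?_⟩
    rw [← toMer_res, Algebra.smul_def]
    rfl

/-- The subsheaf of those sections of `𝒦_X` whose value at each point `x` lies in `N x`. -/
noncomputable def ofStalks {X : Scheme.{u}}
    (N : ∀ x : X, Submodule (X.presheaf.stalk x) (FracStalk X x)) : MerSubsheaf X where
  sec U :=
    { carrier := {s | ∀ x : U, s.1 x ∈ N x.1}
      zero_mem' := fun x => (N x.1).zero_mem
      add_mem' := fun hs ht x => (N x.1).add_mem (hs x) (ht x)
      neg_mem' := fun hs x => (N x.1).neg_mem (hs x) }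
  smul_mem U a s hs x := by
    have := (N x.1).smul_mem ((X.presheaf.germ U x.1 x.2).hom a) (hs x)
    rwa [Algebra.smul_def] at this
  res_mem h s hs x := hs ⟨x.1, h x.2⟩
  glue U s h x := by
    obtain ⟨V, hx, hV, hs⟩ := h x.1 x.2
    exact hs ⟨x.1, hx⟩

lemma mem_sec_iff {X : Scheme.{u}} (I : MerSubsheaf X) (U : X.Opens) (s : merSections X U) :
    s ∈ I.sec U ↔ ∀ x : U, s.1 x ∈ I.stalk x.1 := by
  refine ⟨fun hs x => ⟨U, x.2, s, hs, rfl⟩, fun h => I.glue U s fun x hx => ?_⟩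
  obtain ⟨V, hx', t, ht, e⟩ := h ⟨x, hx⟩
  obtain ⟨W, hxW, hW, e'⟩ := exists_merRes_eq (merRes (inf_le_left : U ⊓ V ≤ U) s)
    (merRes (inf_le_right : U ⊓ V ≤ V) t) x ⟨hx, hx'⟩ e.symm
  refine ⟨W, hxW, hW.trans inf_le_left, ?_⟩
  have := I.res_mem (hW.trans inf_le_right) t ht
  have e'' : merRes (hW.trans inf_le_left) s = merRes (hW.trans inf_le_right) t := e'
  rwa [e'']

lemma ext_stalk {X : Scheme.{u}} {I J : MerSubsheaf X} (h : ∀ x, I.stalk x = J.stalk x) :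
    I = J := by
  ext U s
  rw [mem_sec_iff, mem_sec_iff]
  simp only [h]

lemma stalk_ofStalks {X : Scheme.{u}}
    (N : ∀ x : X, Submodule (X.presheaf.stalk x) (FracStalk X x))
    (hN : ∀ x, ∀ z ∈ N x, ∃ (U : X.Opens) (hx : x ∈ U) (s : merSections X U),
      s.1 ⟨x, hx⟩ = z ∧ ∀ y : U, s.1 y ∈ N y.1) (x : X) :
    (ofStalks N).stalk x = N x := by
  ext z
  constructor
  · rintro ⟨U, hx, s, hs, rfl⟩
    exact hs ⟨x, hx⟩
  · intro hz
    obtain ⟨U, hx, s, e, hs⟩ := hN x z hz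
    exact ⟨U, hx, s, hs, e⟩

/-- The subsheaf `𝒪_X ⊆ 𝒦_X`, the fractional ideal of the divisor `0`. -/
noncomputable instance {X : Scheme.{u}} : One (MerSubsheaf X) := ⟨ofStalks fun _ => 1⟩

/-- The product `I · J ⊆ 𝒦_X`, the fractional ideal of the sum of two divisors. -/
noncomputable instance {X : Scheme.{u}} : Mul (MerSubsheaf X) :=
  ⟨fun I J => ofStalks fun x => I.stalk x * J.stalk x⟩

/-- The inverse `I⁻¹ = {f ∈ 𝒦_X | f · I ⊆ 𝒪_X}`, the fractional ideal of `-D` if `I` is the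
fractional ideal of `D`. -/
noncomputable instance {X : Scheme.{u}} : Inv (MerSubsheaf X) where
  inv I :=
    { sec := fun U =>
        { carrier := {f | ∀ (V : X.Opens) (h : V ≤ U) (g : merSections X V), g ∈ I.sec V →
            merRes h f * g ∈ (1 : MerSubsheaf X).sec V}
          zero_mem' := fun V h g _ => by rw [map_zero, zero_mul]; exact zero_mem _
          add_mem' := fun hs ht V h g hg => by
            rw [map_add, add_mul]
            exact add_mem (hs V h g hg) (ht V h g hg)
          neg_mem' := fun hs V h g hg => by
            rw [map_neg, neg_mul]
            exact neg_mem (hs V h g hg) }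
      smul_mem := fun U a s hs V h g hg => by
        rw [map_mul, toMer_res, mul_assoc]
        exact MerSubsheaf.smul_mem _ _ _ _ (hs V h g hg)
      res_mem := fun h s hs W h' g hg => hs W (h'.trans h) g hg
      glue := fun U s h V hV g hg => by
        refine MerSubsheaf.glue _ _ _ fun x hx => ?_
        obtain ⟨W, hxW, hW, hs⟩ := h x (hV hx)
        refine ⟨V ⊓ W, ⟨hx, hxW⟩, inf_le_left, ?_⟩
        rw [map_mul]
        exact hs (V ⊓ W) inf_le_right _ (I.res_mem inf_le_left g hg) }

/-- The subsheaf `𝒪_X · f ⊆ 𝒦_X` generated by a global section `f` of `𝒦_X`. -/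
noncomputable def principal {X : Scheme.{u}} (f : merSections X ⊤) : MerSubsheaf X :=
  ofStalks fun x => Submodule.span _ {f.1 ⟨x, trivial⟩}

lemma stalk_one {X : Scheme.{u}} (x : X) : (1 : MerSubsheaf X).stalk x = 1 := by
  refine stalk_ofStalks _ (fun x z hz => ?_) x
  obtain ⟨c, rfl⟩ := Submodule.mem_one.1 hz
  obtain ⟨V, hx, a, rfl⟩ := X.presheaf.exists_germ_eq c
  exact ⟨V, hx, toMer X V a, rfl, fun y => Submodule.mem_one.2 ⟨_, rfl⟩⟩

lemma stalk_mul {X : Scheme.{u}} (I J : MerSubsheaf X) (x : X) :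
    (I * J).stalk x = I.stalk x * J.stalk x := by
  refine stalk_ofStalks _ (fun x z hz => ?_) x
  induction hz using Submodule.mul_induction_on' with
  | mem_mul_mem a ha b hb =>
    obtain ⟨U, hx, s, hs, rfl⟩ := ha
    obtain ⟨V, hx', t, ht, rfl⟩ := hb
    refine ⟨U ⊓ V, ⟨hx, hx'⟩, merRes inf_le_left s * merRes inf_le_right t, rfl, fun y => ?_⟩
    have h₁ : s.1 ⟨y.1, y.2.1⟩ ∈ I.stalk y.1 := ⟨U, y.2.1, s, hs, rfl⟩
    have h₂ : t.1 ⟨y.1, y.2.2⟩ ∈ J.stalk y.1 := ⟨V, y.2.2, t, ht, rfl⟩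
    exact Submodule.mul_mem_mul h₁ h₂
  | add a _ b _ ha hb =>
    obtain ⟨U, hx, s, rfl, hs⟩ := ha
    obtain ⟨V, hx', t, rfl, ht⟩ := hb
    exact ⟨U ⊓ V, ⟨hx, hx'⟩, merRes inf_le_left s + merRes inf_le_right t, rfl, fun y =>
      add_mem (hs ⟨y.1, y.2.1⟩) (ht ⟨y.1, y.2.2⟩)⟩

lemma stalk_principal {X : Scheme.{u}} (f : merSections X ⊤) (x : X) :
    (principal f).stalk x = Submodule.span _ {f.1 ⟨x, trivial⟩} := by
  refine stalk_ofStalks _ (fun x z hz => ?_) x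
  obtain ⟨c, rfl⟩ := Submodule.mem_span_singleton.1 hz
  obtain ⟨V, hx, a, rfl⟩ := X.presheaf.exists_germ_eq c
  refine ⟨V, hx, toMer X V a * merRes le_top f, ?_, fun y => ?_⟩
  · rw [Algebra.smul_def]; rfl
  · refine Submodule.mem_span_singleton.2 ⟨(X.presheaf.germ V y.1 y.2).hom a, ?_⟩
    rw [Algebra.smul_def]; rfl

/-- The restriction `I|_U` to an open subscheme, where `𝒦_U` is identified with `𝒦_X|_U` through
the isomorphisms of local rings `𝒪_{X,x} ≅ 𝒪_{U,x}`. -/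
noncomputable def restrict {X : Scheme.{u}} (I : MerSubsheaf X) (U : X.Opens) :
    MerSubsheaf U.toScheme :=
  ofStalks fun x => Submodule.span _
    (IsFractionRing.ringEquivOfRingEquiv (K := FracStalk X (U.ι x)) (L := FracStalk U.toScheme x)
      (asIso (U.ι.stalkMap x)).commRingCatIsoToRingEquiv '' (I.stalk (U.ι x) : Set _))

/-! ### Generalized divisors -/

/-- `I` is coherent: it is locally generated by finitely many sections. (On a locally noetherian
scheme, finitely many sections of `𝒦_X` locally have a common regular denominator, so that a
submodule of finite type of `𝒦_X` is locally isomorphic to an ideal sheaf of finite type, and is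
coherent.) -/
def IsCoherent {X : Scheme.{u}} (I : MerSubsheaf X) : Prop :=
  ∀ x : X, ∃ (V : X.Opens) (_ : x ∈ V) (n : ℕ) (s : Fin n → merSections X V),
    ∀ (y : X) (hy : y ∈ V), I.stalk y = Submodule.span _ (Set.range fun i => (s i).1 ⟨y, hy⟩)

/-- `I` is (the fractional ideal of) a generalized divisor: it is coherent, and nondegenerate,
i.e. `I_η = 𝒦_{X,η}` at each generic point `η` of `X`. -/
structure IsGenDivisor {X : Scheme.{u}} (I : MerSubsheaf X) : Prop where
  isCoherent : I.IsCoherent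
  nondegenerate : ∀ η : X, closure {η} ∈ irreducibleComponents X → I.stalk η = ⊤

/-- `I ⊆ 𝒪_X`. -/
def IsEffective {X : Scheme.{u}} (I : MerSubsheaf X) : Prop :=
  ∀ U : X.Opens, I.sec U ≤ (1 : MerSubsheaf X).sec U

/-- `I` is generated over `V` by the section `f` of `𝒦_X` over `V`. -/
def IsGeneratedOn {X : Scheme.{u}} (I : MerSubsheaf X) (V : X.Opens) (f : merSections X V) :
    Prop :=
  ∀ (y : X) (hy : y ∈ V), I.stalk y = Submodule.span _ {f.1 ⟨y, hy⟩}

/-- `I` is Cartier: it is an invertible fractional ideal, i.e. it is locally generated by an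
invertible section of `𝒦_X`. -/
def IsCartier {X : Scheme.{u}} (I : MerSubsheaf X) : Prop :=
  ∀ x : X, ∃ (V : X.Opens) (_ : x ∈ V) (f : (merSections X V)ˣ), I.IsGeneratedOn V f.1

/-- Linear equivalence: `J = I · (f)` for an invertible global section `f` of `𝒦_X`. -/
def LinEquiv {X : Scheme.{u}} (I J : MerSubsheaf X) : Prop :=
  ∃ f : (merSections X ⊤)ˣ, I * principal f.1 = J

lemma LinEquiv.refl {X : Scheme.{u}} (I : MerSubsheaf X) : I.LinEquiv I := by
  refine ⟨1, ext_stalk fun x => ?_⟩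
  rw [stalk_mul, stalk_principal]
  have : Submodule.span (X.presheaf.stalk x)
      {((1 : (merSections X ⊤)ˣ) : merSections X ⊤).1 ⟨x, trivial⟩} = 1 :=
    Submodule.one_eq_span.symm
  rw [this, mul_one]

lemma LinEquiv.trans {X : Scheme.{u}} {I J L : MerSubsheaf X} (h : I.LinEquiv J)
    (h' : J.LinEquiv L) : I.LinEquiv L := by
  obtain ⟨f, rfl⟩ := h
  obtain ⟨g, rfl⟩ := h'
  refine ⟨f * g, ext_stalk fun x => ?_⟩
  simp only [stalk_mul, stalk_principal]
  rw [mul_assoc, Submodule.span_mul_span, Set.singleton_mul_singleton]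
  rfl

lemma LinEquiv.symm {X : Scheme.{u}} {I J : MerSubsheaf X} (h : I.LinEquiv J) :
    J.LinEquiv I := by
  obtain ⟨f, rfl⟩ := h
  obtain ⟨g, hg⟩ := LinEquiv.refl I
  refine ⟨f⁻¹, ext_stalk fun x => ?_⟩
  simp only [stalk_mul, stalk_principal]
  rw [mul_assoc, Submodule.span_mul_span, Set.singleton_mul_singleton]
  have : (f.1.1 ⟨x, trivial⟩ * (f⁻¹).1.1 ⟨x, trivial⟩ : FracStalk X x) = 1 :=
    congrFun (congrArg Subtype.val f.mul_inv) ⟨x, trivial⟩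
  rw [this, ← Submodule.one_eq_span, mul_one]

end MerSubsheaf

/-- The set `GDiv(X)` of generalized divisors, given by their fractional ideals. -/
def GDiv (X : Scheme.{u}) : Type u := {I : MerSubsheaf X // I.IsGenDivisor}

/-- Linear equivalence on `GDiv(X)`. -/
def GDiv.setoid (X : Scheme.{u}) : Setoid (GDiv X) where
  r D E := D.1.LinEquiv E.1
  iseqv := ⟨fun D => .refl D.1, fun h => h.symm, fun h h' => h.trans h'⟩

/-- `GPic(X) = GDiv(X) / Prin(X)`. -/
def GPic (X : Scheme.{u}) : Type u := Quotient (GDiv.setoid X)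

/-- The class of a generalized divisor in `GPic(X)`. -/
def GDiv.toGPic {X : Scheme.{u}} (D : GDiv X) : GPic X := Quotient.mk (GDiv.setoid X) D

/-! ### The direct image -/

/-- The `0`-th Fitting ideal of a finitely generated module: it is generated by the maximal minors
of the matrices of relations in the presentations of `M`, i.e. by the determinants of the
`r × r` matrices whose rows are relations between the members of a generating family of length `r`.
(For a fixed generating family, these determinants generate an ideal that does not depend on the
family.) -/
def fittingIdeal (R : Type*) [CommRing R] (M : Type*) [AddCommGroup M] [Module R M] : Ideal R :=
  Ideal.span {d | ∃ (r : ℕ) (m : Fin r → M) (A : Matrix (Fin r) (Fin r) R),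
    Submodule.span R (Set.range m) = ⊤ ∧ (∀ i, ∑ j, A i j • m j = 0) ∧ d = A.det}

/-- The ideal `Γ(U, I ∩ 𝒪_X)` of `Γ(U, 𝒪_X)`; it is `Γ(U, I)` if `I ⊆ 𝒪_X`. -/
noncomputable def MerSubsheaf.idealOn {X : Scheme.{u}} (I : MerSubsheaf X) (U : X.Opens) :
    Ideal Γ(X, U) where
  carrier := {a | toMer X U a ∈ I.sec U}
  zero_mem' := by simp [zero_mem]
  add_mem' := fun ha hb => by
    simp only [Set.mem_ofPred_eq, map_add] at *
    exact add_mem ha hb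
  smul_mem' := fun c a ha => by
    simp only [Set.mem_ofPred_eq, smul_eq_mul, map_mul] at *
    exact I.smul_mem U c _ ha

/-- For an affine open `V ⊆ Y` with affine preimage and a coherent ideal `I ⊆ 𝒪_X`, the `0`-th
Fitting ideal of the `Γ(V, 𝒪_Y)`-module
`Γ(V, π_*(𝒪_X / I)) = Γ(π⁻¹V, 𝒪_X) / Γ(π⁻¹V, I)`. -/
noncomputable def fittingOn {X Y : Scheme.{u}} (π : X ⟶ Y) (I : MerSubsheaf X) (V : Y.Opens) :
    Ideal Γ(Y, V) :=
  letI := (π.app V).hom.toAlgebra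
  fittingIdeal Γ(Y, V) (Γ(X, π ⁻¹ᵁ V) ⧸ I.idealOn (π ⁻¹ᵁ V))

/-- The subsheaf `Fitt₀(π_*(𝒪_X / I)) ⊆ 𝒪_Y ⊆ 𝒦_Y`, generated by the Fitting ideals on the affine
open subsets of `Y`. -/
noncomputable def fittingSheaf {X Y : Scheme.{u}} (π : X ⟶ Y) (I : MerSubsheaf X) :
    MerSubsheaf Y :=
  MerSubsheaf.ofStalks fun y => Submodule.span _
    {z | ∃ (V : Y.Opens) (hy : y ∈ V) (a : Γ(Y, V)),
      IsAffineOpen V ∧ a ∈ fittingOn π I V ∧ z = germFrac Y V y hy a}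

/-- `D = D' - E` with `D'` effective and `E` effective Cartier. -/
def IsEffectiveDifference {X : Scheme.{u}} (I : MerSubsheaf X) (D' E : GDiv X) : Prop :=
  D'.1.IsEffective ∧ E.1.IsEffective ∧ E.1.IsCartier ∧ I = D'.1 * E.1⁻¹

open Classical in
/-- The direct image of a generalized divisor: `π_*(D) = π_*(D') - π_*(E)` for a choice of `D'`
effective and `E` effective Cartier with `D = D' - E`, where the direct image of an effective
divisor with ideal sheaf `I` is given by the `0`-th Fitting ideal of `π_*(𝒪_X / I)`. -/
noncomputable def directImage {X Y : Scheme.{u}} (π : X ⟶ Y) (I : MerSubsheaf X) :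
    MerSubsheaf Y :=
  if h : ∃ p : GDiv X × GDiv X, IsEffectiveDifference I p.1 p.2 then
    fittingSheaf π h.choose.1.1 * (fittingSheaf π h.choose.2.1)⁻¹
  else 1

/-- The norm `Γ(V, π_*𝒪_X) → Γ(V, 𝒪_Y)`, the determinant of multiplication, for `V` such that
`Γ(V, π_*𝒪_X)` is a finite free `Γ(V, 𝒪_Y)`-module. -/
noncomputable def normOn {X Y : Scheme.{u}} (π : X ⟶ Y) (V : Y.Opens) (f : Γ(X, π ⁻¹ᵁ V)) :
    Γ(Y, V) :=
  letI := (π.app V).hom.toAlgebra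
  Algebra.norm Γ(Y, V) f

/-- `J` is the classical direct image (norm) of the Cartier divisor with fractional ideal `I`:
there is a cover of `Y` by affine open subsets `V` over which `π_*𝒪_X` is finite free and `I` is
generated on `π⁻¹V` by a quotient `h = f / g` of regular sections, and `J` is generated on `V` by
the quotient `k = N(f) / N(g)` of their norms. -/
def IsNormDirectImage {X Y : Scheme.{u}} (π : X ⟶ Y) (I : MerSubsheaf X) (J : MerSubsheaf Y) :
    Prop :=
  ∀ y : Y, ∃ (V : Y.Opens) (_ : y ∈ V) (f g : Γ(X, π ⁻¹ᵁ V)) (h : (merSections X (π ⁻¹ᵁ V))ˣ)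
    (k : (merSections Y V)ˣ),
    IsAffineOpen V ∧
    (letI := (π.app V).hom.toAlgebra
     Module.Free Γ(Y, V) Γ(X, π ⁻¹ᵁ V) ∧ Module.Finite Γ(Y, V) Γ(X, π ⁻¹ᵁ V)) ∧
    IsRegularSection X (π ⁻¹ᵁ V) f ∧ IsRegularSection X (π ⁻¹ᵁ V) g ∧
    h.1 * toMer X (π ⁻¹ᵁ V) g = toMer X (π ⁻¹ᵁ V) f ∧ I.IsGeneratedOn (π ⁻¹ᵁ V) h.1 ∧
    IsRegularSection Y V (normOn π V f) ∧ IsRegularSection Y V (normOn π V g) ∧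
    k.1 * toMer Y V (normOn π V g) = toMer Y V (normOn π V f) ∧ J.IsGeneratedOn V k.1

/-! ### Fitting ideals -/

section Fitting

variable {R M : Type*} [CommRing R] [AddCommGroup M] [Module R M]

/-! Everything rests on one computation. Let `S` be a finite free `R`-algebra with basis `e`. A
matrix of relations between the classes of `e` in `S ⧸ I` is a matrix whose rows are the coordinates
of elements of `I`. Replacing `I` by `g * I` multiplies each such matrix by the matrix of
multiplication by `g`, so the Fitting ideal is multiplied by the norm of `g`
(`fittingIdeal_quotient_span_mul`). The norm of a nonzerodivisor is again a nonzerodivisor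
(`norm_mem_nonZeroDivisors`), by an argument with associated primes.

To apply this on `Y`, one needs small affine `V` over which `π_*𝒪_X` is free (finite flat over
noetherian) and over which an effective Cartier divisor has a single equation on all of `π⁻¹V`. The
latter holds because fibres are finite: local equations at the points of a fibre are combined with
functions separating these points, and the result spreads out since `π` is closed
(`MerSubsheaf.IsCartier.exists_generator`). Hence `fittingSheaf` is multiplicative as soon as one
factor is effective Cartier, and it sends effective Cartier divisors to Cartier divisors. If `D' - E
= D'' - E'`, then `D' + E' = D'' + E`; applying the Fitting sheaf and cancelling the Cartier terms
shows that the direct image is well defined. Its value on negatives and on sums then follows by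
choosing suitable presentations.

That the Fitting ideals on affine open subsets form a sheaf with the expected stalks
(`stalk_fittingSheaf`) needs two facts: Fitting ideals commute with localization, and an effective
coherent subsheaf of `𝒦_X` is quasi-coherent (`IsCoherent.exists_pow_mul_mem_idealOn`).

The dimension of `X` enters in the existence of a presentation `D = D' - E`. Zeros of a regular
section are isolated closed points, so a local denominator is a unit away from the one point for
which it was chosen. The divisor `E` can therefore be prescribed point by point.

For linear equivalence, an invertible `f` is locally on `Y` a quotient `a / b` of regular sections.
The quotients `N(a) / N(b)` glue to an invertible section of `𝒦_Y` that generates the direct image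
of `(f)`, and additivity does the rest. -/

/-- The ideal generated by the determinants of square matrices of relations between the members
of a fixed finite family. -/
def relationDetIdeal {ι : Type*} [Fintype ι] [DecidableEq ι] (R : Type*) [CommRing R] [Module R M]
    (m : ι → M) : Ideal R :=
  Ideal.span {d | ∃ A : Matrix ι ι R, (∀ i, ∑ j, A i j • m j = 0) ∧ d = A.det}

lemma relationDetIdeal_comp_equiv {ι κ : Type*} [Fintype ι] [DecidableEq ι] [Fintype κ]
    [DecidableEq κ] (e : κ ≃ ι) (m : ι → M) :
    relationDetIdeal R (m ∘ e) = relationDetIdeal R m := by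
  refine le_antisymm (Ideal.span_le.2 ?_) (Ideal.span_le.2 ?_)
  · rintro _ ⟨A, hA, rfl⟩
    refine Ideal.subset_span ⟨A.submatrix e.symm e.symm, fun i => ?_,
      (Matrix.det_submatrix_equiv_self _ _).symm⟩
    rw [← hA (e.symm i), ← e.sum_comp]
    simp
  · rintro _ ⟨A, hA, rfl⟩
    refine Ideal.subset_span ⟨A.submatrix e e, fun i => ?_,
      (Matrix.det_submatrix_equiv_self _ _).symm⟩
    rw [← hA (e i), ← e.sum_comp (fun j => A (e i) j • m j)]
    simp

/-- A redundant generator does not enlarge the ideal of determinants of relations. -/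
lemma relationDetIdeal_cons_le {n : ℕ} (x : M) (m : Fin n → M)
    (hx : x ∈ Submodule.span R (Set.range m)) :
    relationDetIdeal R (Fin.cons x m : Fin (n + 1) → M) ≤ relationDetIdeal R m := by
  obtain ⟨c, rfl⟩ := (Submodule.mem_span_range_iff_exists_fun R).1 hx
  refine Ideal.span_le.2 ?_
  rintro _ ⟨A, hA, rfl⟩
  -- Adding `c j` times column `0` to column `j + 1` keeps the determinant. As `x = ∑ c j • m j`,
  -- the last `n` entries of every row of `B` are now a relation between the `m j`, so all minors in
  -- the expansion along column `0` lie in the smaller ideal.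
  set B : Matrix (Fin (n + 1)) (Fin (n + 1)) R :=
    Matrix.of fun i j => A i j + (Fin.cons 0 c : Fin (n + 1) → R) j * A i 0 with hB
  have hdet : A.det = B.det := by
    rw [← Matrix.det_transpose A, ← Matrix.det_transpose B]
    refine (Matrix.det_eq_of_forall_row_eq_smul_add_const (Fin.cons 0 c : Fin (n + 1) → R) 0
      rfl fun i j => ?_).symm
    simp [hB]
  rw [SetLike.mem_coe, hdet, Matrix.det_succ_column_zero]
  refine Ideal.sum_mem _ fun i _ => Ideal.mul_mem_left _ _ (Ideal.subset_span ⟨_, fun k => ?_, rfl⟩)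
  have := hA (i.succAbove k)
  rw [Fin.sum_univ_succ] at this
  simp only [Fin.cons_zero, Fin.cons_succ] at this
  rw [← this]
  simp only [hB, Matrix.submatrix_apply, Matrix.of_apply, Fin.cons_succ, add_smul,
    Finset.sum_add_distrib, Finset.smul_sum, smul_smul]
  rw [add_comm]
  congr 1
  exact Finset.sum_congr rfl fun j _ => by rw [mul_comm]

lemma relationDetIdeal_append_le {r n : ℕ} (m' : Fin r → M) (m : Fin n → M)
    (hm : ∀ i, m' i ∈ Submodule.span R (Set.range m)) :
    relationDetIdeal R (Fin.append m' m) ≤ relationDetIdeal R m := by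
  induction r with
  | zero =>
    have : Fin.append m' m = m ∘ finCongr (Nat.zero_add n) := by
      rw [Subsingleton.elim m' Fin.elim0, Fin.elim0_append]; rfl
    rw [this, relationDetIdeal_comp_equiv]
  | succ r ih =>
    have e : Fin.append m' m = (Fin.cons (m' 0) (Fin.append (Fin.tail m') m) :
        Fin (r + n + 1) → M) ∘ finCongr (Nat.succ_add r n) := by
      conv_lhs => rw [← Fin.cons_self_tail m']
      rw [Fin.append_cons]; rfl
    rw [e, relationDetIdeal_comp_equiv]
    refine (relationDetIdeal_cons_le _ _ ?_).trans (ih (Fin.tail m') fun i => hm i.succ)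
    refine Submodule.span_mono ?_ (hm 0)
    rintro _ ⟨i, rfl⟩
    exact ⟨Fin.natAdd r i, by simp⟩

lemma relationDetIdeal_le_append {r n : ℕ} (m' : Fin r → M) (m : Fin n → M)
    (hm : ∀ i, m i ∈ Submodule.span R (Set.range m')) :
    relationDetIdeal R m' ≤ relationDetIdeal R (Fin.append m' m) := by
  choose D hD using fun i => (Submodule.mem_span_range_iff_exists_fun R).1 (hm i)
  have e : Fin.append m' m ∘ finSumFinEquiv = Sum.elim m' m := by
    ext i; cases i <;> simp
  rw [← relationDetIdeal_comp_equiv finSumFinEquiv, e]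
  refine Ideal.span_le.2 ?_
  rintro _ ⟨A, hA, rfl⟩
  -- The added rows record that each `m i` is a combination of the `m'`. The block determinant is
  -- `det A * det (-1)`, and the second factor `det (-1)` undoes the sign.
  have hdet : A.det = (Matrix.fromBlocks A 0 (Matrix.of D) (-1)).det *
      (-1 : Matrix (Fin n) (Fin n) R).det := by
    rw [Matrix.det_fromBlocks_zero₁₂, mul_assoc, ← Matrix.det_mul]
    simp
  rw [SetLike.mem_coe, hdet]
  refine Ideal.mul_mem_right _ _ (Ideal.subset_span ⟨_, ?_, rfl⟩)
  rintro (i | i)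
  · simpa using hA i
  · simp [Fintype.sum_sum_type, hD, Matrix.one_apply, ite_smul]

/-- Both families are compared with their concatenation. -/
lemma relationDetIdeal_le {r n : ℕ} (m' : Fin r → M) (m : Fin n → M)
    (hm' : ∀ i, m' i ∈ Submodule.span R (Set.range m))
    (hm : ∀ i, m i ∈ Submodule.span R (Set.range m')) :
    relationDetIdeal R m' ≤ relationDetIdeal R m :=
  (relationDetIdeal_le_append m' m hm).trans (relationDetIdeal_append_le m' m hm')

/-- The Fitting ideal may be computed from any finite generating family. -/
lemma fittingIdeal_eq_relationDetIdeal {ι : Type*} [Fintype ι] [DecidableEq ι] (m : ι → M)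
    (hm : Submodule.span R (Set.range m) = ⊤) :
    fittingIdeal R M = relationDetIdeal R m := by
  rw [← relationDetIdeal_comp_equiv (Fintype.equivFin ι).symm]
  set m₀ := m ∘ (Fintype.equivFin ι).symm with hm₀
  have hs : Submodule.span R (Set.range m₀) = ⊤ := by
    rw [hm₀, (Fintype.equivFin ι).symm.surjective.range_comp, hm]
  refine le_antisymm (Ideal.span_le.2 ?_) (Ideal.span_le.2 ?_)
  · rintro _ ⟨r, m', A, hm', hA, rfl⟩
    exact relationDetIdeal_le m' m₀ (fun i => hs ▸ trivial) (fun i => hm' ▸ trivial)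
      (Ideal.subset_span ⟨A, hA, rfl⟩)
  · rintro _ ⟨A, hA, rfl⟩
    exact Ideal.subset_span ⟨_, m₀, A, hs, hA, rfl⟩

/-- The empty family generates the zero module, and the empty determinant is `1`. -/
lemma fittingIdeal_of_subsingleton [Subsingleton M] : fittingIdeal R M = ⊤ := by
  rw [fittingIdeal_eq_relationDetIdeal (Fin.elim0 : Fin 0 → M) (Subsingleton.elim _ _),
    Ideal.eq_top_iff_one]
  exact Ideal.subset_span ⟨1, fun i => i.elim0, by simp⟩

/-- The formation of the Fitting ideal commutes with localization. -/
lemma fittingIdeal_eq_map {R' M' : Type*} [CommRing R'] [AddCommGroup M'] [Module R' M']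
    [Module.Finite R M] (σ : R →+* R') (φ : M →+ M') (hφs : ∀ (r : R) m, φ (r • m) = σ r • φ m)
    (hσ : ∀ r', ∃ t r, IsUnit (σ t) ∧ σ t * r' = σ r)
    (hφ : ∀ m', ∃ t m, IsUnit (σ t) ∧ σ t • m' = φ m)
    (hker : ∀ m, φ m = 0 → ∃ t, IsUnit (σ t) ∧ t • m = 0) :
    fittingIdeal R' M' = (fittingIdeal R M).map σ := by
  obtain ⟨n, m, hm⟩ := Module.Finite.exists_fin (R := R) (M := M)
  have hspan : Submodule.span R' (Set.range (φ ∘ m)) = ⊤ := by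
    refine eq_top_iff.2 fun m' _ => ?_
    obtain ⟨t, x, ht, hx⟩ := hφ m'
    have h1 : φ x ∈ Submodule.span R' (Set.range (φ ∘ m)) := by
      obtain ⟨c, rfl⟩ := (Submodule.mem_span_range_iff_exists_fun R).1
        (show x ∈ Submodule.span R (Set.range m) by rw [hm]; trivial)
      rw [map_sum]
      refine Submodule.sum_mem _ fun i _ => ?_
      rw [hφs]
      exact Submodule.smul_mem _ _ (Submodule.subset_span ⟨i, rfl⟩)
    rw [← hx] at h1
    exact (Submodule.smul_mem_iff_of_isUnit _ ht).1 h1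
  rw [fittingIdeal_eq_relationDetIdeal m hm, fittingIdeal_eq_relationDetIdeal _ hspan]
  refine le_antisymm (Ideal.span_le.2 ?_) ?_
  · rintro _ ⟨A, hA, rfl⟩
    choose t r ht hr using fun p : Fin n × Fin n => hσ (A p.1 p.2)
    -- A common denominator for all entries of `A`.
    set T := ∏ p, t p
    have hT : IsUnit (σ T) := by
      rw [map_prod]
      exact IsUnit.prod_univ_iff.2 ht
    have hB : ∀ i j, ∃ b, σ T * A i j = σ b := fun i j => by
      refine ⟨(∏ p ∈ Finset.univ.erase (i, j), t p) * r (i, j), ?_⟩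
      rw [map_mul, ← hr (i, j), ← mul_assoc, ← map_mul,
        Finset.prod_erase_mul _ _ (Finset.mem_univ _)]
    choose B hB using hB
    -- The rows of `B` are relations only after applying `φ`; one more factor per row turns them
    -- into relations in `M`. All the factors introduced become units in `R'`, hence do not affect
    -- membership of the determinant.
    have hk : ∀ i, ∃ s, IsUnit (σ s) ∧ s • ∑ j, B i j • m j = 0 := fun i => by
      refine hker _ ?_
      rw [map_sum]
      simp only [hφs, ← hB, mul_smul, ← Finset.smul_sum]
      have := hA i
      simp only [Function.comp_apply] at this
      rw [this, smul_zero]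
    choose s hs hsB using hk
    have hdet : (Matrix.of fun i j => s i * B i j).det ∈ relationDetIdeal R m := by
      refine Ideal.subset_span ⟨_, fun i => ?_, rfl⟩
      rw [← hsB i, Finset.smul_sum]
      exact Finset.sum_congr rfl fun j _ => by rw [smul_smul]; rfl
    have h2 := Ideal.mem_map_of_mem σ hdet
    have h3 : (σ (Matrix.of fun i j => s i * B i j).det) =
        (∏ i, σ (s i)) * (σ T ^ n * A.det) := by
      have h5 : σ T ^ n * A.det = (Matrix.of fun i j => σ (B i j)).det := by
        have := Matrix.det_smul A (σ T)
        rw [Fintype.card_fin] at this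
        rw [← this]
        congr 1
        ext i j
        simp [hB]
      have h4 : (Matrix.of fun i j => σ (s i) * σ (B i j)).det =
          (∏ i, σ (s i)) * (Matrix.of fun i j => σ (B i j)).det := by
        rw [← Matrix.det_mul_column]; rfl
      rw [h5, ← h4, RingHom.map_det]
      congr 1
      ext i j
      simp
    rw [h3] at h2
    rwa [Ideal.unit_mul_mem_iff_mem _ (IsUnit.prod_univ_iff.2 hs),
      Ideal.unit_mul_mem_iff_mem _ (hT.pow n)] at h2
  · rw [Ideal.map_le_iff_le_comap]
    refine Ideal.span_le.2 ?_
    rintro _ ⟨A, hA, rfl⟩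
    refine Ideal.subset_span ⟨σ.mapMatrix A, fun i => ?_, RingHom.map_det _ _⟩
    have := congrArg φ (hA i)
    rw [map_sum, map_zero] at this
    rw [← this]
    exact Finset.sum_congr rfl fun j _ => (hφs _ _).symm

end Fitting

/-! ### Fitting ideals of quotients of a finite algebra, and norms -/

section FittingQuotient

variable {R S : Type*} [CommRing R] [CommRing S] [Algebra R S]

/-- The hypotheses describe localization without naming a multiplicative set: the denominators are
any elements that become units in `R'`. This covers restriction to basic open subsets and, with
denominator `1`, isomorphisms. -/
lemma fittingIdeal_quotient_eq_map {R' S' : Type*} [CommRing R'] [CommRing S'] [Algebra R' S']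
    [Module.Finite R S] (σ : R →+* R') (τ : S →+* S')
    (hc : ∀ r, τ (algebraMap R S r) = algebraMap R' S' (σ r)) (I : Ideal S) (I' : Ideal S')
    (hσ : ∀ r', ∃ t r, IsUnit (σ t) ∧ σ t * r' = σ r)
    (hτ : ∀ s', ∃ t s, IsUnit (σ t) ∧ algebraMap R' S' (σ t) * s' = τ s)
    (hI : I ≤ I'.comap τ)
    (hI' : ∀ s, τ s ∈ I' → ∃ t, IsUnit (σ t) ∧ algebraMap R S t * s ∈ I) :
    fittingIdeal R' (S' ⧸ I') = (fittingIdeal R (S ⧸ I)).map σ := by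
  refine fittingIdeal_eq_map σ (Ideal.quotientMap I' τ hI).toAddMonoidHom ?_ hσ ?_ ?_
  · intro r m
    obtain ⟨s, rfl⟩ := Ideal.Quotient.mk_surjective m
    have h1 : r • Ideal.Quotient.mk I s = Ideal.Quotient.mk I (algebraMap R S r * s) := by
      rw [← Algebra.smul_def]; rfl
    have h2 : ∀ s', σ r • Ideal.Quotient.mk I' s' =
        Ideal.Quotient.mk I' (algebraMap R' S' (σ r) * s') := fun s' => by
      rw [← Algebra.smul_def]; rfl
    simp only [RingHom.toAddMonoidHom_eq_coe, AddMonoidHom.coe_coe]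
    rw [h1, Ideal.quotientMap_mk, Ideal.quotientMap_mk, h2, map_mul τ, hc]
  · intro m
    obtain ⟨s', rfl⟩ := Ideal.Quotient.mk_surjective m
    obtain ⟨t, s, ht, h⟩ := hτ s'
    refine ⟨t, Ideal.Quotient.mk I s, ht, ?_⟩
    have h2 : σ t • Ideal.Quotient.mk I' s' =
        Ideal.Quotient.mk I' (algebraMap R' S' (σ t) * s') := by
      rw [← Algebra.smul_def]; rfl
    simp only [RingHom.toAddMonoidHom_eq_coe, AddMonoidHom.coe_coe]
    rw [Ideal.quotientMap_mk, h2, h]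
  · intro m hm
    obtain ⟨s, rfl⟩ := Ideal.Quotient.mk_surjective m
    simp only [RingHom.toAddMonoidHom_eq_coe, AddMonoidHom.coe_coe] at hm
    rw [Ideal.quotientMap_mk, Ideal.Quotient.eq_zero_iff_mem] at hm
    obtain ⟨t, ht, h⟩ := hI' s hm
    refine ⟨t, ht, ?_⟩
    have h1 : t • Ideal.Quotient.mk I s = Ideal.Quotient.mk I (algebraMap R S t * s) := by
      rw [← Algebra.smul_def]; rfl
    rw [h1, Ideal.Quotient.eq_zero_iff_mem]
    exact h

/-- A row is a relation between the classes of the basis exactly when it is the coordinate vector of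
an element of `I`. -/
lemma fittingIdeal_quotient_eq_span {ι : Type*} [Fintype ι] [DecidableEq ι] (e : Module.Basis ι R S)
    (I : Ideal S) : fittingIdeal R (S ⧸ I) =
      Ideal.span {d | ∃ A : Matrix ι ι R, (∀ i, ∑ j, A i j • e j ∈ I) ∧ d = A.det} := by
  rw [fittingIdeal_eq_relationDetIdeal (fun i => Ideal.Quotient.mk I (e i))]
  · unfold relationDetIdeal
    congr 1
    ext d
    refine exists_congr fun A => and_congr_left fun _ => forall_congr' fun i => ?_
    rw [← Ideal.Quotient.eq_zero_iff_mem, map_sum]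
    rfl
  · have : Set.range (fun i => Ideal.Quotient.mk I (e i)) =
        (Ideal.Quotient.mkₐ R I).toLinearMap '' Set.range e := by
      rw [← Set.range_comp]; rfl
    rw [this, Submodule.span_image, e.span_eq, Submodule.map_top, LinearMap.range_eq_top]
    exact Ideal.Quotient.mk_surjective

/-- Multiplying an ideal by an element `g` multiplies the Fitting ideal of the quotient by the norm
of `g`. -/
lemma fittingIdeal_quotient_span_mul [Module.Free R S] [Module.Finite R S] (g : S) (I : Ideal S) :
    fittingIdeal R (S ⧸ (Ideal.span {g} * I)) =
      Ideal.span {Algebra.norm R g} * fittingIdeal R (S ⧸ I) := by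
  classical
  rcases subsingleton_or_nontrivial R with h | h
  · exact Subsingleton.elim _ _
  let ι := Module.Free.ChooseBasisIndex R S
  let e : Module.Basis ι R S := Module.Free.chooseBasis R S
  -- If a row of `W` holds the coordinates of `w`, the same row of the product holds those of `g *
  -- w`. The transpose is there because `leftMulMatrix` stores coordinates in columns.
  have hmul : ∀ (W : Matrix ι ι R) (i : ι),
      ∑ j, (W * (Algebra.leftMulMatrix e g).transpose) i j • e j =
      g * ∑ j, W i j • e j := fun W i => by
    have h1 : ∀ k, g * e k = ∑ j, Algebra.leftMulMatrix e g j k • e j := fun k => by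
      rw [← e.sum_repr (g * e k)]
      simp [Algebra.leftMulMatrix_eq_repr_mul]
    simp_rw [Matrix.mul_apply, Matrix.transpose_apply, Finset.sum_smul, Finset.mul_sum,
      mul_smul_comm, h1, Finset.smul_sum, mul_smul]
    exact Finset.sum_comm
  have hdet : ∀ W : Matrix ι ι R, (W * (Algebra.leftMulMatrix e g).transpose).det =
      Algebra.norm R g * W.det := fun W => by
    rw [Matrix.det_mul, Matrix.det_transpose, Algebra.norm_eq_matrix_det e, mul_comm]
  rw [fittingIdeal_quotient_eq_span e, fittingIdeal_quotient_eq_span e]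
  refine le_antisymm (Ideal.span_le.2 ?_) ?_
  · rintro _ ⟨A, hA, rfl⟩
    -- Each row of `A` represents some `g * w i` with `w i ∈ I`, so `A` factors through the
    -- coordinate matrix of the `w i`.
    choose w hw hwA using fun i => Ideal.mem_span_singleton_mul.1 (hA i)
    have hAW : A = (Matrix.of fun i j => e.repr (w i) j) *
        (Algebra.leftMulMatrix e g).transpose := by
      ext i j
      have : ∑ j, A i j • e j = ∑ j, ((Matrix.of fun i j => e.repr (w i) j) *
        (Algebra.leftMulMatrix e g).transpose) i j • e j := by
        rw [hmul, ← hwA i]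
        simp [e.sum_repr]
      have h2 := congrArg (fun z => e.repr z j) this
      simpa [Finsupp.single_apply] using h2
    rw [hAW, SetLike.mem_coe, hdet]
    refine Ideal.mul_mem_mul (Ideal.mem_span_singleton_self _)
      (Ideal.subset_span ⟨_, fun i => ?_, rfl⟩)
    simpa [e.sum_repr] using hw i
  · rw [Ideal.span_mul_span']
    refine Ideal.span_le.2 ?_
    rintro _ ⟨_, rfl, _, ⟨W, hW, rfl⟩, rfl⟩
    refine Ideal.subset_span ⟨W * (Algebra.leftMulMatrix e g).transpose, fun i => ?_, (hdet W).symm⟩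
    rw [hmul]
    exact Ideal.mul_mem_mul (Ideal.mem_span_singleton_self _) (hW i)

/-- The norm of a nonzerodivisor is a nonzerodivisor. -/
lemma norm_mem_nonZeroDivisors [IsNoetherianRing R] [Module.Free R S] [Module.Finite R S] {g : S}
    (hg : g ∈ nonZeroDivisors S) : Algebra.norm R g ∈ nonZeroDivisors R := by
  classical
  let e := Module.Free.chooseBasis R S
  refine mem_nonZeroDivisors_iff_right.2 fun c hc => by_contra fun hc0 => ?_
  -- If a nonzero `c` kills the norm, the norm lies in an associated prime `p`, the annihilator of
  -- some `z`. The matrix of `g` is then singular over the domain `R ⧸ p`. A nonzero kernel vector,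
  -- lifted to `w` and multiplied by `z`, gives an element of `S` killed by `g`; as `g` is a
  -- nonzerodivisor, all `w k * z` vanish, so `w` is zero modulo `p`.
  obtain ⟨p, hp, hle⟩ := exists_le_isAssociatedPrime_of_isNoetherianRing R c hc0
  obtain ⟨hprime, z, hz⟩ := isAssociatedPrime_iff.1 hp
  have hann : ∀ r : R, r ∈ p ↔ r * z = 0 := fun r => by
    rw [hz, Submodule.mem_colon_singleton, Submodule.mem_bot, smul_eq_mul]
  have hdet : (Algebra.leftMulMatrix e g).det ∈ p := by
    rw [← Algebra.norm_eq_matrix_det e]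
    apply hle
    rw [Submodule.mem_colon_singleton, Submodule.mem_bot, smul_eq_mul, mul_comm, hc]
  have : ((Ideal.Quotient.mk p).mapMatrix (Algebra.leftMulMatrix e g)).det = 0 := by
    rw [← RingHom.map_det, Ideal.Quotient.eq_zero_iff_mem]
    exact hdet
  obtain ⟨v, hv0, hv⟩ := Matrix.exists_mulVec_eq_zero_iff.2 this
  choose w hw using fun i => Ideal.Quotient.mk_surjective (v i)
  obtain rfl : (fun i => Ideal.Quotient.mk p (w i)) = v := funext hw
  have hmem : ∀ j, (Algebra.leftMulMatrix e g).mulVec w j ∈ p := fun j => by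
    rw [← Ideal.Quotient.eq_zero_iff_mem]
    refine Eq.trans ?_ (congrFun hv j)
    simp [Matrix.mulVec, dotProduct]
  apply hv0
  funext i
  simp only [Pi.zero_apply, Ideal.Quotient.eq_zero_iff_mem, hann]
  have hzero : (∑ k, (w k * z) • e k) * g = 0 := by
    apply e.repr.injective
    ext j
    have h1 : e.repr (g * ∑ k, (w k * z) • e k) =
      (Algebra.leftMulMatrix e g).mulVec (fun k => w k * z) := by
      rw [← Algebra.leftMulMatrix_mulVec_repr]
      congr 1
      ext k
      simp [Finsupp.single_apply]
    rw [mul_comm, h1]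
    have h2 : (Algebra.leftMulMatrix e g).mulVec (fun k => w k * z) j =
      (Algebra.leftMulMatrix e g).mulVec w j * z := by
      simp [Matrix.mulVec, dotProduct, Finset.sum_mul, mul_assoc]
    rw [h2, (hann _).1 (hmem j)]
    simp
  have := mem_nonZeroDivisors_iff_right.1 hg _ hzero
  have h3 := congrArg (fun s => e.repr s i) this
  simpa [Finsupp.single_apply] using h3

end FittingQuotient

/-! ### Subsheaves of `𝒦_X` -/

/-- At a generic point of an irreducible component, nonzerodivisors are units. -/
lemma isUnit_of_mem_nonZeroDivisors_stalk {X : Scheme.{u}} {η : X}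
    (hη : closure {η} ∈ irreducibleComponents X) {a : X.presheaf.stalk η}
    (ha : a ∈ nonZeroDivisors (X.presheaf.stalk η)) : IsUnit a := by
  by_contra hu
  have hnil : IsNilpotent a := by
    -- The primes of the stalk correspond to the generalizations of `η`, and a generic point has no
    -- proper ones. So the maximal ideal is the only prime and a nonunit is nilpotent.
    rw [nilpotent_iff_mem_prime]
    intro p hp
    have hspec : X.fromSpecStalk η ⟨p, hp⟩ ⤳ η := by
      have : X.fromSpecStalk η ⟨p, hp⟩ ∈ Set.range (X.fromSpecStalk η) := ⟨_, rfl⟩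
      rwa [Scheme.range_fromSpecStalk] at this
    have h1 : closure {η} ⊆ closure {X.fromSpecStalk η ⟨p, hp⟩} :=
      specializes_iff_closure_subset.1 hspec
    have h2 := hη.2 isIrreducible_singleton.closure h1
    have h3 : η ⤳ X.fromSpecStalk η ⟨p, hp⟩ := specializes_iff_closure_subset.2 h2
    have h4 : X.fromSpecStalk η ⟨p, hp⟩ =
        X.fromSpecStalk η (IsLocalRing.closedPoint (X.presheaf.stalk η)) := by
      rw [Scheme.fromSpecStalk_closedPoint]
      exact (hspec.antisymm h3).eq
    have h5 := (X.fromSpecStalk η).isEmbedding.injective h4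
    have h6 : p = IsLocalRing.maximalIdeal (X.presheaf.stalk η) :=
      congrArg PrimeSpectrum.asIdeal h5
    rw [h6]
    exact hu
  obtain ⟨n, hn⟩ := hnil
  have := pow_mem ha n
  rw [hn] at this
  exact zero_notMem_nonZeroDivisors this

lemma val_merUnits_mul_inv {X : Scheme.{u}} {V : X.Opens} (f : (merSections X V)ˣ) (x : V) :
    (f.1.1 x : FracStalk X x.1) * f⁻¹.1.1 x = 1 :=
  congrFun (congrArg Subtype.val f.mul_inv) x

lemma isUnit_val_merUnits {X : Scheme.{u}} {V : X.Opens} (f : (merSections X V)ˣ) (x : V) :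
    IsUnit (f.1.1 x : FracStalk X x.1) :=
  IsUnit.of_mul_eq_one _ (val_merUnits_mul_inv f x)

lemma isUnit_germFrac_iff {X : Scheme.{u}} {V : X.Opens} (b : Γ(X, V)) (x : X) (hx : x ∈ V) :
    IsUnit (germFrac X V x hx b) ↔
      (X.presheaf.germ V x hx).hom b ∈ nonZeroDivisors (X.presheaf.stalk x) := by
  refine ⟨fun h => ?_, fun h => IsLocalization.map_units (FracStalk X x) ⟨_, h⟩⟩
  refine mem_nonZeroDivisors_iff_right.2 fun z hz => ?_
  apply IsFractionRing.injective (X.presheaf.stalk x) (FracStalk X x)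
  have := congrArg (algebraMap (X.presheaf.stalk x) (FracStalk X x)) hz
  rw [map_mul, map_zero] at this
  rw [map_zero]
  exact (h.mul_left_eq_zero).1 this

/-- A regular section of `𝒪_X` is invertible in `𝒦_X`. -/
lemma IsRegularSection.isUnit_toMer {X : Scheme.{u}} {V : X.Opens} {b : Γ(X, V)}
    (hb : IsRegularSection X V b) : IsUnit (toMer X V b) := by
  have hu : ∀ x : V, IsUnit (germFrac X V x.1 x.2 b) := fun x =>
    (isUnit_germFrac_iff b x.1 x.2).2 (hb x.1 x.2)
  let c : merSections X V := ⟨fun x => ((hu x).unit⁻¹ : (FracStalk X x.1)ˣ).1, fun x =>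
    ⟨V, x.2, le_rfl, 1, b, hb, fun y hy => by
      rw [map_one]
      exact (hu ⟨y, hy⟩).val_inv_mul⟩⟩
  refine IsUnit.of_mul_eq_one c ?_
  ext x
  exact (hu x).mul_val_inv

lemma toMer_injective {X : Scheme.{u}} {U : X.Opens} :
    Function.Injective (toMer X U) := by
  intro a b h
  refine TopCat.Presheaf.section_ext X.sheaf U a b fun x hx => ?_
  exact IsFractionRing.injective (X.presheaf.stalk x) (FracStalk X x)
    (congrFun (congrArg Subtype.val h) ⟨x, hx⟩)

namespace MerSubsheaf

variable {X : Scheme.{u}}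

noncomputable instance : CommMonoid (MerSubsheaf X) where
  mul_assoc I J L := ext_stalk fun x => by simp only [stalk_mul, mul_assoc]
  mul_comm I J := ext_stalk fun x => by simp only [stalk_mul, mul_comm]
  one_mul I := ext_stalk fun x => by rw [stalk_mul, stalk_one, one_mul]
  mul_one I := ext_stalk fun x => by rw [stalk_mul, stalk_one, mul_one]

lemma isEffective_iff {I : MerSubsheaf X} : I.IsEffective ↔ ∀ x, I.stalk x ≤ 1 := by
  refine ⟨fun h x => ?_, fun h U s hs => ?_⟩
  · rintro _ ⟨U, hx, s, hs, rfl⟩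
    rw [← stalk_one]
    exact ⟨U, hx, s, h U hs, rfl⟩
  · rw [mem_sec_iff] at hs ⊢
    intro x
    rw [stalk_one]
    exact h _ (hs x)

/-- A section of `𝒦_X` that belongs to `I` at a point belongs to `I` near that point. -/
lemma exists_forall_mem_stalk {I : MerSubsheaf X} {U : X.Opens} {x : X} (hx : x ∈ U)
    (s : merSections X U) (h : s.1 ⟨x, hx⟩ ∈ I.stalk x) :
    ∃ (V : X.Opens) (_ : x ∈ V) (hV : V ≤ U), ∀ (y : X) (hy : y ∈ V),
      s.1 ⟨y, hV hy⟩ ∈ I.stalk y := by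
  obtain ⟨W, hxW, t, ht, e⟩ := h
  obtain ⟨V, hxV, hV, e'⟩ := exists_merRes_eq (merRes (inf_le_left : U ⊓ W ≤ U) s)
    (merRes (inf_le_right : U ⊓ W ≤ W) t) x ⟨hx, hxW⟩ e.symm
  refine ⟨V, hxV, hV.trans inf_le_left, fun y hy => ?_⟩
  have h1 : s.1 ⟨y, (hV hy).1⟩ = t.1 ⟨y, (hV hy).2⟩ := congrFun (congrArg Subtype.val e') ⟨y, hy⟩
  rw [h1]
  exact ⟨W, (hV hy).2, t, ht, rfl⟩

/-- The subsheaf generated by a section over an open subset (zero outside of it). -/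
noncomputable def spanSection (U : X.Opens) (f : merSections X U) : MerSubsheaf X :=
  ofStalks fun x => Submodule.span _ {z | ∃ hx : x ∈ U, z = f.1 ⟨x, hx⟩}

lemma stalk_spanSection (U : X.Opens) (f : merSections X U) (x : X) (hx : x ∈ U) :
    (spanSection U f).stalk x = Submodule.span _ {f.1 ⟨x, hx⟩} := by
  have e : ∀ (y : X) (hy : y ∈ U), {z | ∃ hx : y ∈ U, z = f.1 ⟨y, hx⟩} = {f.1 ⟨y, hy⟩} :=
    fun y hy => by
      ext z
      exact ⟨fun ⟨_, h⟩ => h, fun h => ⟨hy, h⟩⟩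
  refine le_antisymm ?_ ?_
  · rintro _ ⟨V, hx', s, hs, rfl⟩
    have := hs ⟨x, hx'⟩
    simp only [e x hx] at this
    exact this
  · rw [Submodule.span_le, Set.singleton_subset_iff]
    refine ⟨U, hx, f, fun y => ?_, rfl⟩
    simp only [e y.1 y.2]
    exact Submodule.mem_span_singleton_self _

/-- An inclusion between stalks of a coherent subsheaf and another subsheaf holds nearby. -/
lemma IsCoherent.exists_stalk_le {I J : MerSubsheaf X} (hI : I.IsCoherent) {x : X}
    (h : I.stalk x ≤ J.stalk x) :
    ∃ (V : X.Opens), x ∈ V ∧ ∀ y ∈ V, I.stalk y ≤ J.stalk y := by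
  obtain ⟨V, hx, n, s, hs⟩ := hI x
  have hmem : ∀ i, (s i).1 ⟨x, hx⟩ ∈ J.stalk x := fun i => h (by
    rw [hs x hx]
    exact Submodule.subset_span ⟨i, rfl⟩)
  choose W hxW hWV hW using fun i => exists_forall_mem_stalk hx (s i) (hmem i)
  refine ⟨V ⊓ ⨅ i, W i, ⟨hx, ?_⟩, fun y hy => ?_⟩
  · rw [TopologicalSpace.Opens.coe_iInf]
    exact Set.mem_iInter.2 hxW
  · have hyW : ∀ i, y ∈ W i := by
      have := hy.2
      rw [TopologicalSpace.Opens.coe_iInf] at this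
      exact Set.mem_iInter.1 this
    rw [hs y hy.1, Submodule.span_le]
    rintro _ ⟨i, rfl⟩
    exact hW i y (hyW i)

lemma IsGeneratedOn.mono {I : MerSubsheaf X} {V W : X.Opens} {f : merSections X V}
    (hf : I.IsGeneratedOn V f) (h : W ≤ V) : I.IsGeneratedOn W (merRes h f) :=
  fun y hy => hf y (h hy)

lemma IsGeneratedOn.mul {I J : MerSubsheaf X} {V : X.Opens} {f g : merSections X V}
    (hf : I.IsGeneratedOn V f) (hg : J.IsGeneratedOn V g) : (I * J).IsGeneratedOn V (f * g) :=
  fun y hy => by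
    rw [stalk_mul, hf y hy, hg y hy, Submodule.span_mul_span, Set.singleton_mul_singleton]
    rfl

lemma span_singleton_mul_eq_one {R K : Type*} [CommRing R] [CommRing K] [Algebra R K] {a b : K}
    (h : a * b = 1) : Submodule.span R {a} * Submodule.span R {b} = 1 := by
  rw [Submodule.span_mul_span, Set.singleton_mul_singleton, h, Submodule.one_eq_span]

/-- A section of the inverse, tested against `f` itself, is a multiple of `f⁻¹`; conversely `f⁻¹`
sends every multiple of `f` into `𝒪_X`. -/
lemma IsGeneratedOn.inv {I : MerSubsheaf X} {V : X.Opens} {f : (merSections X V)ˣ}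
    (hf : I.IsGeneratedOn V f.1) : I⁻¹.IsGeneratedOn V f⁻¹.1 := by
  intro x hx
  have hu := val_merUnits_mul_inv f
  refine le_antisymm ?_ ?_
  · rintro _ ⟨U, hxU, g, hg, rfl⟩
    have h1 : merRes (inf_le_left : V ⊓ U ≤ V) f.1 ∈ I.sec (V ⊓ U) := by
      rw [mem_sec_iff]
      intro y
      rw [hf y.1 y.2.1]
      exact Submodule.mem_span_singleton_self _
    have h2 := (mem_sec_iff _ _ _).1 (hg (V ⊓ U) inf_le_right _ h1) ⟨x, hx, hxU⟩
    rw [stalk_one] at h2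
    obtain ⟨c, hc⟩ := Submodule.mem_one.1 h2
    refine Submodule.mem_span_singleton.2 ⟨c, ?_⟩
    have h3 : algebraMap (X.presheaf.stalk x) (FracStalk X x) c =
      g.1 ⟨x, hxU⟩ * f.1.1 ⟨x, hx⟩ := hc
    rw [Algebra.smul_def, h3, mul_assoc, hu ⟨x, hx⟩, mul_one]
  · rw [Submodule.span_le, Set.singleton_subset_iff]
    refine ⟨V, hx, f⁻¹.1, fun W hW g hg => ?_, rfl⟩
    rw [mem_sec_iff] at hg ⊢
    intro y
    have h1 := hg y
    rw [hf y.1 (hW y.2)] at h1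
    obtain ⟨c, hc⟩ := Submodule.mem_span_singleton.1 h1
    rw [stalk_one]
    refine Submodule.mem_one.2 ⟨c, ?_⟩
    change _ = f⁻¹.1.1 ⟨y.1, hW y.2⟩ * g.1 y
    rw [← hc, mul_smul_comm, mul_comm, hu ⟨y.1, hW y.2⟩, Algebra.smul_def, mul_one]

lemma isCartier_one : (1 : MerSubsheaf X).IsCartier := fun x =>
  ⟨⊤, trivial, 1, fun y _ => by
    rw [stalk_one, Submodule.one_eq_span]; rfl⟩

lemma IsCartier.mul {I J : MerSubsheaf X} (hI : I.IsCartier) (hJ : J.IsCartier) :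
    (I * J).IsCartier := fun x => by
  obtain ⟨V, hx, f, hf⟩ := hI x
  obtain ⟨W, hx', g, hg⟩ := hJ x
  exact ⟨V ⊓ W, ⟨hx, hx'⟩,
    Units.map (merRes (inf_le_left : V ⊓ W ≤ V)).toMonoidHom f *
    Units.map (merRes (inf_le_right : V ⊓ W ≤ W)).toMonoidHom g,
    (hf.mono inf_le_left).mul (hg.mono inf_le_right)⟩

lemma IsCartier.inv {I : MerSubsheaf X} (hI : I.IsCartier) : I⁻¹.IsCartier := fun x => by
  obtain ⟨V, hx, f, hf⟩ := hI x
  exact ⟨V, hx, f⁻¹, hf.inv⟩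

lemma IsCartier.mul_inv_cancel {I : MerSubsheaf X} (hI : I.IsCartier) : I * I⁻¹ = 1 :=
  ext_stalk fun x => by
    obtain ⟨V, hx, f, hf⟩ := hI x
    rw [stalk_mul, hf x hx, hf.inv x hx, stalk_one]
    exact span_singleton_mul_eq_one (val_merUnits_mul_inv f ⟨x, hx⟩)

/-- Inverses in a commutative monoid are unique. The operation `I⁻¹` is not a monoid inverse for
general `I`, so all cancellation below goes through Cartier factors. -/
lemma IsCartier.eq_inv {I J : MerSubsheaf X} (hI : I.IsCartier) (h : I * J = 1) : J = I⁻¹ := by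
  rw [← one_mul J, ← hI.mul_inv_cancel, mul_assoc, mul_comm I⁻¹, ← mul_assoc, h, one_mul]

/-- Turns a presentation `D = D' - E` into `D + E = D'`, which involves no inverse. -/
lemma IsCartier.eq_mul_inv_iff {I J L : MerSubsheaf X} (hI : I.IsCartier) :
    J = L * I⁻¹ ↔ J * I = L := by
  refine ⟨?_, ?_⟩
  · rintro rfl
    rw [mul_assoc, mul_comm I⁻¹, hI.mul_inv_cancel, mul_one]
  · rintro rfl
    rw [mul_assoc, hI.mul_inv_cancel, mul_one]

lemma IsCartier.inv_inv {I : MerSubsheaf X} (hI : I.IsCartier) : I⁻¹⁻¹ = I :=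
  (hI.inv.eq_inv (by rw [mul_comm, hI.mul_inv_cancel])).symm

lemma IsCartier.mul_inv {I J : MerSubsheaf X} (hI : I.IsCartier) (hJ : J.IsCartier) :
    (I * J)⁻¹ = I⁻¹ * J⁻¹ :=
  ((hI.mul hJ).eq_inv (by
    rw [mul_mul_mul_comm, hI.mul_inv_cancel, hJ.mul_inv_cancel, mul_one])).symm

lemma inv_one : (1 : MerSubsheaf X)⁻¹ = 1 := (isCartier_one.eq_inv (mul_one _)).symm

lemma IsCoherent.mul {I J : MerSubsheaf X} (hI : I.IsCoherent) (hJ : J.IsCoherent) :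
    (I * J).IsCoherent := fun x => by
  obtain ⟨V, hx, n, s, hs⟩ := hI x
  obtain ⟨W, hx', m, t, ht⟩ := hJ x
  refine ⟨V ⊓ W, ⟨hx, hx'⟩, n * m, fun k => merRes inf_le_left (s (finProdFinEquiv.symm k).1) *
    merRes inf_le_right (t (finProdFinEquiv.symm k).2), fun y hy => ?_⟩
  rw [stalk_mul, hs y hy.1, ht y hy.2, Submodule.span_mul_span]
  congr 1
  ext z
  constructor
  · rintro ⟨_, ⟨i, rfl⟩, _, ⟨j, rfl⟩, rfl⟩
    refine ⟨finProdFinEquiv (i, j), ?_⟩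
    simp only [Equiv.symm_apply_apply]
    rfl
  · rintro ⟨k, rfl⟩
    exact ⟨_, ⟨(finProdFinEquiv.symm k).1, rfl⟩, _, ⟨(finProdFinEquiv.symm k).2, rfl⟩, rfl⟩

lemma IsCartier.isCoherent {I : MerSubsheaf X} (hI : I.IsCartier) : I.IsCoherent := fun x => by
  obtain ⟨V, hx, f, hf⟩ := hI x
  refine ⟨V, hx, 1, fun _ => f.1, fun y hy => ?_⟩
  rw [hf y hy, Set.range_const]

/-- Denominators are already units in the stalk at a generic point, so the fraction ring adds
nothing there. -/
lemma span_singleton_eq_top_of_isUnit {η : X} (hη : closure {η} ∈ irreducibleComponents X)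
    {z : FracStalk X η} (hz : IsUnit z) :
    Submodule.span (X.presheaf.stalk η) {z} = ⊤ := by
  refine eq_top_iff.2 fun w _ => ?_
  obtain ⟨⟨a, b⟩, hab⟩ := IsLocalization.surj (nonZeroDivisors (X.presheaf.stalk η))
    (w * ((hz.unit⁻¹ : (FracStalk X η)ˣ) : FracStalk X η))
  obtain ⟨c, hc⟩ := isUnit_of_mem_nonZeroDivisors_stalk hη b.2
  refine Submodule.mem_span_singleton.2 ⟨a * (c⁻¹ : (X.presheaf.stalk η)ˣ).1, ?_⟩
  simp only at hab
  rw [Algebra.smul_def, map_mul, ← hab, ← hc]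
  have h1 : algebraMap (X.presheaf.stalk η) (FracStalk X η) c *
      algebraMap (X.presheaf.stalk η) (FracStalk X η) (c⁻¹ : (X.presheaf.stalk η)ˣ).1 = 1 := by
    rw [← map_mul, Units.mul_inv, map_one]
  rw [mul_assoc (w * _), h1, mul_one, mul_assoc, hz.val_inv_mul, mul_one]

lemma IsCartier.isGenDivisor {I : MerSubsheaf X} (hI : I.IsCartier) : I.IsGenDivisor where
  isCoherent := hI.isCoherent
  nondegenerate η hη := by
    obtain ⟨V, hx, f, hf⟩ := hI η
    rw [hf η hx]
    exact span_singleton_eq_top_of_isUnit hη (isUnit_val_merUnits f ⟨η, hx⟩)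

lemma IsGenDivisor.mul {I J : MerSubsheaf X} (hI : I.IsGenDivisor) (hJ : J.IsGenDivisor) :
    (I * J).IsGenDivisor where
  isCoherent := hI.isCoherent.mul hJ.isCoherent
  nondegenerate η hη := by
    rw [stalk_mul, hI.nondegenerate η hη, hJ.nondegenerate η hη]
    refine eq_top_iff.2 fun z _ => ?_
    rw [← mul_one z]
    exact Submodule.mul_mem_mul trivial trivial

lemma IsEffective.mul {I J : MerSubsheaf X} (hI : I.IsEffective) (hJ : J.IsEffective) :
    (I * J).IsEffective := by
  rw [isEffective_iff] at *
  intro x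
  rw [stalk_mul, ← mul_one (1 : Submodule (X.presheaf.stalk x) (FracStalk X x))]
  exact mul_le_mul' (hI x) (hJ x)

lemma isCartier_principal (f : (merSections X ⊤)ˣ) : (principal f.1).IsCartier := fun _ =>
  ⟨⊤, trivial, f, fun _ _ => stalk_principal _ _⟩

end MerSubsheaf

/-- The generalized divisor of a Cartier divisor. -/
def MerSubsheaf.IsCartier.toGDiv {X : Scheme.{u}} {I : MerSubsheaf X} (hI : I.IsCartier) : GDiv X :=
  ⟨I, hI.isGenDivisor⟩

/-! ### Quasi-coherence -/

lemma algebraMap_mem_span_image_iff {R K : Type*} [CommRing R] [CommRing K] [Algebra R K]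
    (h : Function.Injective (algebraMap R K)) (S : Set R) (c : R) :
    algebraMap R K c ∈ Submodule.span R (algebraMap R K '' S) ↔ c ∈ Ideal.span S := by
  have e : Submodule.span R (algebraMap R K '' S) =
      Submodule.map (Algebra.linearMap R K) (Ideal.span S) :=
    (Submodule.map_span (Algebra.linearMap R K) S).symm
  rw [e]
  constructor
  · rintro ⟨d, hd, hdc⟩
    rwa [← h hdc]
  · exact fun hc => ⟨c, hc, rfl⟩

section Affine

variable {X : Scheme.{u}} {U : X.Opens}

lemma germFrac_mul_mem {x : X} {hx : x ∈ U} (N : Submodule (X.presheaf.stalk x) (FracStalk X x))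
    (b : Γ(X, U)) {z : FracStalk X x} (hz : z ∈ N) : germFrac X U x hx b * z ∈ N := by
  have := N.smul_mem ((X.presheaf.germ U x hx).hom b) hz
  rwa [Algebra.smul_def] at this

lemma germFrac_mem_span_iff {x : X} (hx : x ∈ U) (J : Ideal Γ(X, U)) (c : Γ(X, U)) :
    germFrac X U x hx c ∈ Submodule.span (X.presheaf.stalk x) (germFrac X U x hx '' J) ↔
      (X.presheaf.germ U x hx).hom c ∈ J.map (X.presheaf.germ U x hx).hom := by
  have : germFrac X U x hx '' J =
      algebraMap (X.presheaf.stalk x) (FracStalk X x) '' ((X.presheaf.germ U x hx).hom '' J) := by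
    rw [← Set.image_comp]; rfl
  rw [this]
  exact algebraMap_mem_span_image_iff (IsFractionRing.injective _ _) _ _

lemma AlgebraicGeometry.IsAffineOpen.mem_ideal_of_germFrac_mem_span (hU : IsAffineOpen U)
    (J : Ideal Γ(X, U))
    {c : Γ(X, U)} (h : ∀ (x : X) (hx : x ∈ U), germFrac X U x hx c ∈
      Submodule.span (X.presheaf.stalk x) (germFrac X U x hx '' J)) : c ∈ J :=
  hU.mem_ideal_iff.2 fun x hx => (germFrac_mem_span_iff hx J c).1 (h x hx)

/-- The open subset is only assumed equal to a basic one, since the preimage of a basic open subset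
under `π` is basic only up to a propositional equality. -/
lemma AlgebraicGeometry.IsAffineOpen.exists_pow_mul_eq_res (hU : IsAffineOpen U)
    (f : Γ(X, U)) {V : X.Opens} (hVU : V ≤ U)
    (e : V = X.basicOpen f) (a : Γ(X, V)) : ∃ (n : ℕ) (c : Γ(X, U)),
      (X.presheaf.map (homOfLE hVU).op).hom (f ^ n) * a =
        (X.presheaf.map (homOfLE hVU).op).hom c := by
  let := (X.presheaf.map (homOfLE hVU).op).hom.toAlgebra
  have := hU.isLocalization_of_eq_basicOpen f (homOfLE hVU) e
  obtain ⟨⟨c, ⟨_, n, rfl⟩⟩, h⟩ := IsLocalization.surj (Submonoid.powers f) a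
  exact ⟨n, c, by rw [mul_comm]; exact h⟩

lemma isUnit_res_of_le_basicOpen (f : Γ(X, U)) {V : X.Opens} (hVU : V ≤ U) (e : V ≤ X.basicOpen f) :
    IsUnit ((X.presheaf.map (homOfLE hVU).op).hom f) := by
  refine X.toRingedSpace.isUnit_of_isUnit_germ V _ fun x hx => ?_
  have := (X.mem_basicOpen f x (hVU hx)).1 (e hx)
  rwa [← X.presheaf.germ_res_apply (homOfLE hVU) x hx f] at this

/-- Ideals on the affine `X.basicOpen f` are determined by stalks, so `c` lies in the localization
of `J`. One power of `f` clears the denominator, a second one lifts the resulting equality to `Γ(X,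
U)`. -/
lemma AlgebraicGeometry.IsAffineOpen.exists_pow_mul_mem_of_basicOpen (hU : IsAffineOpen U)
    (J : Ideal Γ(X, U)) (f c : Γ(X, U)) (h : ∀ (x : X) (hx : x ∈ X.basicOpen f),
      germFrac X U x (X.basicOpen_le f hx) c ∈ Submodule.span (X.presheaf.stalk x) (germFrac X U x (X.basicOpen_le f hx) '' J)) :
    ∃ n : ℕ, f ^ n * c ∈ J := by
  let := (X.presheaf.map (homOfLE (X.basicOpen_le f)).op).hom.toAlgebra
  have hloc := hU.isLocalization_of_eq_basicOpen f (homOfLE (X.basicOpen_le f)) rfl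
  have h1 : algebraMap Γ(X, U) Γ(X, X.basicOpen f) c ∈
      J.map (algebraMap Γ(X, U) Γ(X, X.basicOpen f)) := by
    rw [(hU.basicOpen f).mem_ideal_iff]
    intro x hx
    have h2 := (germFrac_mem_span_iff _ J c).1 (h x hx)
    rw [Ideal.map_map]
    have e : (X.presheaf.germ (X.basicOpen f) x hx).hom.comp
        (algebraMap Γ(X, U) Γ(X, X.basicOpen f)) =
        (X.presheaf.germ U x (X.basicOpen_le f hx)).hom := by
      rw [← X.presheaf.germ_res (homOfLE (X.basicOpen_le f)) x hx]
      rfl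
    rw [e]
    have := RingHom.congr_fun e c
    rw [RingHom.comp_apply] at this
    exact this ▸ h2
  obtain ⟨⟨j, ⟨_, n, rfl⟩⟩, hj⟩ :=
    (IsLocalization.mem_map_algebraMap_iff (Submonoid.powers f) _).1 h1
  simp only at hj
  rw [← map_mul] at hj
  obtain ⟨⟨_, m, rfl⟩, hm⟩ := (IsLocalization.eq_iff_exists (Submonoid.powers f) _).1 hj
  refine ⟨m + n, ?_⟩
  have : f ^ (m + n) * c = f ^ m * (c * f ^ n) := by ring
  rw [this]
  simp only at hm
  rw [hm]
  exact J.mul_mem_left _ j.2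

end Affine

namespace MerSubsheaf

variable {X : Scheme.{u}} {I : MerSubsheaf X}

lemma mem_idealOn_iff {U : X.Opens} {a : Γ(X, U)} :
    a ∈ I.idealOn U ↔ ∀ (x : X) (hx : x ∈ U), germFrac X U x hx a ∈ I.stalk x := by
  refine Iff.trans (mem_sec_iff I U (toMer X U a)) ?_
  exact ⟨fun h x hx => h ⟨x, hx⟩, fun h x => h x.1 x.2⟩

/-- A section of `𝒦_X` whose value at a point lies in `𝒪_X` comes from `𝒪_X` nearby. -/
lemma exists_germFrac_eq_of_mem_one {U : X.Opens} (s : merSections X U) {x : X} (hx : x ∈ U)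
    (h : s.1 ⟨x, hx⟩ ∈ (1 : Submodule (X.presheaf.stalk x) (FracStalk X x))) :
    ∃ (V : X.Opens) (_ : x ∈ V) (hV : V ≤ U) (a : Γ(X, V)), ∀ (y : X) (hy : y ∈ V),
      s.1 ⟨y, hV hy⟩ = germFrac X V y hy a := by
  obtain ⟨c, hc⟩ := Submodule.mem_one.1 h
  obtain ⟨W, hxW, a, rfl⟩ := X.presheaf.exists_germ_eq c
  obtain ⟨V, hxV, hV, e⟩ := exists_merRes_eq (merRes (inf_le_left : U ⊓ W ≤ U) s)
    (merRes (inf_le_right : U ⊓ W ≤ W) (toMer X W a)) x ⟨hx, hxW⟩ hc.symm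
  refine ⟨V, hxV, hV.trans inf_le_left,
    (X.presheaf.map (homOfLE (hV.trans inf_le_right)).op).hom a, fun y hy => ?_⟩
  rw [germFrac_res (hV.trans inf_le_right)]
  exact congrFun (congrArg Subtype.val e) ⟨y, hy⟩

/-- An effective coherent subsheaf is locally generated by an ideal of functions. -/
lemma IsCoherent.exists_ideal (hI : I.IsCoherent) (he : I.IsEffective) {x : X} {U : X.Opens}
    (hxU : x ∈ U) : ∃ (V : X.Opens) (_ : IsAffineOpen V) (_ : x ∈ V) (_ : V ≤ U)
      (J : Ideal Γ(X, V)), ∀ (y : X) (hy : y ∈ V), I.stalk y =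
        Submodule.span (X.presheaf.stalk y) (germFrac X V y hy '' J) := by
  obtain ⟨V, hx, n, s, hs⟩ := hI x
  have h1 : ∀ i, (s i).1 ⟨x, hx⟩ ∈ (1 : Submodule (X.presheaf.stalk x) (FracStalk X x)) :=
    fun i => isEffective_iff.1 he x (by rw [hs x hx]; exact Submodule.subset_span ⟨i, rfl⟩)
  choose W hxW hWV a ha using fun i => exists_germFrac_eq_of_mem_one (s i) hx (h1 i)
  obtain ⟨D, hD, hxD, hDle⟩ := exists_isAffineOpen_mem_and_subset
    (U := V ⊓ U ⊓ ⨅ i, W i) (x := x) ⟨⟨hx, hxU⟩, by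
      rw [TopologicalSpace.Opens.coe_iInf]
      exact Set.mem_iInter.2 hxW⟩
  have hDle : D ≤ V ⊓ U ⊓ ⨅ i, W i := hDle
  have hDW : ∀ i, D ≤ W i := fun i => hDle.trans (inf_le_right.trans (iInf_le _ i))
  have hDV : D ≤ V := hDle.trans (inf_le_left.trans inf_le_left)
  refine ⟨D, hD, hxD, hDle.trans (inf_le_left.trans inf_le_right),
    Ideal.span (Set.range fun i => (X.presheaf.map (homOfLE (hDW i)).op).hom (a i)),
    fun y hy => ?_⟩
  have e : ∀ i, (s i).1 ⟨y, hDV hy⟩ = germFrac X D y hy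
      ((X.presheaf.map (homOfLE (hDW i)).op).hom (a i)) := fun i => by
    rw [germFrac_res, ← ha i y (hDW i hy)]
  rw [hs y (hDV hy)]
  refine le_antisymm (Submodule.span_mono ?_) (Submodule.span_le.2 ?_)
  · rintro _ ⟨i, rfl⟩
    exact ⟨_, Ideal.subset_span ⟨i, rfl⟩, (e i).symm⟩
  · rintro _ ⟨c, hc, rfl⟩
    induction hc using Submodule.span_induction with
    | mem c hc =>
      obtain ⟨i, rfl⟩ := hc
      exact Submodule.subset_span ⟨i, e i⟩
    | zero => rw [map_zero]; exact zero_mem _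
    | add c d _ _ hc hd => rw [map_add]; exact add_mem hc hd
    | smul r c _ hc =>
      rw [smul_eq_mul, map_mul]
      exact germFrac_mul_mem _ _ hc

/-- A function on an affine open subset that belongs to `I` on a basic open subset belongs to `I`
after multiplication by a power of the equation. -/
lemma IsCoherent.exists_pow_mul_mem_idealOn (hI : I.IsCoherent) (he : I.IsEffective) {U : X.Opens}
    (hU : IsAffineOpen U) (f c : Γ(X, U)) (h : ∀ (x : X) (hx : x ∈ X.basicOpen f),
      germFrac X U x (X.basicOpen_le f hx) c ∈ I.stalk x) :
    ∃ n : ℕ, f ^ n * c ∈ I.idealOn U := by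
  have key : ∃ n : ℕ, ∀ x ∈ (U : Set X), ∀ hx : x ∈ U,
      germFrac X U x hx (f ^ n * c) ∈ I.stalk x := by
    have hmono : ∀ (x : X) (hx : x ∈ U) (n m : ℕ), n ≤ m →
        germFrac X U x hx (f ^ n * c) ∈ I.stalk x → germFrac X U x hx (f ^ m * c) ∈ I.stalk x := by
      intro x hx n m hnm h
      obtain ⟨k, rfl⟩ := Nat.exists_eq_add_of_le' hnm
      rw [pow_add, mul_assoc, map_mul]
      exact germFrac_mul_mem _ _ h
    -- Quasi-compactness yields a single exponent: exponents may be increased, so the maximum serves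
    -- a union, and near a point `I` comes from an ideal of functions.
    refine hU.isCompact.induction_on (p := fun K => ∃ n : ℕ, ∀ x ∈ K, ∀ hx : x ∈ U,
      germFrac X U x hx (f ^ n * c) ∈ I.stalk x) ⟨0, fun x hx => hx.elim⟩ ?_ ?_ ?_
    · rintro s t hst ⟨n, hn⟩
      exact ⟨n, fun x hx => hn x (hst hx)⟩
    · rintro s t ⟨n, hn⟩ ⟨m, hm⟩
      refine ⟨max n m, fun x hx hxU => ?_⟩
      rcases hx with hx | hx
      · exact hmono x hxU n _ (le_max_left _ _) (hn x hx hxU)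
      · exact hmono x hxU m _ (le_max_right _ _) (hm x hx hxU)
    · intro x hxU
      obtain ⟨V, hV, hxV, hVU, J, hJ⟩ := hI.exists_ideal he (show x ∈ U from hxU)
      obtain ⟨n, hn⟩ := hV.exists_pow_mul_mem_of_basicOpen J
        ((X.presheaf.map (homOfLE hVU).op).hom f) ((X.presheaf.map (homOfLE hVU).op).hom c)
        fun y hy => by
          rw [← hJ y (X.basicOpen_le _ hy), germFrac_res hVU]
          rw [Scheme.basicOpen_res] at hy
          exact h y hy.2
      refine ⟨V, mem_nhdsWithin_of_mem_nhds (V.isOpen.mem_nhds hxV), n, fun y hy hyU => ?_⟩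
      have hyV : y ∈ V := hy
      rw [hJ y hyV, ← germFrac_res hVU _ y hyV]
      refine Submodule.subset_span ⟨_, hn, ?_⟩
      rw [map_mul (X.presheaf.map (homOfLE hVU).op).hom, map_pow]
  obtain ⟨n, hn⟩ := key
  exact ⟨n, mem_idealOn_iff.2 fun x hx => hn x hx hx⟩

/-- The stalks of an effective coherent subsheaf are generated by its sections over an affine open
subset. -/
lemma IsCoherent.stalk_eq_span_idealOn (hI : I.IsCoherent) (he : I.IsEffective) {U : X.Opens}
    (hU : IsAffineOpen U) {x : X} (hx : x ∈ U) : I.stalk x =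
      Submodule.span (X.presheaf.stalk x) (germFrac X U x hx '' I.idealOn U) := by
  refine le_antisymm (fun z hz => ?_) (Submodule.span_le.2 ?_)
  · obtain ⟨c, rfl⟩ := Submodule.mem_one.1 (isEffective_iff.1 he x hz)
    obtain ⟨W, hxW, a, rfl⟩ := X.presheaf.exists_germ_eq c
    obtain ⟨V, hxV, hVW, hV⟩ := exists_forall_mem_stalk hxW (toMer X W a) hz
    -- After shrinking to a basic open subset, `f ^ n * a` extends to a function `d` on `U`, and `f
    -- ^ m * d` lies in `I` on all of `U`. Since `f` is a unit at `x`, the germ of `a` is recovered.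
    obtain ⟨f, hfV, hxf⟩ := hU.exists_basicOpen_le ⟨x, hxV⟩ hx
    obtain ⟨n, d, hd⟩ := hU.exists_pow_mul_eq_res f (X.basicOpen_le f) rfl
      ((X.presheaf.map (homOfLE (hfV.trans hVW)).op).hom a)
    have hgerm : ∀ (y : X) (hy : y ∈ X.basicOpen f), germFrac X U y (X.basicOpen_le f hy) d =
        germFrac X U y (X.basicOpen_le f hy) (f ^ n) * germFrac X W y (hVW (hfV hy)) a := by
      intro y hy
      rw [← germFrac_res (X.basicOpen_le f) d y hy, ← hd, map_mul, germFrac_res, germFrac_res]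
    obtain ⟨m, hm⟩ := hI.exists_pow_mul_mem_idealOn he hU f d fun y hy => by
      rw [hgerm y hy]
      exact germFrac_mul_mem _ _ (hV y (hfV hy))
    have h1 := Submodule.subset_span (R := X.presheaf.stalk x)
      (Set.mem_image_of_mem (germFrac X U x hx) (SetLike.mem_coe.2 hm))
    rw [map_mul, hgerm x hxf, ← mul_assoc, ← map_mul, ← pow_add] at h1
    have hu : IsUnit ((X.presheaf.germ U x hx).hom (f ^ (m + n))) := by
      rw [map_pow]
      exact ((X.mem_basicOpen f x hx).1 hxf).pow _
    have h2 : (X.presheaf.germ U x hx).hom (f ^ (m + n)) • germFrac X W x hxW a ∈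
      Submodule.span (X.presheaf.stalk x) (germFrac X U x hx '' I.idealOn U) := by
      rw [Algebra.smul_def]; exact h1
    exact (Submodule.smul_mem_iff_of_isUnit _ hu).1 h2
  · rintro _ ⟨a, ha, rfl⟩
    exact mem_idealOn_iff.1 ha x hx

end MerSubsheaf

/-! ### The Fitting sheaf -/

section FittingSheaf

variable {X Y : Scheme.{u}} (π : X ⟶ Y) [AlgebraicGeometry.IsFinite π] {I : MerSubsheaf X}

/-- The rings of sections on both schemes are localizations at powers of `a`. Quasi-coherence of `I`
makes the quotient by `I` localize in the same way. -/
lemma fittingOn_basicOpen (hI : I.IsCoherent) (he : I.IsEffective) {V V' : Y.Opens}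
    (hV : IsAffineOpen V) (a : Γ(Y, V)) (hV' : V' ≤ V) (e : V' = Y.basicOpen a) :
    fittingOn π I V' = (fittingOn π I V).map (Y.presheaf.map (homOfLE hV').op).hom := by
  have hle : π ⁻¹ᵁ V' ≤ π ⁻¹ᵁ V := π.preimage_mono hV'
  have e' : π ⁻¹ᵁ V' = X.basicOpen ((π.app V).hom a) := by
    rw [e]; exact Scheme.preimage_basicOpen π a
  have hU : IsAffineOpen (π ⁻¹ᵁ V) := hV.preimage π
  let := (π.app V).hom.toAlgebra
  let := (π.app V').hom.toAlgebra
  have hfin : Module.Finite Γ(Y, V) Γ(X, π ⁻¹ᵁ V) := π.finite_app V hV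
  have hnat : ∀ r, (X.presheaf.map (homOfLE hle).op).hom ((π.app V).hom r) =
      (π.app V').hom ((Y.presheaf.map (homOfLE hV').op).hom r) := fun r => by
    have := π.naturality (homOfLE hV').op
    exact (RingHom.congr_fun (congrArg CommRingCat.Hom.hom this) r).symm
  have hu : ∀ n : ℕ, IsUnit ((Y.presheaf.map (homOfLE hV').op).hom (a ^ n)) := fun n => by
    rw [map_pow]
    exact (isUnit_res_of_le_basicOpen a hV' e.le).pow n
  refine fittingIdeal_quotient_eq_map (Y.presheaf.map (homOfLE hV').op).hom
    (X.presheaf.map (homOfLE hle).op).hom hnat _ _ (fun r' => ?_) (fun s' => ?_) ?_ ?_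
  · obtain ⟨n, c, h⟩ := hV.exists_pow_mul_eq_res a hV' e r'
    exact ⟨a ^ n, c, hu n, h⟩
  · obtain ⟨n, c, h⟩ := hU.exists_pow_mul_eq_res _ hle e' s'
    refine ⟨a ^ n, c, hu n, ?_⟩
    rw [← h, ← map_pow]
    congr 1
    exact (hnat _).symm
  · intro s hs
    exact MerSubsheaf.mem_idealOn_iff.2 fun x hx => by
      rw [germFrac_res hle]
      exact MerSubsheaf.mem_idealOn_iff.1 hs x (hle hx)
  · intro s hs
    obtain ⟨n, hn⟩ := hI.exists_pow_mul_mem_idealOn he hU ((π.app V).hom a) s fun x hx => by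
      have hx' : x ∈ π ⁻¹ᵁ V' := e'.ge hx
      rw [← germFrac_res hle s x hx']
      exact MerSubsheaf.mem_idealOn_iff.1 hs x hx'
    refine ⟨a ^ n, hu n, ?_⟩
    change (π.app V).hom (a ^ n) * s ∈ _
    rwa [map_pow]

/-- The stalks of the Fitting sheaf are generated by the Fitting ideal over any affine open
neighbourhood. -/
lemma stalk_fittingSheaf (hI : I.IsCoherent) (he : I.IsEffective) {V : Y.Opens}
    (hV : IsAffineOpen V) {y : Y} (hy : y ∈ V) : (fittingSheaf π I).stalk y =
      Submodule.span (Y.presheaf.stalk y) (germFrac Y V y hy '' fittingOn π I V) := by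
  have key : ∀ (z : Y) (W : Y.Opens) (hzV : z ∈ V) (hzW : z ∈ W) (hW : IsAffineOpen W)
      (a : Γ(Y, W)),
      a ∈ fittingOn π I W → germFrac Y W z hzW a ∈
        Submodule.span (Y.presheaf.stalk z) (germFrac Y V z hzV '' fittingOn π I V) := by
    intro z W hzV hzW hW a ha
    -- The two affine open subsets are compared on an open subset that is basic in both.
    obtain ⟨f, g, hfg, hzf⟩ := exists_basicOpen_le_affine_inter hV hW z ⟨hzV, hzW⟩
    have h1 := fittingOn_basicOpen π hI he hV f (Y.basicOpen_le f) rfl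
    have h2 := fittingOn_basicOpen π hI he hW g (hfg.le.trans (Y.basicOpen_le g)) hfg
    rw [h2] at h1
    have h3 := Ideal.mem_map_of_mem (Y.presheaf.map
      (homOfLE (hfg.le.trans (Y.basicOpen_le g))).op).hom ha
    rw [h1] at h3
    rw [← germFrac_res (hfg.le.trans (Y.basicOpen_le g)) a z hzf]
    have : ∀ b ∈ (fittingOn π I V).map (Y.presheaf.map (homOfLE (Y.basicOpen_le f)).op).hom,
        germFrac Y (Y.basicOpen f) z hzf b ∈
          Submodule.span (Y.presheaf.stalk z) (germFrac Y V z hzV '' fittingOn π I V) := by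
      intro b hb
      induction hb using Submodule.span_induction with
      | mem c hc =>
        obtain ⟨d, hd, rfl⟩ := hc
        rw [germFrac_res]
        exact Submodule.subset_span ⟨d, hd, rfl⟩
      | zero => rw [map_zero]; exact zero_mem _
      | add c d _ _ hc hd => rw [map_add]; exact add_mem hc hd
      | smul r c _ hc =>
        rw [smul_eq_mul, map_mul]
        exact germFrac_mul_mem _ _ hc
    exact this _ h3
  refine le_antisymm ?_ (Submodule.span_le.2 ?_)
  · rintro _ ⟨W, hyW, s, hs, rfl⟩
    refine Submodule.span_le.2 ?_ (hs ⟨y, hyW⟩)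
    rintro _ ⟨W', hyW', a, hW', ha, rfl⟩
    exact key y W' hy hyW' hW' a ha
  · rintro _ ⟨a, ha, rfl⟩
    exact ⟨V, hy, toMer Y V a, fun z => Submodule.subset_span ⟨V, z.2, a, hV, ha, rfl⟩, rfl⟩

end FittingSheaf

/-! ### Generic models of localization and spans of images -/

section Algebra

/-- A finite flat algebra over a noetherian ring is free over a neighbourhood of any given prime. -/
lemma exists_forall_free_away {A B : Type*} [CommRing A] [CommRing B] [Algebra A B]
    [IsNoetherianRing A] [Module.Finite A B] [Module.Flat A B] (p : Ideal A) [p.IsPrime] :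
    ∃ f ∉ p, ∀ (A' B' : Type u) [CommRing A'] [CommRing B'] [Algebra A A'] [Algebra A B']
      [Algebra A' B'] [IsScalarTower A A' B'] [Algebra B B'] [IsScalarTower A B B']
      [IsLocalization.Away f A']
      [IsLocalization (Algebra.algebraMapSubmonoid B (Submonoid.powers f)) B'],
      Module.Free A' B' := by
  have : Module.FinitePresentation A B := Module.finitePresentation_of_finite A B
  have : Module.Free (Localization.AtPrime p) (LocalizedModule p.primeCompl B) :=
    Module.free_of_flat_of_isLocalRing
  obtain ⟨f, hf, hfree, -⟩ := Module.FinitePresentation.exists_free_localizedModule_powers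
    p.primeCompl (LocalizedModule.mkLinearMap p.primeCompl B) (Localization.AtPrime p)
  refine ⟨f, hf, ?_⟩
  intro A' B' _ _ _ _ _ _ _ _ _ _
  have hloc : IsLocalizedModule (Submonoid.powers f)
      (IsScalarTower.toAlgHom A B B').toLinearMap := inferInstance
  let σ := (IsLocalization.algEquiv (Submonoid.powers f)
      (Localization (Submonoid.powers f)) A').toRingEquiv
  -- Freeness is known for the standard model of the localization. The identification with `B'` is
  -- semilinear along `σ`, which identifies the two models of the base ring.
  have i1 := RingHomInvPair.of_ringEquiv σ
  have i2 := i1.symm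
  refine (Module.Free.iff_of_equiv (σ := (σ : _ →+* A'))
    { __ := IsLocalizedModule.iso (Submonoid.powers f)
        (IsScalarTower.toAlgHom A B B').toLinearMap, map_smul' := ?_ }).1 hfree
  intro r x
  obtain ⟨r, s, rfl⟩ := IsLocalization.exists_mk'_eq (Submonoid.powers f) r
  apply ((Module.End.isUnit_iff _).mp (IsLocalizedModule.map_units
    (IsScalarTower.toAlgHom A B B').toLinearMap s)).1
  simp [σ, ← map_smul, ← smul_assoc]

lemma span_image_mul {A R K : Type*} [CommRing A] [CommRing R] [CommRing K] [Algebra R K]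
    (φ : A →+* K) (I J : Ideal A) :
    Submodule.span R (φ '' (I * J : Ideal A)) =
      Submodule.span R (φ '' I) * Submodule.span R (φ '' J) := by
  rw [Submodule.span_mul_span]
  refine le_antisymm (Submodule.span_le.2 ?_) (Submodule.span_mono ?_)
  · rintro _ ⟨a, ha, rfl⟩
    induction ha using Submodule.mul_induction_on' with
    | mem_mul_mem i hi j hj =>
      rw [map_mul]
      exact Submodule.subset_span ⟨_, ⟨i, hi, rfl⟩, _, ⟨j, hj, rfl⟩, rfl⟩
    | add a _ b _ ha hb => rw [map_add]; exact add_mem ha hb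
  · rintro _ ⟨_, ⟨i, hi, rfl⟩, _, ⟨j, hj, rfl⟩, rfl⟩
    exact ⟨i * j, Ideal.mul_mem_mul hi hj, map_mul φ i j⟩

lemma span_image_ideal_span {A R K : Type*} [CommRing A] [CommRing R] [CommRing K] [Algebra R K]
    (ψ : A →+* R) (φ : A →+* K) (h : ∀ a, φ a = algebraMap R K (ψ a)) (S : Set A) :
    Submodule.span R (φ '' Ideal.span S) = Submodule.span R (φ '' S) := by
  refine le_antisymm (Submodule.span_le.2 ?_)
    (Submodule.span_mono (Set.image_mono Ideal.subset_span))
  rintro _ ⟨a, ha, rfl⟩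
  induction ha using Submodule.span_induction with
  | mem x hx => exact Submodule.subset_span ⟨x, hx, rfl⟩
  | zero => rw [map_zero]; exact zero_mem _
  | add x y _ _ hx hy => rw [map_add]; exact add_mem hx hy
  | smul a x _ hx =>
    have := Submodule.smul_mem _ (ψ a) hx
    rw [Algebra.smul_def, ← h] at this
    rwa [smul_eq_mul, map_mul]

end Algebra

/-! ### Ideals and regular sections on affine open subsets -/

section Affine

variable {X : Scheme.{u}} {U : X.Opens}

lemma span_germFrac_span (x : X) (hx : x ∈ U) (S : Set Γ(X, U)) :
    Submodule.span (X.presheaf.stalk x) (germFrac X U x hx '' Ideal.span S) =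
      Submodule.span (X.presheaf.stalk x) (germFrac X U x hx '' S) :=
  span_image_ideal_span (X.presheaf.germ U x hx).hom _ (fun _ => rfl) S

lemma span_germFrac_top (x : X) (hx : x ∈ U) :
    Submodule.span (X.presheaf.stalk x) (germFrac X U x hx '' (⊤ : Ideal Γ(X, U))) = 1 := by
  rw [← Ideal.span_singleton_one, span_germFrac_span, Set.image_singleton, map_one,
    Submodule.one_eq_span]

lemma AlgebraicGeometry.IsAffineOpen.ideal_eq_of_span_germFrac_eq (hU : IsAffineOpen U)
    {J K : Ideal Γ(X, U)} (h : ∀ (x : X) (hx : x ∈ U),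
      Submodule.span (X.presheaf.stalk x) (germFrac X U x hx '' J) =
        Submodule.span (X.presheaf.stalk x) (germFrac X U x hx '' K)) : J = K := by
  refine le_antisymm (fun c hc => ?_) (fun c hc => ?_)
  · exact hU.mem_ideal_of_germFrac_mem_span K fun x hx =>
      h x hx ▸ Submodule.subset_span ⟨c, hc, rfl⟩
  · exact hU.mem_ideal_of_germFrac_mem_span J fun x hx =>
      h x hx ▸ Submodule.subset_span ⟨c, hc, rfl⟩

lemma IsRegularSection.mem_nonZeroDivisors {b : Γ(X, U)} (hb : IsRegularSection X U b) :
    b ∈ nonZeroDivisors Γ(X, U) := by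
  refine mem_nonZeroDivisors_iff_right.2 fun z hz => ?_
  apply toMer_injective
  have := congrArg (toMer X U) hz
  rw [map_mul, map_zero] at this
  rw [map_zero]
  exact (hb.isUnit_toMer.mul_left_eq_zero).1 this

/-- The stalks are localizations of the ring of sections, and localization preserves
nonzerodivisors. -/
lemma AlgebraicGeometry.IsAffineOpen.isRegularSection (hU : IsAffineOpen U) {b : Γ(X, U)}
    (hb : b ∈ nonZeroDivisors Γ(X, U)) : IsRegularSection X U b := by
  intro x hx
  let := X.presheaf.algebra_section_stalk ⟨x, hx⟩
  have := hU.isLocalization_stalk ⟨x, hx⟩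
  exact IsLocalization.map_nonZeroDivisors_le (hU.primeIdealOf ⟨x, hx⟩).asIdeal.primeCompl
    (X.presheaf.stalk x) ⟨b, hb, rfl⟩

lemma IsRegularSection.mul {a b : Γ(X, U)} (ha : IsRegularSection X U a)
    (hb : IsRegularSection X U b) : IsRegularSection X U (a * b) := fun x hx => by
  rw [map_mul]
  exact mul_mem (ha x hx) (hb x hx)

end Affine

/-! ### Finite flat morphisms -/

section Finite

variable {X Y : Scheme.{u}} (π : X ⟶ Y)

/-- The sections of `π_*𝒪_X` over `V` are a finite free module. -/
def IsFiniteFreeOver (V : Y.Opens) : Prop :=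
  letI := (π.app V).hom.toAlgebra
  Module.Free Γ(Y, V) Γ(X, π ⁻¹ᵁ V) ∧ Module.Finite Γ(Y, V) Γ(X, π ⁻¹ᵁ V)

variable {π}

lemma app_res_apply {V V' : Y.Opens} (h : V' ≤ V) (h' : π ⁻¹ᵁ V' ≤ π ⁻¹ᵁ V) (r : Γ(Y, V)) :
    (X.presheaf.map (homOfLE h').op).hom ((π.app V).hom r) =
      (π.app V').hom ((Y.presheaf.map (homOfLE h).op).hom r) := by
  have := π.naturality (homOfLE h).op
  exact (RingHom.congr_fun (congrArg CommRingCat.Hom.hom this) r).symm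

lemma isLocalization_preimage_basicOpen [IsAffineHom π] {V V' : Y.Opens} (hV : IsAffineOpen V)
    (a : Γ(Y, V)) (hV' : V' ≤ V) (e : V' = Y.basicOpen a) :
    letI := (π.app V).hom.toAlgebra
    letI := (X.presheaf.map (homOfLE (π.preimage_mono hV')).op).hom.toAlgebra
    IsLocalization (Algebra.algebraMapSubmonoid Γ(X, π ⁻¹ᵁ V) (Submonoid.powers a))
      Γ(X, π ⁻¹ᵁ V') := by
  have e' : π ⁻¹ᵁ V' = X.basicOpen ((π.app V).hom a) := by
    rw [e]; exact Scheme.preimage_basicOpen π a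
  have := (hV.preimage π).isLocalization_of_eq_basicOpen _ (homOfLE (π.preimage_mono hV')) e'
  simp only [Algebra.algebraMapSubmonoid, Submonoid.map_powers]
  exact this

lemma normOn_res_basicOpen [AlgebraicGeometry.IsFinite π] {V V' : Y.Opens}
    (hV : IsAffineOpen V) (a : Γ(Y, V)) (hV' : V' ≤ V) (e : V' = Y.basicOpen a)
    (hfree : IsFiniteFreeOver π V) (f : Γ(X, π ⁻¹ᵁ V)) :
    normOn π V' ((X.presheaf.map (homOfLE (π.preimage_mono hV')).op).hom f) =
      (Y.presheaf.map (homOfLE hV').op).hom (normOn π V f) := by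
  let i1 := (π.app V).hom.toAlgebra
  let i2 := (π.app V').hom.toAlgebra
  let i3 := (X.presheaf.map (homOfLE (π.preimage_mono hV')).op).hom.toAlgebra
  let i4 := (Y.presheaf.map (homOfLE hV').op).hom.toAlgebra
  let i5 : Algebra Γ(Y, V) Γ(X, π ⁻¹ᵁ V') := ((π.app V').hom.comp
    (Y.presheaf.map (homOfLE hV').op).hom).toAlgebra
  have t1 : IsScalarTower Γ(Y, V) Γ(Y, V') Γ(X, π ⁻¹ᵁ V') := .of_algebraMap_eq' rfl
  have t2 : IsScalarTower Γ(Y, V) Γ(X, π ⁻¹ᵁ V) Γ(X, π ⁻¹ᵁ V') :=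
    .of_algebraMap_eq fun r => (app_res_apply hV' (π.preimage_mono hV') r).symm
  have l1 := isLocalization_preimage_basicOpen (π := π) hV a hV' e
  have l2 := hV.isLocalization_of_eq_basicOpen a (homOfLE hV') e
  have := hfree.1
  have := hfree.2
  exact Algebra.norm_localization Γ(Y, V) (Submonoid.powers a) f

/-- Every point of `Y` has arbitrarily small affine neighbourhoods over which `π_*𝒪_X` is free. -/
lemma exists_isFiniteFreeOver (π : X ⟶ Y) [IsLocallyNoetherian Y] [AlgebraicGeometry.IsFinite π]
    [AlgebraicGeometry.Flat π] {y : Y} {V₀ : Y.Opens} (hy : y ∈ V₀) :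
    ∃ V : Y.Opens, IsAffineOpen V ∧ y ∈ V ∧ V ≤ V₀ ∧ IsFiniteFreeOver π V := by
  obtain ⟨V, hV, hyV, hVle⟩ := exists_isAffineOpen_mem_and_subset hy
  let i1 := (π.app V).hom.toAlgebra
  have hnoeth : IsNoetherianRing Γ(Y, V) := IsLocallyNoetherian.component_noetherian ⟨V, hV⟩
  have hfin : Module.Finite Γ(Y, V) Γ(X, π ⁻¹ᵁ V) := π.finite_app V hV
  have hflat : Module.Flat Γ(Y, V) Γ(X, π ⁻¹ᵁ V) := by
    have := π.flat_appLE hV (hV.preimage π) le_rfl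
    rw [Scheme.Hom.appLE_eq_app] at this
    exact this
  obtain ⟨a, ha, h⟩ := exists_forall_free_away.{u} (A := Γ(Y, V)) (B := Γ(X, π ⁻¹ᵁ V))
    (hV.primeIdealOf ⟨y, hyV⟩).asIdeal
  have hya : y ∈ Y.basicOpen a := by
    rw [Y.mem_basicOpen a y hyV]
    let := Y.presheaf.algebra_section_stalk ⟨y, hyV⟩
    have := hV.isLocalization_stalk ⟨y, hyV⟩
    exact IsLocalization.map_units (Y.presheaf.stalk y)
      (⟨a, ha⟩ : (hV.primeIdealOf ⟨y, hyV⟩).asIdeal.primeCompl)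
  refine ⟨Y.basicOpen a, hV.basicOpen a, hya, (Y.basicOpen_le a).trans hVle, ?_,
    π.finite_app _ (hV.basicOpen a)⟩
  have hV' := Y.basicOpen_le a
  let i2 := (π.app (Y.basicOpen a)).hom.toAlgebra
  let i3 := (X.presheaf.map (homOfLE (π.preimage_mono hV')).op).hom.toAlgebra
  let i4 := (Y.presheaf.map (homOfLE hV').op).hom.toAlgebra
  let i5 : Algebra Γ(Y, V) Γ(X, π ⁻¹ᵁ (Y.basicOpen a)) := ((π.app (Y.basicOpen a)).hom.comp
    (Y.presheaf.map (homOfLE hV').op).hom).toAlgebra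
  have t1 : IsScalarTower Γ(Y, V) Γ(Y, Y.basicOpen a) Γ(X, π ⁻¹ᵁ (Y.basicOpen a)) :=
    .of_algebraMap_eq' rfl
  have t2 : IsScalarTower Γ(Y, V) Γ(X, π ⁻¹ᵁ V) Γ(X, π ⁻¹ᵁ (Y.basicOpen a)) :=
    .of_algebraMap_eq fun r => (app_res_apply hV' (π.preimage_mono hV') r).symm
  have l1 := isLocalization_preimage_basicOpen (π := π) hV a hV' rfl
  have l2 := hV.isLocalization_of_eq_basicOpen a (homOfLE hV') rfl
  exact h Γ(Y, Y.basicOpen a) Γ(X, π ⁻¹ᵁ (Y.basicOpen a))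

/-- Open neighbourhoods of a fibre of a finite morphism contain preimages of neighbourhoods. -/
lemma exists_preimage_le_of_fiber_le (π : X ⟶ Y) [AlgebraicGeometry.IsFinite π] {y : Y}
    {G : X.Opens} (h : ∀ x, π x = y → x ∈ G) : ∃ V : Y.Opens, y ∈ V ∧ π ⁻¹ᵁ V ≤ G := by
  have hc : IsClosed (π '' (G : Set X)ᶜ) := π.isClosedMap _ G.isOpen.isClosed_compl
  refine ⟨⟨(π '' (G : Set X)ᶜ)ᶜ, hc.isOpen_compl⟩, ?_, fun x hx => ?_⟩
  · rintro ⟨x, hx, hxy⟩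
    exact hx (h x hxy)
  · by_contra hxG
    exact hx ⟨x, hxG, rfl⟩

/-- In an affine open subset containing a finite fibre, there is a function that vanishes at all
points of the fibre except a given one. -/
lemma exists_mem_basicOpen_of_fiber [AlgebraicGeometry.IsFinite π] {y : Y} {U : X.Opens}
    (hU : IsAffineOpen U) {x : X} (hx : x ∈ U) (hxy : π x = y) :
    ∃ e : Γ(X, U), x ∈ X.basicOpen e ∧ ∀ x', π x' = y → x' ∈ X.basicOpen e → x' = x := by
  have hd := (π.isDiscrete_preimage_singleton y).to_subtype
  obtain ⟨W, hW, hWx⟩ := isOpen_induced_iff.1 (isOpen_discrete ({⟨x, hxy⟩} : Set (π ⁻¹' {y})))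
  have hxW : x ∈ W := by
    have : (⟨x, hxy⟩ : π ⁻¹' {y}) ∈ Subtype.val ⁻¹' W := by rw [hWx]; rfl
    exact this
  obtain ⟨e, he, hxe⟩ := hU.exists_basicOpen_le (V := ⟨W, hW⟩) ⟨x, hxW⟩ hx
  refine ⟨e, hxe, fun x' hx' hx'e => ?_⟩
  have : (⟨x', hx'⟩ : π ⁻¹' {y}) ∈ Subtype.val ⁻¹' W := he hx'e
  rw [hWx] at this
  exact congrArg Subtype.val this

end Finite

/-! ### A single equation for a Cartier divisor near a fibre -/

section CartierGenerator

variable {X Y : Scheme.{u}} {π : X ⟶ Y} {I J : MerSubsheaf X}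

lemma isUnit_of_span_singleton_eq {R K : Type*} [CommRing R] [CommRing K] [Algebra R K] {u z : K}
    (hu : IsUnit u) (h : Submodule.span R {u} = Submodule.span R {z}) : IsUnit z := by
  have hmem : u ∈ Submodule.span R {z} := h ▸ Submodule.mem_span_singleton_self u
  obtain ⟨c, rfl⟩ := Submodule.mem_span_singleton.1 hmem
  rw [Algebra.smul_def] at hu
  exact isUnit_of_mul_isUnit_right hu

lemma MerSubsheaf.IsCartier.isUnit_of_stalk_eq (hI : I.IsCartier) {x : X} {z : FracStalk X x}
    (h : I.stalk x = Submodule.span (X.presheaf.stalk x) {z}) : IsUnit z := by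
  obtain ⟨V, hx, u, hu⟩ := hI x
  rw [hu x hx] at h
  exact isUnit_of_span_singleton_eq (isUnit_val_merUnits u ⟨x, hx⟩) h

lemma MerSubsheaf.IsCartier.isRegularSection (hI : I.IsCartier) {U : X.Opens} {f : Γ(X, U)}
    (h : I.IsGeneratedOn U (toMer X U f)) : IsRegularSection X U f := fun x hx =>
  (isUnit_germFrac_iff f x hx).1 (hI.isUnit_of_stalk_eq (h x hx))

lemma span_singleton_eq_of_isUnit {R K : Type*} [CommRing R] [CommRing K] [Algebra R K] {z : K}
    {r : R} (hr : IsUnit r) : Submodule.span R {algebraMap R K r * z} = Submodule.span R {z} := by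
  rw [← Algebra.smul_def]
  exact Submodule.span_singleton_smul_eq hr z

/-- If a principal submodule generated by a unit is also generated by a set of elements, then over
a local ring it is generated by one of them. -/
lemma exists_span_singleton_eq_of_span_eq {R K : Type*} [CommRing R] [IsLocalRing R] [CommRing K]
    [Algebra R K] (hinj : Function.Injective (algebraMap R K)) {u : K} (hu : IsUnit u) {S : Set K}
    (h : Submodule.span R {u} = Submodule.span R S) :
    ∃ s ∈ S, Submodule.span R {s} = Submodule.span R {u} := by
  by_contra! hne
  -- If no member generates, each is a nonunit times `u`, so the span lies in `𝔪 * u`. Then `u = m *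
  -- u` with `m ∈ 𝔪`, and cancelling the unit `u` gives `m = 1`.
  have hle : Submodule.span R S ≤
      Submodule.map (LinearMap.toSpanSingleton R K u) (IsLocalRing.maximalIdeal R) := by
    refine Submodule.span_le.2 fun s hs => ?_
    have hsu : s ∈ Submodule.span R {u} := h ▸ Submodule.subset_span hs
    obtain ⟨c, rfl⟩ := Submodule.mem_span_singleton.1 hsu
    refine ⟨c, fun hc => hne _ hs (Submodule.span_singleton_smul_eq hc u), rfl⟩
  obtain ⟨m, hm, hmu⟩ := hle (h ▸ Submodule.mem_span_singleton_self u)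
  have h1 : algebraMap R K m * u = 1 * u := by
    rw [one_mul, ← Algebra.smul_def]; exact hmu
  have h2 := hu.mul_right_cancel h1
  rw [← map_one (algebraMap R K)] at h2
  have h3 := hinj h2
  subst h3
  exact (Ideal.ne_top_iff_one _).1 (IsLocalRing.maximalIdeal.isMaximal R).ne_top hm

/-- An effective Cartier divisor is generated by one function near any fibre of a finite
morphism. -/
lemma MerSubsheaf.IsCartier.exists_generator (π : X ⟶ Y) [AlgebraicGeometry.IsFinite π]
    (hI : I.IsCartier) (he : I.IsEffective) (y : Y) :
    ∃ (V : Y.Opens) (_ : y ∈ V) (f : Γ(X, π ⁻¹ᵁ V)),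
      I.IsGeneratedOn (π ⁻¹ᵁ V) (toMer X _ f) := by
  classical
  obtain ⟨V, hV, hyV, -⟩ := exists_isAffineOpen_mem_and_subset (x := y) (U := ⊤) trivial
  set U := π ⁻¹ᵁ V with hUdef
  have hU : IsAffineOpen U := hV.preimage π
  have hfin : (π ⁻¹' {y}).Finite := π.finite_preimage_singleton y
  have hmem : ∀ x, π x = y → x ∈ U := fun x hx => by
    change π x ∈ V
    rwa [hx]
  have hg : ∀ x : X, ∃ g : Γ(X, U), g ∈ I.idealOn U ∧ ∀ hx : π x = y,
      Submodule.span (X.presheaf.stalk x) {germFrac X U x (hmem x hx) g} = I.stalk x := by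
    intro x
    by_cases hx : π x = y
    · obtain ⟨W, hxW, u, hu⟩ := hI x
      have h1 := hI.isCoherent.stalk_eq_span_idealOn he hU (hmem x hx)
      rw [hu x hxW] at h1
      obtain ⟨_, ⟨g, hgI, rfl⟩, hg⟩ := exists_span_singleton_eq_of_span_eq
        (IsFractionRing.injective (X.presheaf.stalk x) (FracStalk X x))
        (isUnit_val_merUnits u ⟨x, hxW⟩) h1
      exact ⟨g, hgI, fun _ => by rw [hg, hu x hxW]⟩
    · exact ⟨0, zero_mem _, fun h => (hx h).elim⟩
  choose g hgI hg using hg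
  have he : ∀ x : X, ∃ e : Γ(X, U), π x = y →
      (x ∈ X.basicOpen e ∧ ∀ x', π x' = y → x' ∈ X.basicOpen e → x' = x) := by
    intro x
    by_cases hx : π x = y
    · obtain ⟨e, h⟩ := exists_mem_basicOpen_of_fiber hU (hmem x hx) hx
      exact ⟨e, fun _ => h⟩
    · exact ⟨0, fun h => (hx h).elim⟩
  choose e he using he
  -- At a point `x` of the fibre, `e x` is a unit, the other `e x'` lie in the maximal ideal, and
  -- every `g x'` is a multiple of the local generator `g x`. So `f` is a unit times `g x` there.
  set f : Γ(X, U) := ∑ x ∈ hfin.toFinset, e x * g x with hf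
  have hfgen : ∀ x (hx : π x = y), I.stalk x =
      Submodule.span (X.presheaf.stalk x) {germFrac X U x (hmem x hx) f} := by
    intro x hx
    have hmult : ∀ x', ∃ r, algebraMap (X.presheaf.stalk x) (FracStalk X x) r *
        germFrac X U x (hmem x hx) (g x) = germFrac X U x (hmem x hx) (g x') := fun x' => by
      have h1 := mem_idealOn_iff.1 (hgI x') x (hmem x hx)
      rw [← hg x hx] at h1
      obtain ⟨r, hr⟩ := Submodule.mem_span_singleton.1 h1
      exact ⟨r, by rw [← hr, Algebra.smul_def]⟩
    choose r hr using hmult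
    set c : X.presheaf.stalk x := (X.presheaf.germ U x (hmem x hx)).hom (e x) +
      ∑ x' ∈ hfin.toFinset.erase x, (X.presheaf.germ U x (hmem x hx)).hom (e x') * r x' with hc
    have hfc : germFrac X U x (hmem x hx) f =
        algebraMap (X.presheaf.stalk x) (FracStalk X x) c *
          germFrac X U x (hmem x hx) (g x) := by
      have hxf : x ∈ hfin.toFinset := by simpa using hx
      rw [hf, ← Finset.add_sum_erase _ _ hxf, map_add, map_sum, hc, map_add, add_mul, map_sum,
        Finset.sum_mul, map_mul]
      congr 1
      refine Finset.sum_congr rfl fun x' _ => ?_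
      rw [map_mul, map_mul, ← hr x', mul_assoc]
      rfl
    have hcu : IsUnit c := by
      have hnu : ∑ x' ∈ hfin.toFinset.erase x,
          (X.presheaf.germ U x (hmem x hx)).hom (e x') * r x' ∈
            IsLocalRing.maximalIdeal (X.presheaf.stalk x) := by
        refine Ideal.sum_mem _ fun x' hx' => Ideal.mul_mem_right _ _ ?_
        rw [Finset.mem_erase, Set.Finite.mem_toFinset] at hx'
        rw [IsLocalRing.mem_maximalIdeal, mem_nonunits_iff]
        intro hu
        exact hx'.1 ((he x' hx'.2).2 x hx ((X.mem_basicOpen _ x (hmem x hx)).2 hu)).symm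
      have hu : IsUnit ((X.presheaf.germ U x (hmem x hx)).hom (e x)) :=
        (X.mem_basicOpen _ x (hmem x hx)).1 (he x hx).1
      by_contra hcn
      have h1 : c ∈ IsLocalRing.maximalIdeal (X.presheaf.stalk x) := hcn
      have h2 := Ideal.sub_mem _ h1 hnu
      rw [hc, add_sub_cancel_right] at h2
      exact h2 hu
    rw [hfc, span_singleton_eq_of_isUnit hcu, hg x hx]
  -- Being generated by `f` spreads from each point of the fibre to a neighbourhood by coherence,
  -- then to the preimage of a neighbourhood of `y`.
  have hopen : ∀ x, π x = y → ∃ W : X.Opens, x ∈ W ∧ W ≤ U ∧ ∀ (z : X) (hz : z ∈ U), z ∈ W →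
      I.stalk z = Submodule.span (X.presheaf.stalk z) {germFrac X U z hz f} := by
    intro x hx
    have hfI : f ∈ I.idealOn U := Ideal.sum_mem _ fun x _ => Ideal.mul_mem_left _ _ (hgI x)
    obtain ⟨W, hxW, hW⟩ := hI.isCoherent.exists_stalk_le
      (J := MerSubsheaf.spanSection U (toMer X U f)) (x := x) (by
        rw [MerSubsheaf.stalk_spanSection _ _ x (hmem x hx)]
        exact (hfgen x hx).le)
    refine ⟨W ⊓ U, ⟨hxW, hmem x hx⟩, inf_le_right, fun z hz hzW => le_antisymm ?_ ?_⟩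
    · have := hW z hzW.1
      rwa [MerSubsheaf.stalk_spanSection _ _ z hz] at this
    · rw [Submodule.span_le, Set.singleton_subset_iff]
      exact mem_idealOn_iff.1 hfI z hz
  choose W hxW hWU hW using hopen
  obtain ⟨V', hyV', hV'⟩ := exists_preimage_le_of_fiber_le π (y := y)
    (G := ⨆ x, ⨆ hx : π x = y, W x hx) fun x hx => by
      simp only [TopologicalSpace.Opens.mem_iSup]
      exact ⟨x, hx, hxW x hx⟩
  have hle : π ⁻¹ᵁ V' ≤ U := hV'.trans (iSup_le fun x => iSup_le fun hx => hWU x hx)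
  refine ⟨V', hyV', (X.presheaf.map (homOfLE hle).op).hom f, fun z hz => ?_⟩
  have h1 := hV' hz
  simp only [TopologicalSpace.Opens.mem_iSup] at h1
  obtain ⟨x, hx, hzW⟩ := h1
  rw [hW x hx z (hle hz) hzW, ← germFrac_res hle f z hz]
  rfl

lemma MerSubsheaf.IsGeneratedOn.res_toMer {U V : X.Opens} {f : Γ(X, U)}
    (h : I.IsGeneratedOn U (toMer X U f)) (hVU : V ≤ U) :
    I.IsGeneratedOn V (toMer X V ((X.presheaf.map (homOfLE hVU).op).hom f)) := by
  rw [← toMer_res hVU]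
  exact h.mono hVU

end CartierGenerator

/-! ### Multiplicativity of the Fitting sheaf -/

section Multiplicativity

variable {X Y : Scheme.{u}} {π : X ⟶ Y} {I J : MerSubsheaf X}

/-- Both ideals generate the same stalks, which suffices over an affine open subset. -/
lemma idealOn_mul_of_isGeneratedOn (hI : I.IsCoherent) (hIe : I.IsEffective) (hJ : J.IsCoherent)
    (hJe : J.IsEffective) {U : X.Opens} (hU : IsAffineOpen U) {f : Γ(X, U)}
    (hf : I.IsGeneratedOn U (toMer X U f)) :
    (I * J).idealOn U = Ideal.span {f} * J.idealOn U := by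
  refine hU.ideal_eq_of_span_germFrac_eq fun x hx => ?_
  rw [← (hI.mul hJ).stalk_eq_span_idealOn (hIe.mul hJe) hU hx, MerSubsheaf.stalk_mul, hf x hx,
    span_image_mul, ← hJ.stalk_eq_span_idealOn hJe hU hx, span_germFrac_span, Set.image_singleton]
  rfl

lemma idealOn_one (U : X.Opens) : (1 : MerSubsheaf X).idealOn U = ⊤ := by
  rw [Ideal.eq_top_iff_one, MerSubsheaf.mem_idealOn_iff]
  intro x hx
  rw [MerSubsheaf.stalk_one, map_one]
  exact Submodule.one_le.1 le_rfl

lemma isEffective_one : (1 : MerSubsheaf X).IsEffective :=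
  MerSubsheaf.isEffective_iff.2 fun x => (MerSubsheaf.stalk_one x).le

lemma fittingOn_eq_top_of_idealOn_eq_top {V : Y.Opens} (h : I.idealOn (π ⁻¹ᵁ V) = ⊤) :
    fittingOn π I V = ⊤ := by
  let := (π.app V).hom.toAlgebra
  have : Subsingleton (Γ(X, π ⁻¹ᵁ V) ⧸ I.idealOn (π ⁻¹ᵁ V)) :=
    Ideal.Quotient.subsingleton_iff.2 h
  exact fittingIdeal_of_subsingleton

/-- The symmetric form serves twice: with `f = 1` for multiplicativity, and with general `f`, `g`
for a divisor generated by a quotient of two equations. -/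
lemma fittingOn_congr_span_mul {V : Y.Opens} (hV : IsFiniteFreeOver π V) {f g : Γ(X, π ⁻¹ᵁ V)}
    (h : Ideal.span {f} * I.idealOn (π ⁻¹ᵁ V) = Ideal.span {g} * J.idealOn (π ⁻¹ᵁ V)) :
    Ideal.span {normOn π V f} * fittingOn π I V = Ideal.span {normOn π V g} * fittingOn π J V := by
  let := (π.app V).hom.toAlgebra
  have := hV.1
  have := hV.2
  have h1 := fittingIdeal_quotient_span_mul (R := Γ(Y, V)) f (I.idealOn (π ⁻¹ᵁ V))
  rw [h] at h1
  exact h1.symm.trans (fittingIdeal_quotient_span_mul (R := Γ(Y, V)) g (J.idealOn (π ⁻¹ᵁ V)))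

lemma normOn_mul {V : Y.Opens} (f g : Γ(X, π ⁻¹ᵁ V)) :
    normOn π V (f * g) = normOn π V f * normOn π V g := by
  let := (π.app V).hom.toAlgebra
  exact map_mul (Algebra.norm Γ(Y, V)) f g

lemma normOn_one {V : Y.Opens} : normOn π V 1 = 1 := by
  let := (π.app V).hom.toAlgebra
  exact map_one (Algebra.norm Γ(Y, V))

lemma isRegularSection_normOn [IsLocallyNoetherian Y] {V : Y.Opens} (hV : IsAffineOpen V)
    (hfree : IsFiniteFreeOver π V) {f : Γ(X, π ⁻¹ᵁ V)} (hf : IsRegularSection X (π ⁻¹ᵁ V) f) :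
    IsRegularSection Y V (normOn π V f) := by
  let := (π.app V).hom.toAlgebra
  have : IsNoetherianRing Γ(Y, V) := IsLocallyNoetherian.component_noetherian ⟨V, hV⟩
  have := hfree.1
  have := hfree.2
  exact hV.isRegularSection (norm_mem_nonZeroDivisors hf.mem_nonZeroDivisors)

variable [AlgebraicGeometry.IsFinite π]

lemma fittingOn_mul_of_isGeneratedOn (hI : I.IsCoherent) (hIe : I.IsEffective) (hJ : J.IsCoherent)
    (hJe : J.IsEffective) {V : Y.Opens} (hV : IsAffineOpen V) (hfree : IsFiniteFreeOver π V)
    {f : Γ(X, π ⁻¹ᵁ V)} (hf : I.IsGeneratedOn (π ⁻¹ᵁ V) (toMer X _ f)) :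
    fittingOn π (I * J) V = Ideal.span {normOn π V f} * fittingOn π J V := by
  have h := fittingOn_congr_span_mul (I := I * J) (J := J) hfree (f := 1) (g := f) (by
    rw [Ideal.span_singleton_one, Ideal.top_mul,
      idealOn_mul_of_isGeneratedOn hI hIe hJ hJe (hV.preimage π) hf])
  rwa [normOn_one, Ideal.span_singleton_one, Ideal.top_mul] at h

lemma fittingOn_of_isGeneratedOn (hI : I.IsCoherent) (hIe : I.IsEffective) {V : Y.Opens}
    (hV : IsAffineOpen V) (hfree : IsFiniteFreeOver π V) {f : Γ(X, π ⁻¹ᵁ V)}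
    (hf : I.IsGeneratedOn (π ⁻¹ᵁ V) (toMer X _ f)) :
    fittingOn π I V = Ideal.span {normOn π V f} := by
  have h := fittingOn_mul_of_isGeneratedOn (J := 1) hI hIe MerSubsheaf.isCartier_one.isCoherent
    isEffective_one hV hfree hf
  rwa [mul_one, fittingOn_eq_top_of_idealOn_eq_top (idealOn_one _), Ideal.mul_top] at h

/-- The direct image of an effective Cartier divisor is locally generated by the norm of an
equation. -/
lemma fittingSheaf_isGeneratedOn (hI : I.IsCoherent) (hIe : I.IsEffective) {V : Y.Opens}
    (hV : IsAffineOpen V) (hfree : IsFiniteFreeOver π V) {f : Γ(X, π ⁻¹ᵁ V)}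
    (hf : I.IsGeneratedOn (π ⁻¹ᵁ V) (toMer X _ f)) :
    (fittingSheaf π I).IsGeneratedOn V (toMer Y V (normOn π V f)) := fun y hy => by
  rw [stalk_fittingSheaf π hI hIe hV hy, fittingOn_of_isGeneratedOn hI hIe hV hfree hf,
    span_germFrac_span, Set.image_singleton]
  rfl

omit [AlgebraicGeometry.IsFinite π] in
lemma isEffective_fittingSheaf : (fittingSheaf π I).IsEffective :=
  MerSubsheaf.isEffective_iff.2 fun y => by
    rintro _ ⟨U, hy, s, hs, rfl⟩
    refine Submodule.span_le.2 ?_ (hs ⟨y, hy⟩)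
    rintro _ ⟨W, hyW, a, -, -, rfl⟩
    exact Submodule.mem_one.2 ⟨_, rfl⟩

lemma fittingSheaf_one : fittingSheaf π 1 = 1 := MerSubsheaf.ext_stalk fun y => by
  obtain ⟨V, hV, hyV, -⟩ := exists_isAffineOpen_mem_and_subset (x := y) (U := ⊤) trivial
  rw [stalk_fittingSheaf π MerSubsheaf.isCartier_one.isCoherent isEffective_one hV hyV,
    fittingOn_eq_top_of_idealOn_eq_top (idealOn_one _), span_germFrac_top, MerSubsheaf.stalk_one]

variable [IsLocallyNoetherian Y]

lemma isCoherent_fittingSheaf (hI : I.IsCoherent) (hIe : I.IsEffective) :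
    (fittingSheaf π I).IsCoherent := fun y => by
  obtain ⟨V, hV, hyV, -⟩ := exists_isAffineOpen_mem_and_subset (x := y) (U := ⊤) trivial
  have : IsNoetherianRing Γ(Y, V) := IsLocallyNoetherian.component_noetherian ⟨V, hV⟩
  obtain ⟨n, s, hs⟩ := Submodule.fg_iff_exists_fin_generating_family.1
    (IsNoetherian.noetherian (fittingOn π I V))
  refine ⟨V, hyV, n, fun i => toMer Y V (s i), fun z hz => ?_⟩
  have hs' : fittingOn π I V = Ideal.span (Set.range s) := hs.symm
  rw [stalk_fittingSheaf π hI hIe hV hz, hs', span_germFrac_span, ← Set.range_comp]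
  rfl

omit [IsLocallyNoetherian Y] in
/-- The points over a generic point are generic. -/
lemma closure_mem_irreducibleComponents_of_apply {x : X}
    (h : closure {π x} ∈ irreducibleComponents Y) : closure {x} ∈ irreducibleComponents X := by
  refine ⟨isIrreducible_singleton.closure, fun Z hZ hle => ?_⟩
  obtain ⟨ξ, hξ⟩ := QuasiSober.sober hZ.closure isClosed_closure
  have hξx : ξ ⤳ x := by
    rw [specializes_iff_closure_subset, hξ.def]
    exact hle.trans subset_closure
  have h1 : closure {π x} ⊆ closure {π ξ} :=
    specializes_iff_closure_subset.1 (hξx.map π.continuous)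
  have h2 : π x ⤳ π ξ :=
    specializes_iff_closure_subset.2 (h.2 isIrreducible_singleton.closure h1)
  have h3 : π ξ = π x := ((hξx.map π.continuous).antisymm h2).eq
  obtain ⟨V, hV, hxV, -⟩ := exists_isAffineOpen_mem_and_subset (x := π x) (U := ⊤) trivial
  -- A generalization of `x` lies in every neighbourhood of `x`, in particular in one that meets the
  -- fibre only in `x`.
  obtain ⟨e, hxe, he⟩ := exists_mem_basicOpen_of_fiber (π := π) (hV.preimage π)
    (x := x) hxV rfl
  have h4 : ξ = x := he ξ h3 (hξx.mem_open (X.basicOpen e).isOpen hxe)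
  rw [← h4, hξ.def]
  exact subset_closure

/-- All points over a generic point are generic, so `𝒪_X / I` vanishes near the fibre and its direct
image vanishes near `η`. The Fitting ideal of the zero module is the unit ideal. -/
lemma isGenDivisor_fittingSheaf (hI : I.IsGenDivisor) (hIe : I.IsEffective) :
    (fittingSheaf π I).IsGenDivisor where
  isCoherent := isCoherent_fittingSheaf hI.isCoherent hIe
  nondegenerate η hη := by
    have hopen : ∀ x, π x = η → ∃ W : X.Opens, x ∈ W ∧ ∀ z ∈ W,
        (1 : MerSubsheaf X).stalk z ≤ I.stalk z := fun x hx =>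
      MerSubsheaf.isCartier_one.isCoherent.exists_stalk_le (by
        rw [hI.nondegenerate x (closure_mem_irreducibleComponents_of_apply (π := π) (by rwa [hx]))]
        exact le_top)
    choose W hxW hW using hopen
    obtain ⟨V₀, hηV₀, hV₀⟩ := exists_preimage_le_of_fiber_le π (y := η)
      (G := ⨆ x, ⨆ hx : π x = η, W x hx) fun x hx => by
        simp only [TopologicalSpace.Opens.mem_iSup]
        exact ⟨x, hx, hxW x hx⟩
    obtain ⟨V, hV, hηV, hVV₀⟩ := exists_isAffineOpen_mem_and_subset hηV₀
    have htop : I.idealOn (π ⁻¹ᵁ V) = ⊤ := by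
      rw [Ideal.eq_top_iff_one, MerSubsheaf.mem_idealOn_iff]
      intro z hz
      have h1 := hV₀ (π.preimage_mono hVV₀ hz)
      simp only [TopologicalSpace.Opens.mem_iSup] at h1
      obtain ⟨x, hx, hzW⟩ := h1
      refine hW x hx z hzW ?_
      rw [map_one, MerSubsheaf.stalk_one]
      exact Submodule.one_le.1 le_rfl
    rw [stalk_fittingSheaf π hI.isCoherent hIe hV hηV, fittingOn_eq_top_of_idealOn_eq_top htop,
      span_germFrac_top, Submodule.one_eq_span]
    exact MerSubsheaf.span_singleton_eq_top_of_isUnit hη isUnit_one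

variable [AlgebraicGeometry.Flat π]

lemma exists_isFiniteFreeOver_isGeneratedOn (hI : I.IsCartier)
    (hIe : I.IsEffective) {y : Y} {V₀ : Y.Opens} (hy : y ∈ V₀) :
    ∃ (V : Y.Opens) (_ : y ∈ V) (f : Γ(X, π ⁻¹ᵁ V)), V ≤ V₀ ∧ IsAffineOpen V ∧
      IsFiniteFreeOver π V ∧ I.IsGeneratedOn (π ⁻¹ᵁ V) (toMer X _ f) := by
  obtain ⟨V₁, hyV₁, f, hf⟩ := hI.exists_generator π hIe y
  obtain ⟨V, hV, hyV, hle, hfree⟩ := exists_isFiniteFreeOver π (V₀ := V₀ ⊓ V₁) ⟨hy, hyV₁⟩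
  exact ⟨V, hyV, _, hle.trans inf_le_left, hV, hfree,
    hf.res_toMer (π.preimage_mono (hle.trans inf_le_right))⟩

/-- Locally on `Y` the Cartier factor has one equation `f` on the whole preimage, and both sides are
the norm of `f` times the Fitting ideal of `J`. -/
lemma fittingSheaf_mul (hI : I.IsCartier) (hIe : I.IsEffective) (hJ : J.IsCoherent)
    (hJe : J.IsEffective) : fittingSheaf π (I * J) = fittingSheaf π I * fittingSheaf π J :=
  MerSubsheaf.ext_stalk fun y => by
    obtain ⟨V, hyV, f, -, hV, hfree, hf⟩ :=
      exists_isFiniteFreeOver_isGeneratedOn (π := π) hI hIe (V₀ := ⊤) (y := y) trivial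
    rw [MerSubsheaf.stalk_mul, stalk_fittingSheaf π (hI.isCoherent.mul hJ) (hIe.mul hJe) hV hyV,
      stalk_fittingSheaf π hI.isCoherent hIe hV hyV, stalk_fittingSheaf π hJ hJe hV hyV,
      fittingOn_mul_of_isGeneratedOn hI.isCoherent hIe hJ hJe hV hfree hf,
      fittingOn_of_isGeneratedOn hI.isCoherent hIe hV hfree hf, span_image_mul]

lemma isCartier_fittingSheaf (hI : I.IsCartier) (hIe : I.IsEffective) :
    (fittingSheaf π I).IsCartier := fun y => by
  obtain ⟨V, hyV, f, -, hV, hfree, hf⟩ :=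
    exists_isFiniteFreeOver_isGeneratedOn (π := π) hI hIe (V₀ := ⊤) (y := y) trivial
  have hreg := isRegularSection_normOn hV hfree (hI.isRegularSection hf)
  refine ⟨V, hyV, hreg.isUnit_toMer.unit, ?_⟩
  exact fittingSheaf_isGeneratedOn hI.isCoherent hIe hV hfree hf

end Multiplicativity

/-! ### Divisors on a curve as differences of effective divisors -/

section Denominators

variable {X : Scheme.{u}}

/-- On a curve, every point that is not generic is closed. -/
lemma IsPureCurve.isClosed_singleton (hX : IsPureCurve X) {z : X}
    (hz : closure {z} ∉ irreducibleComponents X) : IsClosed ({z} : Set X) := by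
  rw [← closure_subset_iff_isClosed]
  intro w hw
  by_contra hne
  obtain ⟨C, hC, hzC⟩ : ∃ C ∈ irreducibleComponents X, z ∈ C :=
    ⟨_, irreducibleComponent_mem_irreducibleComponents z, mem_irreducibleComponent⟩
  have hCc := isClosed_of_mem_irreducibleComponents C hC
  obtain ⟨η, hη⟩ := QuasiSober.sober hC.1 hCc
  have hηC : η ∈ C := hη.mem
  have hwC : w ∈ C := hCc.closure_subset_iff.2 (Set.singleton_subset_iff.2 hzC) hw
  -- A point `z` that is neither closed nor generic would give a chain of length two in a component
  -- of dimension one.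
  let p : C → TopologicalSpace.IrreducibleCloseds C := fun a =>
    ⟨closure {a}, isIrreducible_singleton.closure, isClosed_closure⟩
  have hlt : ∀ a b : C, b.1 ⤳ a.1 → ¬ a.1 ⤳ b.1 → p a < p b := fun a b hba hab => by
    rw [← subtype_specializes_iff, specializes_iff_closure_subset] at hba hab
    exact lt_of_le_not_ge hba hab
  have hzw : z ⤳ w := specializes_iff_mem_closure.2 hw
  have h1 : p ⟨w, hwC⟩ < p ⟨z, hzC⟩ := hlt _ _ hzw fun h => hne (h.antisymm hzw).eq
  have hηz : η ⤳ z := specializes_iff_mem_closure.2 (hη.def.symm ▸ hzC)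
  have h2 : p ⟨z, hzC⟩ < p ⟨η, hηC⟩ := hlt _ _ hηz fun h => hz (by
    have hzη : z = η := (h.antisymm hηz).eq
    rw [hzη, hη.def]; exact hC)
  let s : LTSeries (TopologicalSpace.IrreducibleCloseds C) :=
    ⟨2, ![p ⟨w, hwC⟩, p ⟨z, hzC⟩, p ⟨η, hηC⟩], fun i => by
      fin_cases i
      · exact h1
      · exact h2⟩
  have h3 : ((2 : ℕ) : WithBot ℕ∞) ≤ topologicalKrullDim C := Order.LTSeries.length_le_krullDim s
  rw [hX.dim_eq_one C hC] at h3
  norm_num at h3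

lemma IsRegularSection.not_mem_irreducibleComponents {V : X.Opens} {b : Γ(X, V)}
    (hb : IsRegularSection X V b) {z : X} (hz : z ∈ V)
    (h : ¬ IsUnit ((X.presheaf.germ V z hz).hom b)) :
    closure {z} ∉ irreducibleComponents X := fun hc =>
  h (isUnit_of_mem_nonZeroDivisors_stalk hc (hb z hz))

open Classical in
/-- On a curve, the zeros of a regular section are isolated. -/
lemma IsPureCurve.exists_isUnit_germ (hX : IsPureCurve X) {V : X.Opens} {b : Γ(X, V)}
    (hb : IsRegularSection X V b) {x : X} (hx : x ∈ V) :
    ∃ (W : X.Opens) (_ : x ∈ W) (hWV : W ≤ V), ∀ (z : X) (hz : z ∈ W), z ≠ x →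
      IsUnit ((X.presheaf.germ V z (hWV hz)).hom b) := by
  have := hX.isNoetherian
  obtain ⟨V', hV', hxV', hle⟩ := exists_isAffineOpen_mem_and_subset hx
  have hle : V' ≤ V := hle
  have hnoeth : IsNoetherianRing Γ(X, V') := IsLocallyNoetherian.component_noetherian ⟨V', hV'⟩
  set b' := (X.presheaf.map (homOfLE hle).op).hom b with hb'
  have hunit : ∀ (z : X) (hz : z ∈ V'), IsUnit ((X.presheaf.germ V z (hle hz)).hom b) ↔
      b' ∉ (hV'.primeIdealOf ⟨z, hz⟩).asIdeal := fun z hz => by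
    let := X.presheaf.algebra_section_stalk ⟨z, hz⟩
    have := hV'.isLocalization_stalk ⟨z, hz⟩
    rw [← X.presheaf.germ_res_apply (homOfLE hle) z hz b]
    exact IsLocalization.AtPrime.isUnit_to_map_iff (X.presheaf.stalk z)
      (hV'.primeIdealOf ⟨z, hz⟩).asIdeal b'
  let Z : Set X := {z | ∃ hz : z ∈ V', ¬ IsUnit ((X.presheaf.germ V z (hle hz)).hom b)}
  have hZc : ∀ z ∈ Z, IsClosed ({z} : Set X) := fun z ⟨hz, h⟩ =>
    hX.isClosed_singleton (hb.not_mem_irreducibleComponents (hle hz) h)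
  have hZ : Z.Finite := by
    have hfin : ((Ideal.span {b'}).minimalPrimes).Finite :=
      Ideal.finite_minimalPrimes_of_isNoetherianRing _ _
    -- The zeros are among the points given by the finitely many minimal primes over `b'`: such a
    -- point below a zero `z` is itself a zero, hence closed, hence equal to `z`. The value `x` is a
    -- default for ideals that are not prime.
    refine Set.Finite.subset (hfin.image fun p =>
      if h : p.IsPrime then hV'.fromSpec ⟨p, h⟩ else x) ?_
    rintro z ⟨hz, h⟩
    rw [hunit z hz, not_not] at h
    obtain ⟨p, hp, hpz⟩ := Ideal.exists_minimalPrimes_le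
      ((Ideal.span_singleton_le_iff_mem _).2 h)
    have hpp : p.IsPrime := hp.1.1
    refine ⟨p, hp, ?_⟩
    simp only [dif_pos hpp]
    set z' := hV'.fromSpec ⟨p, hpp⟩ with hz'
    have hz'V : z' ∈ V' := by
      have : z' ∈ Set.range hV'.fromSpec := ⟨_, rfl⟩
      rwa [hV'.range_fromSpec] at this
    have hprime : hV'.primeIdealOf ⟨z', hz'V⟩ = ⟨p, hpp⟩ :=
      hV'.fromSpec.isEmbedding.injective (hV'.fromSpec_primeIdealOf ⟨z', hz'V⟩)
    have hz'Z : z' ∈ Z := ⟨hz'V, by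
      rw [hunit z' hz'V, hprime, not_not]
      exact hp.1.2 (Ideal.mem_span_singleton_self _)⟩
    have hsp : z' ⤳ z := by
      have h1 : (⟨p, hpp⟩ : PrimeSpectrum Γ(X, V')) ⤳ hV'.primeIdealOf ⟨z, hz⟩ :=
        (PrimeSpectrum.le_iff_specializes _ _).1 hpz
      have h2 := h1.map hV'.fromSpec.continuous
      rwa [hV'.fromSpec_primeIdealOf] at h2
    have h3 : z ∈ closure {z'} := specializes_iff_mem_closure.1 hsp
    rw [(hZc z' hz'Z).closure_eq] at h3
    exact (Set.mem_singleton_iff.1 h3).symm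
  have hclosed : IsClosed (Z \ {x}) := by
    rw [← Set.biUnion_of_singleton (Z \ {x})]
    exact (hZ.subset Set.sdiff_subset).isClosed_biUnion fun z hz => hZc z hz.1
  refine ⟨V' ⊓ ⟨(Z \ {x})ᶜ, hclosed.isOpen_compl⟩, ⟨hxV', fun h => h.2 rfl⟩,
    inf_le_left.trans hle, fun z hz hne => ?_⟩
  by_contra hu
  exact hz.2 ⟨⟨hz.1, hu⟩, hne⟩

/-- Finitely many sections of `𝒦_X` locally have a common denominator. -/
lemma exists_common_denominator {n : ℕ} {V : X.Opens} (s : Fin n → merSections X V) {x : X}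
    (hx : x ∈ V) : ∃ (W : X.Opens) (_ : x ∈ W) (hWV : W ≤ V) (b : Γ(X, W)),
      IsRegularSection X W b ∧ ∀ i (y : X) (hy : y ∈ W), germFrac X W y hy b * (s i).1 ⟨y, hWV hy⟩ ∈
        (1 : Submodule (X.presheaf.stalk y) (FracStalk X y)) := by
  induction n with
  | zero => exact ⟨V, hx, le_rfl, 1, fun y hy => by simp [one_mem], fun i => i.elim0⟩
  | succ n ih =>
    obtain ⟨W, hxW, hWV, b, hb, h⟩ := ih (fun i => s i.succ)
    obtain ⟨W', hxW', hW'V, a, c, hc, h'⟩ := (s 0).2 ⟨x, hx⟩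
    refine ⟨W ⊓ W', ⟨hxW, hxW'⟩, inf_le_left.trans hWV,
      (X.presheaf.map (homOfLE inf_le_left).op).hom b *
        (X.presheaf.map (homOfLE inf_le_right).op).hom c,
      (hb.res inf_le_left).mul (hc.res inf_le_right), fun i y hy => ?_⟩
    rw [map_mul, germFrac_res, germFrac_res]
    refine Fin.cases ?_ (fun i => ?_) i
    · rw [mul_assoc, mul_comm (germFrac X W' y hy.2 c), h' y hy.2]
      exact germFrac_mul_mem _ _ (Submodule.mem_one.2 ⟨_, rfl⟩)
    · rw [mul_comm (germFrac X W y hy.1 b), mul_assoc]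
      exact germFrac_mul_mem _ _ (h i y hy.1)

namespace MerSubsheaf

/-- Stalks may be prescribed arbitrarily as long as, near each point, they are those of some
subsheaf. -/
lemma stalk_ofStalks_of_locally
    (N : ∀ x : X, Submodule (X.presheaf.stalk x) (FracStalk X x))
    (hN : ∀ x, ∃ (W : X.Opens) (_ : x ∈ W) (J : MerSubsheaf X), ∀ y ∈ W, J.stalk y = N y) (x : X) :
    (ofStalks N).stalk x = N x := by
  refine stalk_ofStalks N (fun x z hz => ?_) x
  obtain ⟨W, hxW, J, hJ⟩ := hN x
  rw [← hJ x hxW] at hz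
  obtain ⟨U, hxU, s, hs, rfl⟩ := hz
  refine ⟨U ⊓ W, ⟨hxU, hxW⟩, merRes inf_le_left s, rfl, fun y => ?_⟩
  rw [← hJ y.1 y.2.2]
  exact ⟨U, y.2.1, s, hs, rfl⟩

open Classical in
/-- On a curve, every coherent subsheaf of `𝒦_X` becomes effective after adding a suitable effective
Cartier divisor. -/
lemma IsCoherent.exists_isCartier_isEffective_mul (hX : IsPureCurve X) {I : MerSubsheaf X}
    (hI : I.IsCoherent) :
    ∃ E : MerSubsheaf X, E.IsCartier ∧ E.IsEffective ∧ (I * E).IsEffective := by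
  have hloc : ∀ x : X, ∃ (W : X.Opens) (_ : x ∈ W) (b : Γ(X, W)), IsRegularSection X W b ∧
      (∀ (y : X) (hy : y ∈ W), I.stalk y * Submodule.span _ {germFrac X W y hy b} ≤ 1) ∧
      ∀ (y : X) (hy : y ∈ W), y ≠ x → IsUnit ((X.presheaf.germ W y hy).hom b) := fun x => by
    obtain ⟨V, hxV, n, s, hs⟩ := hI x
    obtain ⟨W, hxW, hWV, b, hb, h⟩ := exists_common_denominator s hxV
    obtain ⟨W', hxW', hW'W, hu⟩ := hX.exists_isUnit_germ hb hxW
    refine ⟨W', hxW', (X.presheaf.map (homOfLE hW'W).op).hom b, hb.res hW'W, fun y hy => ?_,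
      fun y hy hne => ?_⟩
    · rw [hs y (hWV (hW'W hy)), Submodule.span_mul_span, Submodule.span_le]
      rintro _ ⟨_, ⟨i, rfl⟩, _, rfl, rfl⟩
      rw [germFrac_res]
      simp only
      rw [mul_comm]
      exact h i y (hW'W hy)
    · rw [X.presheaf.germ_res_apply (homOfLE hW'W) y hy b]
      exact hu y hy hne
  choose W hxW b hb hbI hbu using hloc
  have hunit : ∀ x y (hy : y ∈ W x), y ≠ x →
      Submodule.span (X.presheaf.stalk y) {germFrac X (W x) y hy (b x)} = 1 := fun x y hy hne => by
    have := span_singleton_eq_of_isUnit (K := FracStalk X y) (z := 1) (hbu x y hy hne)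
    rw [mul_one, ← Submodule.one_eq_span] at this
    exact this
  have hT : ∀ x y (hy : y ∈ W x), y ≠ x → I.stalk y ≤ 1 := fun x y hy hne => by
    have := hbI x y hy
    rwa [hunit x y hy hne, mul_one] at this
  -- The denominators `b x` need not agree on overlaps, but `b x` is a unit at every point of `W x`
  -- except `x`, and `I` is already contained in `𝒪_X` there. So each point uses only its own
  -- denominator, and only if one is needed. On `W x` the result is generated by `1` or by `b x`.
  let N : ∀ x : X, Submodule (X.presheaf.stalk x) (FracStalk X x) := fun x =>
    if I.stalk x ≤ 1 then 1 else Submodule.span _ {germFrac X (W x) x (hxW x) (b x)}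
  have hN : ∀ x, ∃ f : (merSections X (W x))ˣ, ∀ (y : X) (hy : y ∈ W x),
      N y = Submodule.span _ {f.1.1 ⟨y, hy⟩} := fun x => by
    by_cases hx : I.stalk x ≤ 1
    · refine ⟨1, fun y hy => ?_⟩
      have hy1 : I.stalk y ≤ 1 := by
        by_cases hyx : y = x
        · rwa [hyx]
        · exact hT x y hy hyx
      simp only [N, if_pos hy1]
      exact Submodule.one_eq_span
    · refine ⟨(hb x).isUnit_toMer.unit, fun y hy => ?_⟩
      by_cases hyx : y = x
      · subst hyx
        simp only [N, if_neg hx]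
        rfl
      · simp only [N, if_pos (hT x y hy hyx)]
        exact (hunit x y hy hyx).symm
  have hst : ∀ x, (ofStalks N).stalk x = N x := stalk_ofStalks_of_locally N fun x => by
    obtain ⟨f, hf⟩ := hN x
    exact ⟨W x, hxW x, spanSection (W x) f.1, fun y hy => by
      rw [hf y hy, stalk_spanSection (W x) f.1 y hy]⟩
  refine ⟨ofStalks N, fun x => ?_, isEffective_iff.2 fun x => ?_, isEffective_iff.2 fun x => ?_⟩
  · obtain ⟨f, hf⟩ := hN x
    exact ⟨W x, hxW x, f, fun y hy => by rw [hst, hf y hy]⟩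
  · rw [hst]
    simp only [N]
    split_ifs
    · exact le_rfl
    · rw [Submodule.span_le, Set.singleton_subset_iff]
      exact Submodule.mem_one.2 ⟨_, rfl⟩
  · rw [stalk_mul, hst]
    simp only [N]
    split_ifs with h
    · rwa [mul_one]
    · exact hbI x x (hxW x)

end MerSubsheaf

lemma IsPureCurve.exists_isEffectiveDifference (hX : IsPureCurve X) (D : GDiv X) :
    ∃ D' E : GDiv X, IsEffectiveDifference D.1 D' E := by
  obtain ⟨E, hE, hEe, hDE⟩ := D.2.isCoherent.exists_isCartier_isEffective_mul hX
  exact ⟨⟨D.1 * E, D.2.mul hE.isGenDivisor⟩, hE.toGDiv, hDE, hEe, hE, hE.eq_mul_inv_iff.2 rfl⟩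

end Denominators

/-! ### The direct image -/

section DirectImage

variable {X Y : Scheme.{u}} {π : X ⟶ Y} [AlgebraicGeometry.IsFinite π] [AlgebraicGeometry.Flat π]
  [IsLocallyNoetherian Y] {I J : MerSubsheaf X}

/-- Computing `I * E * E'` in two ways gives `E' * D' = E * D''`. Both sides have a Cartier factor,
so their Fitting sheaves factor, and the images of `E` and `E'` can be cancelled. -/
lemma fittingSheaf_mul_inv_eq {D' E D'' E' : GDiv X} (h : IsEffectiveDifference I D' E)
    (h' : IsEffectiveDifference I D'' E') :
    fittingSheaf π D'.1 * (fittingSheaf π E.1)⁻¹ =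
      fittingSheaf π D''.1 * (fittingSheaf π E'.1)⁻¹ := by
  obtain ⟨hD, hE, hEc, e⟩ := h
  obtain ⟨hD', hE', hEc', e'⟩ := h'
  have h1 : E'.1 * D'.1 = E.1 * D''.1 := by
    rw [← hEc.eq_mul_inv_iff.1 e, ← hEc'.eq_mul_inv_iff.1 e', mul_comm I, mul_left_comm,
      mul_comm I]
  have h2 := congrArg (fittingSheaf π) h1
  rw [fittingSheaf_mul hEc' hE' D'.2.isCoherent hD,
    fittingSheaf_mul hEc hE D''.2.isCoherent hD'] at h2
  have c := isCartier_fittingSheaf (π := π) hEc hE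
  have c' := isCartier_fittingSheaf (π := π) hEc' hE'
  rw [c'.eq_mul_inv_iff, mul_right_comm, mul_comm (fittingSheaf π D'.1), h2, mul_right_comm,
    c.mul_inv_cancel, one_mul]

lemma directImage_eq {D' E : GDiv X} (h : IsEffectiveDifference I D' E) :
    directImage π I = fittingSheaf π D'.1 * (fittingSheaf π E.1)⁻¹ := by
  have hex : ∃ p : GDiv X × GDiv X, IsEffectiveDifference I p.1 p.2 := ⟨(D', E), h⟩
  rw [directImage, dif_pos hex]
  exact fittingSheaf_mul_inv_eq hex.choose_spec h

lemma directImage_of_isEffective (hI : I.IsGenDivisor) (hIe : I.IsEffective) :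
    directImage π I = fittingSheaf π I := by
  have h : IsEffectiveDifference I ⟨I, hI⟩ MerSubsheaf.isCartier_one.toGDiv :=
    ⟨hIe, isEffective_one, MerSubsheaf.isCartier_one, by
      change I = I * 1⁻¹
      rw [MerSubsheaf.inv_one, mul_one]⟩
  rw [directImage_eq h]
  change fittingSheaf π I * (fittingSheaf π 1)⁻¹ = _
  rw [fittingSheaf_one, MerSubsheaf.inv_one, mul_one]

lemma IsEffectiveDifference.isCartier {D' E : GDiv X} (h : IsEffectiveDifference I D' E)
    (hI : I.IsCartier) : D'.1.IsCartier := by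
  rw [← h.2.2.1.eq_mul_inv_iff.1 h.2.2.2]
  exact hI.mul h.2.2.1

lemma isGenDivisor_directImage {D' E : GDiv X} (h : IsEffectiveDifference I D' E) :
    (directImage π I).IsGenDivisor := by
  rw [directImage_eq h]
  exact (isGenDivisor_fittingSheaf D'.2 h.1).mul
    (isCartier_fittingSheaf h.2.2.1 h.2.1).inv.isGenDivisor

lemma isCartier_directImage {D' E : GDiv X} (h : IsEffectiveDifference I D' E)
    (hI : I.IsCartier) : (directImage π I).IsCartier := by
  rw [directImage_eq h]
  exact (isCartier_fittingSheaf (h.isCartier hI) h.1).mul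
    (isCartier_fittingSheaf h.2.2.1 h.2.1).inv

/-- When `D = D' - E` is Cartier so is `D'`, hence `E - D'` is an admissible presentation of `-D`.
-/
lemma directImage_inv {D' E : GDiv X} (h : IsEffectiveDifference I D' E) (hI : I.IsCartier) :
    directImage π I⁻¹ = (directImage π I)⁻¹ := by
  have hD' := h.isCartier hI
  have h' : IsEffectiveDifference I⁻¹ E D' := ⟨h.2.1, h.1, hD', by
    rw [h.2.2.2, hD'.mul_inv h.2.2.1.inv, h.2.2.1.inv_inv, mul_comm]⟩
  have c := isCartier_fittingSheaf (π := π) h.2.2.1 h.2.1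
  rw [directImage_eq h', directImage_eq h, (isCartier_fittingSheaf hD' h.1).mul_inv c.inv,
    c.inv_inv, mul_comm]

/-- The sum is presented as `(D' + G) - (E + H)`. As `J` is Cartier so is `G`; thus both brackets
contain the Cartier summand that multiplicativity requires. -/
lemma directImage_mul {D' E G H : GDiv X} (h : IsEffectiveDifference I D' E)
    (h' : IsEffectiveDifference J G H) (hJ : J.IsCartier) :
    directImage π (I * J) = directImage π I * directImage π J := by
  have hG := h'.isCartier hJ
  obtain ⟨hD, hE, hEc, e⟩ := h
  obtain ⟨hGe, hH, hHc, e'⟩ := h'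
  have h'' : IsEffectiveDifference (I * J) ⟨D'.1 * G.1, D'.2.mul G.2⟩ (hEc.mul hHc).toGDiv :=
    ⟨hD.mul hGe, hE.mul hH, hEc.mul hHc, by
      change _ = D'.1 * G.1 * (E.1 * H.1)⁻¹
      rw [hEc.mul_inv hHc, e, e', mul_mul_mul_comm]⟩
  rw [directImage_eq h'', directImage_eq ⟨hD, hE, hEc, e⟩, directImage_eq ⟨hGe, hH, hHc, e'⟩]
  change fittingSheaf π (D'.1 * G.1) * (fittingSheaf π (E.1 * H.1))⁻¹ = _
  rw [mul_comm D'.1, fittingSheaf_mul hG hGe D'.2.isCoherent hD,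
    fittingSheaf_mul hEc hE hHc.isCoherent hH,
    (isCartier_fittingSheaf hEc hE).mul_inv (isCartier_fittingSheaf hHc hH),
    mul_comm (fittingSheaf π G.1), mul_mul_mul_comm]

end DirectImage

/-! ### Restriction to open subsets -/

section SpanImage

variable {R R' K K' : Type*} [CommRing R] [CommRing R'] [CommRing K] [CommRing K'] [Algebra R K]
  [Algebra R' K'] {e : R ≃+* R'} {φ : K ≃+* K'}

lemma ringEquiv_mem_span_image_iff (h : ∀ r, φ (algebraMap R K r) = algebraMap R' K' (e r))
    (N : Submodule R K) (w : K) : φ w ∈ Submodule.span R' (φ '' N) ↔ w ∈ N := by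
  refine ⟨fun hw => ?_, fun hw => Submodule.subset_span ⟨w, hw, rfl⟩⟩
  have key : ∀ z ∈ Submodule.span R' (φ '' N), φ.symm z ∈ N := fun z hz => by
    induction hz using Submodule.span_induction with
    | mem z hz =>
      obtain ⟨w, hw, rfl⟩ := hz
      rwa [φ.symm_apply_apply]
    | zero => rw [map_zero]; exact zero_mem _
    | add x y _ _ hx hy => rw [map_add]; exact add_mem hx hy
    | smul r z _ hz =>
      obtain ⟨r, rfl⟩ := e.surjective r
      have := N.smul_mem r hz
      rw [Algebra.smul_def] at this ⊢
      rwa [map_mul, ← h, φ.symm_apply_apply]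
  have := key _ hw
  rwa [φ.symm_apply_apply] at this

lemma ringEquiv_span_image_span (h : ∀ r, φ (algebraMap R K r) = algebraMap R' K' (e r))
    (S : Set K) :
    Submodule.span R' (φ '' (Submodule.span R S : Submodule R K)) = Submodule.span R' (φ '' S) := by
  refine le_antisymm (Submodule.span_le.2 ?_) (Submodule.span_mono
    (Set.image_mono Submodule.subset_span))
  rintro _ ⟨w, hw, rfl⟩
  induction hw using Submodule.span_induction with
  | mem z hz => exact Submodule.subset_span ⟨z, hz, rfl⟩
  | zero => rw [map_zero]; exact zero_mem _
  | add x y _ _ hx hy => rw [map_add]; exact add_mem hx hy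
  | smul r z _ hz =>
    have := Submodule.smul_mem _ (e r) hz
    rw [Algebra.smul_def] at this ⊢
    rwa [map_mul, h]

lemma ringEquiv_span_image_mul (h : ∀ r, φ (algebraMap R K r) = algebraMap R' K' (e r))
    (N M : Submodule R K) : Submodule.span R' (φ '' (N * M : Submodule R K)) =
      Submodule.span R' (φ '' N) * Submodule.span R' (φ '' M) := by
  conv_lhs => rw [← Submodule.span_eq N, ← Submodule.span_eq M, Submodule.span_mul_span,
    ringEquiv_span_image_span h, Set.image_mul]
  rw [Submodule.span_mul_span]

lemma ringEquiv_span_image_one (h : ∀ r, φ (algebraMap R K r) = algebraMap R' K' (e r)) :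
    Submodule.span R' (φ '' (1 : Submodule R K)) = 1 := by
  rw [Submodule.one_eq_span, ringEquiv_span_image_span h, Set.image_singleton, map_one,
    Submodule.one_eq_span]

end SpanImage

section Restrict

variable {X : Scheme.{u}} (U : X.Opens)

/-- The isomorphism of local rings at a point of an open subscheme. -/
noncomputable def stalkEquiv (x : U.toScheme) :
    X.presheaf.stalk (U.ι x) ≃+* U.toScheme.presheaf.stalk x :=
  (asIso (U.ι.stalkMap x)).commRingCatIsoToRingEquiv

/-- The isomorphism of total rings of fractions at a point of an open subscheme. -/
noncomputable def fracEquiv (x : U.toScheme) : FracStalk X (U.ι x) ≃+* FracStalk U.toScheme x :=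
  IsFractionRing.ringEquivOfRingEquiv (stalkEquiv U x)

lemma fracEquiv_algebraMap (x : U.toScheme) (c : X.presheaf.stalk (U.ι x)) :
    fracEquiv U x (algebraMap _ _ c) = algebraMap _ _ (stalkEquiv U x c) :=
  IsFractionRing.ringEquivOfRingEquiv_algebraMap _ _

lemma germFrac_appLE {V : X.Opens} {W : U.toScheme.Opens} (e : W ≤ U.ι ⁻¹ᵁ V) (a : Γ(X, V))
    (x : U.toScheme) (hx : x ∈ W) :
    germFrac U.toScheme W x hx ((U.ι.appLE V W e).hom a) =
      fracEquiv U x (germFrac X V (U.ι x) (e hx) a) := by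
  have h1 : (U.ι.appLE V W e).hom a =
      (U.toScheme.presheaf.map (homOfLE e).op).hom ((U.ι.app V).hom a) := rfl
  rw [h1, germFrac_res e]
  simp only [germFrac, RingHom.comp_apply]
  rw [fracEquiv_algebraMap]
  congr 1
  exact (Scheme.Hom.germ_stalkMap_apply U.ι V x (e hx) a).symm

lemma IsRegularSection.appLE {V : X.Opens} {W : U.toScheme.Opens} (e : W ≤ U.ι ⁻¹ᵁ V) {b : Γ(X, V)}
    (hb : IsRegularSection X V b) : IsRegularSection U.toScheme W ((U.ι.appLE V W e).hom b) :=
  fun x hx => by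
    rw [← isUnit_germFrac_iff, germFrac_appLE U e]
    exact ((isUnit_germFrac_iff b _ (e hx)).2 (hb _ (e hx))).map (fracEquiv U x)

/-- Restriction of sections of `𝒦_X` to an open subscheme. -/
noncomputable def merRestrict {V : X.Opens} {W : U.toScheme.Opens} (e : W ≤ U.ι ⁻¹ᵁ V) :
    merSections X V →+* merSections U.toScheme W where
  toFun s := ⟨fun x => fracEquiv U x.1 (s.1 ⟨U.ι x.1, e x.2⟩), fun x => by
    obtain ⟨V', hx, hV', a, b, hb, h⟩ := s.2 ⟨U.ι x.1, e x.2⟩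
    refine ⟨W ⊓ U.ι ⁻¹ᵁ V', ⟨x.2, hx⟩, inf_le_left, (U.ι.appLE V' _ inf_le_right).hom a,
      (U.ι.appLE V' _ inf_le_right).hom b, hb.appLE U _, fun y hy => ?_⟩
    rw [germFrac_appLE, germFrac_appLE]
    exact (map_mul (fracEquiv U y) _ _).symm.trans (congrArg (fracEquiv U y) (h (U.ι y) hy.2))⟩
  map_one' := Subtype.ext (funext fun x => map_one (fracEquiv U x.1))
  map_zero' := Subtype.ext (funext fun x => map_zero (fracEquiv U x.1))
  map_add' s t := Subtype.ext (funext fun x => map_add (fracEquiv U x.1) _ _)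
  map_mul' s t := Subtype.ext (funext fun x => map_mul (fracEquiv U x.1) _ _)

namespace MerSubsheaf

variable (I J : MerSubsheaf X)

lemma stalk_restrict (x : U.toScheme) : (I.restrict U).stalk x =
    Submodule.span (U.toScheme.presheaf.stalk x) (fracEquiv U x '' I.stalk (U.ι x)) := by
  refine stalk_ofStalks _ (fun x z hz => ?_) x
  change z ∈ Submodule.span _ (fracEquiv U x '' I.stalk (U.ι x)) at hz
  obtain ⟨w, rfl⟩ := (fracEquiv U x).surjective z
  rw [ringEquiv_mem_span_image_iff (fracEquiv_algebraMap U x)] at hz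
  obtain ⟨V, hx, s, hs, rfl⟩ := hz
  refine ⟨U.ι ⁻¹ᵁ V, hx, merRestrict U le_rfl s, rfl, fun y => ?_⟩
  exact Submodule.subset_span ⟨_, ⟨V, y.2, s, hs, rfl⟩, rfl⟩

lemma fracEquiv_mem_stalk_restrict_iff (x : U.toScheme) (w : FracStalk X (U.ι x)) :
    fracEquiv U x w ∈ (I.restrict U).stalk x ↔ w ∈ I.stalk (U.ι x) := by
  rw [stalk_restrict, ringEquiv_mem_span_image_iff (fracEquiv_algebraMap U x)]

lemma restrict_mul : (I * J).restrict U = I.restrict U * J.restrict U := ext_stalk fun x => by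
  rw [stalk_mul, stalk_restrict, stalk_restrict, stalk_restrict, stalk_mul,
    ringEquiv_span_image_mul (fracEquiv_algebraMap U x)]

lemma restrict_one : (1 : MerSubsheaf X).restrict U = 1 := ext_stalk fun x => by
  rw [stalk_one, stalk_restrict, stalk_one, ringEquiv_span_image_one (fracEquiv_algebraMap U x)]

variable {I J}

lemma IsEffective.restrict (hI : I.IsEffective) : (I.restrict U).IsEffective :=
  isEffective_iff.2 fun x => by
    rw [stalk_restrict, ← ringEquiv_span_image_one (fracEquiv_algebraMap U x)]
    exact Submodule.span_mono (Set.image_mono (isEffective_iff.1 hI _))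

lemma IsGeneratedOn.restrict {V : X.Opens} {f : merSections X V} (hf : I.IsGeneratedOn V f) :
    (I.restrict U).IsGeneratedOn (U.ι ⁻¹ᵁ V) (merRestrict U le_rfl f) := fun x hx => by
  rw [stalk_restrict, hf (U.ι x) hx, ringEquiv_span_image_span (fracEquiv_algebraMap U x),
    Set.image_singleton]
  rfl

lemma IsCartier.restrict (hI : I.IsCartier) : (I.restrict U).IsCartier := fun x => by
  obtain ⟨V, hx, f, hf⟩ := hI (U.ι x)
  exact ⟨U.ι ⁻¹ᵁ V, hx, Units.map (merRestrict U le_rfl).toMonoidHom f, hf.restrict U⟩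

/-- Restriction is multiplicative, so it preserves inverses in the monoid. -/
lemma IsCartier.restrict_inv (hI : I.IsCartier) : I⁻¹.restrict U = (I.restrict U)⁻¹ :=
  (hI.restrict U).eq_inv (by rw [← restrict_mul, hI.mul_inv_cancel, restrict_one])

lemma IsCoherent.restrict (hI : I.IsCoherent) : (I.restrict U).IsCoherent := fun x => by
  obtain ⟨V, hx, n, s, hs⟩ := hI (U.ι x)
  refine ⟨U.ι ⁻¹ᵁ V, hx, n, fun i => merRestrict U le_rfl (s i), fun y hy => ?_⟩
  rw [stalk_restrict, hs (U.ι y) hy, ringEquiv_span_image_span (fracEquiv_algebraMap U y),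
    ← Set.range_comp]
  rfl

/-- An open subset contains all generalizations of its points. -/
lemma closure_ι_mem_irreducibleComponents {η : U.toScheme}
    (h : closure {η} ∈ irreducibleComponents U.toScheme) :
    closure {U.ι η} ∈ irreducibleComponents X := by
  refine ⟨isIrreducible_singleton.closure, fun Z hZ hle => ?_⟩
  obtain ⟨ξ, hξ⟩ := QuasiSober.sober hZ.closure isClosed_closure
  have hξη : ξ ⤳ U.ι η := by
    rw [specializes_iff_closure_subset, hξ.def]
    exact hle.trans subset_closure
  have hξU : ξ ∈ U := hξη.mem_open U.isOpen η.2
  have h1 : (⟨ξ, hξU⟩ : U) ⤳ η := (subtype_specializes_iff _ _).2 hξη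
  have h2 : η ⤳ (⟨ξ, hξU⟩ : U) := specializes_iff_closure_subset.2
    (h.2 isIrreducible_singleton.closure (specializes_iff_closure_subset.1 h1))
  have h3 : U.ι η ⤳ ξ := (subtype_specializes_iff _ _).1 h2
  refine subset_closure.trans ?_
  rw [← hξ.def]
  exact specializes_iff_closure_subset.1 h3

lemma IsGenDivisor.restrict (hI : I.IsGenDivisor) : (I.restrict U).IsGenDivisor where
  isCoherent := hI.isCoherent.restrict U
  nondegenerate η hη := by
    refine eq_top_iff.2 fun z _ => ?_
    obtain ⟨w, rfl⟩ := (fracEquiv U η).surjective z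
    rw [fracEquiv_mem_stalk_restrict_iff,
      hI.nondegenerate _ (closure_ι_mem_irreducibleComponents U hη)]
    trivial

end MerSubsheaf

lemma IsEffectiveDifference.restrict {I : MerSubsheaf X} {D' E : GDiv X}
    (h : IsEffectiveDifference I D' E) : IsEffectiveDifference (I.restrict U)
      ⟨D'.1.restrict U, D'.2.restrict U⟩ ⟨E.1.restrict U, E.2.restrict U⟩ :=
  ⟨h.1.restrict U, h.2.1.restrict U, h.2.2.1.restrict U, by
    rw [h.2.2.2, MerSubsheaf.restrict_mul, h.2.2.1.restrict_inv]⟩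

lemma surjective_ι_appLE {V : X.Opens} {W : U.toScheme.Opens} (hVU : V ≤ U) (e : W = U.ι ⁻¹ᵁ V) :
    Function.Surjective (U.ι.appLE V W e.le).hom := by
  subst e
  have : IsIso (U.ι.app V) := U.ι.isIso_app V (by rwa [U.opensRange_ι])
  have h2 : IsIso (U.ι.appLE V (U.ι ⁻¹ᵁ V) le_rfl) := by rwa [Scheme.Hom.appLE_eq_app]
  exact (asIso (U.ι.appLE V (U.ι ⁻¹ᵁ V) le_rfl)).commRingCatIsoToRingEquiv.surjective

end Restrict

/-! ### Compatibility of the direct image with restriction -/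

section RestrictDirectImage

variable {X Y : Scheme.{u}} {π : X ⟶ Y} [AlgebraicGeometry.IsFinite π] {I : MerSubsheaf X}

/-- For `W ≤ V` restriction changes nothing but the names of the rings, so the localization lemma
applies with all denominators `1`. The two preimages of `W` are only propositionally equal, whence
`appLE`. -/
lemma fittingOn_restrict {V W : Y.Opens} (hW : IsAffineOpen W) (hWV : W ≤ V) :
    fittingOn (π ∣_ V) (I.restrict (π ⁻¹ᵁ V)) (V.ι ⁻¹ᵁ W) =
      (fittingOn π I W).map (V.ι.app W).hom := by
  have hpre : (π ∣_ V) ⁻¹ᵁ (V.ι ⁻¹ᵁ W) = (π ⁻¹ᵁ V).ι ⁻¹ᵁ (π ⁻¹ᵁ W) := by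
    rw [← Scheme.Hom.comp_preimage, morphismRestrict_ι, Scheme.Hom.comp_preimage]
  let := (π.app W).hom.toAlgebra
  let := ((π ∣_ V).app (V.ι ⁻¹ᵁ W)).hom.toAlgebra
  have hfin : Module.Finite Γ(Y, W) Γ(X, π ⁻¹ᵁ W) := π.finite_app W hW
  have hσ : Function.Surjective (V.ι.app W).hom := by
    have := surjective_ι_appLE V hWV rfl
    rwa [Scheme.Hom.appLE_eq_app] at this
  have hτ := surjective_ι_appLE (π ⁻¹ᵁ V) (π.preimage_mono hWV) hpre
  have hmem : ∀ s : Γ(X, π ⁻¹ᵁ W),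
      ((π ⁻¹ᵁ V).ι.appLE (π ⁻¹ᵁ W) ((π ∣_ V) ⁻¹ᵁ (V.ι ⁻¹ᵁ W)) hpre.le).hom s ∈
        (I.restrict (π ⁻¹ᵁ V)).idealOn ((π ∣_ V) ⁻¹ᵁ (V.ι ⁻¹ᵁ W)) ↔ s ∈ I.idealOn (π ⁻¹ᵁ W) := by
    intro s
    rw [MerSubsheaf.mem_idealOn_iff, MerSubsheaf.mem_idealOn_iff]
    have hpt : ∀ (x : (π ⁻¹ᵁ V).toScheme) (hx : x ∈ (π ∣_ V) ⁻¹ᵁ (V.ι ⁻¹ᵁ W)),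
        germFrac _ _ x hx (((π ⁻¹ᵁ V).ι.appLE (π ⁻¹ᵁ W) ((π ∣_ V) ⁻¹ᵁ (V.ι ⁻¹ᵁ W)) hpre.le).hom s) ∈
          (I.restrict (π ⁻¹ᵁ V)).stalk x ↔
        germFrac X (π ⁻¹ᵁ W) ((π ⁻¹ᵁ V).ι x) (hpre.le hx) s ∈ I.stalk ((π ⁻¹ᵁ V).ι x) := by
      intro x hx
      rw [germFrac_appLE, MerSubsheaf.fracEquiv_mem_stalk_restrict_iff]
    refine ⟨fun h x hx => ?_, fun h x hx => (hpt x hx).2 (h _ (hpre.le hx))⟩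
    · have hxV : x ∈ π ⁻¹ᵁ V := π.preimage_mono hWV hx
      have hx' : (⟨x, hxV⟩ : (π ⁻¹ᵁ V).toScheme) ∈ (π ∣_ V) ⁻¹ᵁ (V.ι ⁻¹ᵁ W) := hpre.ge hx
      exact (hpt ⟨x, hxV⟩ hx').1 (h ⟨x, hxV⟩ hx')
  refine fittingIdeal_quotient_eq_map (V.ι.app W).hom
    ((π ⁻¹ᵁ V).ι.appLE (π ⁻¹ᵁ W) ((π ∣_ V) ⁻¹ᵁ (V.ι ⁻¹ᵁ W)) hpre.le).hom ?_ _ _ ?_ ?_ ?_ ?_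
  · intro r
    have h1 : π.app W ≫ (π ⁻¹ᵁ V).ι.appLE (π ⁻¹ᵁ W) ((π ∣_ V) ⁻¹ᵁ (V.ι ⁻¹ᵁ W)) hpre.le =
        V.ι.app W ≫ (π ∣_ V).app (V.ι ⁻¹ᵁ W) := by
      rw [Scheme.Hom.app_eq_appLE, Scheme.Hom.app_eq_appLE, Scheme.Hom.app_eq_appLE,
        Scheme.Hom.appLE_comp_appLE, Scheme.Hom.appLE_comp_appLE]
      simp only [morphismRestrict_ι]
    exact RingHom.congr_fun (congrArg CommRingCat.Hom.hom h1) r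
  · intro r'
    obtain ⟨r, rfl⟩ := hσ r'
    exact ⟨1, r, by simp, by simp⟩
  · intro s'
    obtain ⟨s, rfl⟩ := hτ s'
    exact ⟨1, s, by simp, by simp⟩
  · intro s hs
    exact (hmem s).2 hs
  · intro s hs
    exact ⟨1, by simp, by simpa using (hmem s).1 hs⟩

lemma fittingSheaf_restrict (hI : I.IsCoherent) (hIe : I.IsEffective) (V : Y.Opens) :
    fittingSheaf (π ∣_ V) (I.restrict (π ⁻¹ᵁ V)) = (fittingSheaf π I).restrict V :=
  MerSubsheaf.ext_stalk fun y => by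
    obtain ⟨W, hW, hyW, hWV⟩ := exists_isAffineOpen_mem_and_subset
      (show V.ι y ∈ V from y.2)
    have hyW' : y ∈ V.ι ⁻¹ᵁ W := hyW
    have hW' : IsAffineOpen (V.ι ⁻¹ᵁ W) :=
      hW.preimage_of_isOpenImmersion V.ι (by rw [V.opensRange_ι]; exact hWV)
    rw [stalk_fittingSheaf (π ∣_ V) (hI.restrict _) (hIe.restrict _) hW' hyW',
      fittingOn_restrict hW hWV, MerSubsheaf.stalk_restrict, stalk_fittingSheaf π hI hIe hW hyW,
      ringEquiv_span_image_span (fracEquiv_algebraMap V y), Ideal.map]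
    refine (span_germFrac_span y hyW' _).trans ?_
    rw [Set.image_image, Set.image_image]
    congr 1
    refine Set.image_congr fun a _ => ?_
    have := germFrac_appLE V (V := W) (W := V.ι ⁻¹ᵁ W) le_rfl a y hyW'
    rwa [Scheme.Hom.appLE_eq_app] at this

lemma directImage_restrict [AlgebraicGeometry.Flat π] [IsLocallyNoetherian Y] {D' E : GDiv X}
    (h : IsEffectiveDifference I D' E) (V : Y.Opens) :
    directImage (π ∣_ V) (I.restrict (π ⁻¹ᵁ V)) = (directImage π I).restrict V := by
  rw [directImage_eq (h.restrict _), directImage_eq h, MerSubsheaf.restrict_mul,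
    (isCartier_fittingSheaf h.2.2.1 h.2.1).restrict_inv,
    ← fittingSheaf_restrict D'.2.isCoherent h.1, ← fittingSheaf_restrict E.2.isCoherent h.2.1]

end RestrictDirectImage

/-! ### Norms -/

/-- Local lifts to `𝒪_X` agree on overlaps because `toMer` is injective, and so they glue. -/
lemma exists_toMer_eq {X : Scheme.{u}} {U : X.Opens} (s : merSections X U)
    (h : ∀ x : U, s.1 x ∈ (1 : Submodule (X.presheaf.stalk x.1) (FracStalk X x.1))) :
    ∃ a : Γ(X, U), toMer X U a = s := by
  choose V hx hV a ha using fun x : U => MerSubsheaf.exists_germFrac_eq_of_mem_one s x.2 (h x)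
  obtain ⟨c, hc, -⟩ := X.sheaf.existsUnique_gluing' V U (fun x => homOfLE (hV x))
    (fun x hxU => TopologicalSpace.Opens.mem_iSup.2 ⟨⟨x, hxU⟩, hx ⟨x, hxU⟩⟩) a
    (fun x y => toMer_injective (by
      ext z
      exact ((germFrac_res inf_le_left (a x) z.1 z.2).trans (ha x z.1 z.2.1).symm).trans
        ((germFrac_res inf_le_right (a y) z.1 z.2).trans (ha y z.1 z.2.2).symm).symm))
  refine ⟨c, ?_⟩
  ext x
  have h1 : (X.presheaf.map (homOfLE (hV x)).op).hom c = a x := hc x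
  change germFrac X U x.1 x.2 c = s.1 x
  rw [← germFrac_res (hV x) c x.1 (hx x), h1]
  exact (ha x x.1 (hx x)).symm

section Norm

variable {X Y : Scheme.{u}} {π : X ⟶ Y} [AlgebraicGeometry.IsFinite π]
  [IsLocallyNoetherian Y] {I : MerSubsheaf X}

omit [AlgebraicGeometry.IsFinite π] in
lemma isUnit_toMer_normOn {V : Y.Opens} (hV : IsAffineOpen V) (hfree : IsFiniteFreeOver π V)
    {f : Γ(X, π ⁻¹ᵁ V)} (hf : IsRegularSection X (π ⁻¹ᵁ V) f) :
    IsUnit (toMer Y V (normOn π V f)) :=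
  (isRegularSection_normOn hV hfree hf).isUnit_toMer

/-- From `I * E = D'` and `I = (f / g)` follows `g * D' = f * E`. Taking Fitting ideals gives `N(g)
* π_*(D') = N(f) * π_*(E)`, and one divides by `N(g)` and `π_*(E)`. Neither `D'` nor `E` has to be
principal on `π⁻¹V`. -/
lemma directImage_isGeneratedOn [AlgebraicGeometry.Flat π] {D' E : GDiv X}
    (hd : IsEffectiveDifference I D' E) {V : Y.Opens}
    (hV : IsAffineOpen V) (hfree : IsFiniteFreeOver π V) {f g : Γ(X, π ⁻¹ᵁ V)}
    {h : merSections X (π ⁻¹ᵁ V)} {k : merSections Y V} (hg : IsRegularSection X (π ⁻¹ᵁ V) g)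
    (hfg : h * toMer X (π ⁻¹ᵁ V) g = toMer X (π ⁻¹ᵁ V) f) (hI : I.IsGeneratedOn (π ⁻¹ᵁ V) h)
    (hk : k * toMer Y V (normOn π V g) = toMer Y V (normOn π V f)) :
    (directImage π I).IsGeneratedOn V k := by
  have hU : IsAffineOpen (π ⁻¹ᵁ V) := hV.preimage π
  have hIE : I * E.1 = D'.1 := hd.2.2.1.eq_mul_inv_iff.1 hd.2.2.2
  have key : Ideal.span {g} * D'.1.idealOn (π ⁻¹ᵁ V) = Ideal.span {f} * E.1.idealOn (π ⁻¹ᵁ V) := by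
    refine hU.ideal_eq_of_span_germFrac_eq fun x hx => ?_
    rw [span_image_mul, span_image_mul, ← D'.2.isCoherent.stalk_eq_span_idealOn hd.1 hU hx,
      ← E.2.isCoherent.stalk_eq_span_idealOn hd.2.1 hU hx, span_germFrac_span, span_germFrac_span,
      Set.image_singleton, Set.image_singleton, ← hIE, MerSubsheaf.stalk_mul, hI x hx,
      ← mul_assoc, Submodule.span_mul_span, Set.singleton_mul_singleton]
    have : germFrac X _ x hx g * h.1 ⟨x, hx⟩ = germFrac X _ x hx f :=
      (mul_comm _ _).trans (congrFun (congrArg Subtype.val hfg) ⟨x, hx⟩)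
    rw [this]
  have hE := (isCartier_fittingSheaf (π := π) hd.2.2.1 hd.2.1).mul_inv_cancel
  intro y hy
  have hky : k.1 ⟨y, hy⟩ * germFrac Y V y hy (normOn π V g) = germFrac Y V y hy (normOn π V f) :=
    congrFun (congrArg Subtype.val hk) ⟨y, hy⟩
  obtain ⟨u, hu⟩ := ((isUnit_germFrac_iff (normOn π V g) y hy).2
    (isRegularSection_normOn hV hfree hg y hy)).exists_right_inv
  have h1 := congrArg (fun J : Ideal Γ(Y, V) =>
    Submodule.span (Y.presheaf.stalk y) (germFrac Y V y hy '' J))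
    (fittingOn_congr_span_mul hfree key)
  simp only [span_image_mul, span_germFrac_span, Set.image_singleton] at h1
  rw [← stalk_fittingSheaf π D'.2.isCoherent hd.1 hV hy,
    ← stalk_fittingSheaf π E.2.isCoherent hd.2.1 hV hy, ← hky, ← Set.singleton_mul_singleton,
    ← Submodule.span_mul_span] at h1
  have hu' := MerSubsheaf.span_singleton_mul_eq_one (R := Y.presheaf.stalk y) hu
  have hE' : (fittingSheaf π E.1).stalk y * (fittingSheaf π E.1)⁻¹.stalk y = 1 := by
    rw [← MerSubsheaf.stalk_mul, hE, MerSubsheaf.stalk_one]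
  rw [directImage_eq hd, MerSubsheaf.stalk_mul]
  -- What remains is a cancellation in the commutative monoid of submodules.
  generalize (fittingSheaf π E.1)⁻¹.stalk y = P at *
  generalize (fittingSheaf π E.1).stalk y = Q at *
  generalize (fittingSheaf π D'.1).stalk y = R at *
  generalize Submodule.span (Y.presheaf.stalk y) {germFrac Y V y hy (normOn π V g)} = G at *
  generalize Submodule.span (Y.presheaf.stalk y) {u} = T at *
  generalize Submodule.span (Y.presheaf.stalk y) {k.1 ⟨y, hy⟩} = S at *
  calc R * P = (G * T) * (R * P) := by rw [hu', one_mul]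
    _ = (G * R) * (T * P) := by simp only [mul_comm, mul_left_comm]
    _ = S * G * Q * (T * P) := by rw [h1]
    _ = S * ((G * T) * (Q * P)) := by simp only [mul_comm, mul_left_comm]
    _ = S := by rw [hu', hE', one_mul, mul_one]

/-- Any admissible cover determines the same `J`, whatever the equations; a cover exists because
equations of `D'` and `E` near a fibre serve as `f` and `g`. -/
lemma isNormDirectImage_iff [AlgebraicGeometry.Flat π] {D' E : GDiv X}
    (hd : IsEffectiveDifference I D' E) (hI : I.IsCartier) (J : MerSubsheaf Y) :
    IsNormDirectImage π I J ↔ J = directImage π I := by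
  constructor
  · intro hJ
    refine MerSubsheaf.ext_stalk fun y => ?_
    obtain ⟨V, hy, f, g, h, k, hV, hfree, -, hg, hfg, hIV, -, -, hk, hJV⟩ := hJ y
    rw [hJV y hy, directImage_isGeneratedOn hd hV hfree hg hfg hIV hk y hy]
  · rintro rfl y
    have hD' := hd.isCartier hI
    obtain ⟨V₁, hy₁, f₁, hf₁⟩ := hD'.exists_generator π hd.1 y
    obtain ⟨V, hy, g, hV₁, hV, hfree, hg⟩ :=
      exists_isFiniteFreeOver_isGeneratedOn (π := π) hd.2.2.1 hd.2.1 hy₁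
    have hf := hf₁.res_toMer (π.preimage_mono hV₁)
    set f := (X.presheaf.map (homOfLE (π.preimage_mono hV₁)).op).hom f₁
    have hfr := hD'.isRegularSection hf
    have hgr := hd.2.2.1.isRegularSection hg
    obtain ⟨uf, huf⟩ := hfr.isUnit_toMer
    obtain ⟨ug, hug⟩ := hgr.isUnit_toMer
    obtain ⟨vf, hvf⟩ := isUnit_toMer_normOn hV hfree hfr
    obtain ⟨vg, hvg⟩ := isUnit_toMer_normOn hV hfree hgr
    have hh : (uf * ug⁻¹).1 * toMer X (π ⁻¹ᵁ V) g = toMer X (π ⁻¹ᵁ V) f := by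
      rw [← hug, ← huf, ← Units.val_mul, inv_mul_cancel_right]
    have hk : (vf * vg⁻¹).1 * toMer Y V (normOn π V g) = toMer Y V (normOn π V f) := by
      rw [← hvg, ← hvf, ← Units.val_mul, inv_mul_cancel_right]
    have hIV : I.IsGeneratedOn (π ⁻¹ᵁ V) (uf * ug⁻¹).1 := by
      rw [hd.2.2.2]
      rw [← huf] at hf
      rw [← hug] at hg
      exact hf.mul hg.inv
    exact ⟨V, hy, f, g, uf * ug⁻¹, vf * vg⁻¹, hV, hfree, hfr, hgr, hh, hIV,
      isRegularSection_normOn hV hfree hfr, isRegularSection_normOn hV hfree hgr, hk,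
      directImage_isGeneratedOn hd hV hfree hgr hh hIV hk⟩

omit [IsLocallyNoetherian Y] in
-- Since `a / b = a' / b'` on the overlap, cross-multiplication there and multiplicativity of the
-- norm give the claim. Norms restrict well to an open subset that is basic in both `V` and `V'`.
lemma germFrac_normOn_mul_eq (f : merSections X ⊤) {V V' : Y.Opens} (hV : IsAffineOpen V)
    (hV' : IsAffineOpen V') (hfree : IsFiniteFreeOver π V) (hfree' : IsFiniteFreeOver π V')
    {a b : Γ(X, π ⁻¹ᵁ V)} {a' b' : Γ(X, π ⁻¹ᵁ V')}
    (h : merRes le_top f * toMer X _ b = toMer X _ a)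
    (h' : merRes le_top f * toMer X _ b' = toMer X _ a') {y : Y} (hy : y ∈ V) (hy' : y ∈ V') :
    germFrac Y V y hy (normOn π V a) * germFrac Y V' y hy' (normOn π V' b') =
      germFrac Y V' y hy' (normOn π V' a') * germFrac Y V y hy (normOn π V b) := by
  obtain ⟨r, r', e, hyr⟩ := exists_basicOpen_le_affine_inter hV hV' y ⟨hy, hy'⟩
  have hW : Y.basicOpen r ≤ V := Y.basicOpen_le r
  have hW' : Y.basicOpen r ≤ V' := e.le.trans (Y.basicOpen_le r')
  have h1 := congrArg (merRes (π.preimage_mono hW)) h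
  have h2 := congrArg (merRes (π.preimage_mono hW')) h'
  rw [map_mul, toMer_res, toMer_res] at h1 h2
  have h3 : (X.presheaf.map (homOfLE (π.preimage_mono hW)).op).hom a *
      (X.presheaf.map (homOfLE (π.preimage_mono hW')).op).hom b' =
      (X.presheaf.map (homOfLE (π.preimage_mono hW')).op).hom a' *
      (X.presheaf.map (homOfLE (π.preimage_mono hW)).op).hom b := toMer_injective (by
    rw [map_mul, map_mul, ← h1, ← h2]
    exact mul_right_comm _ _ _)
  have h4 := congrArg (fun s => germFrac Y _ y hyr (normOn π _ s)) h3
  simp only [normOn_mul, map_mul] at h4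
  rwa [normOn_res_basicOpen hV r hW rfl hfree, normOn_res_basicOpen hV r hW rfl hfree,
    normOn_res_basicOpen hV' r' hW' e hfree', normOn_res_basicOpen hV' r' hW' e hfree',
    germFrac_res, germFrac_res, germFrac_res, germFrac_res] at h4

variable [AlgebraicGeometry.Flat π]

/-- An invertible section of `𝒦_X` is, locally on `Y`, a quotient of regular sections. -/
lemma exists_mul_toMer_eq_toMer {D' E : GDiv X} {f : (merSections X ⊤)ˣ}
    (hd : IsEffectiveDifference (MerSubsheaf.principal f.1) D' E) (y : Y) :
    ∃ (V : Y.Opens) (_ : y ∈ V) (a b : Γ(X, π ⁻¹ᵁ V)), IsAffineOpen V ∧ IsFiniteFreeOver π V ∧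
      IsRegularSection X _ a ∧ IsRegularSection X _ b ∧
      merRes le_top f.1 * toMer X _ b = toMer X _ a := by
  obtain ⟨V, hy, b, -, hV, hfree, hb⟩ := exists_isFiniteFreeOver_isGeneratedOn (π := π)
    hd.2.2.1 hd.2.1 (y := y) (V₀ := ⊤) trivial
  have hD' : D'.1.IsGeneratedOn (π ⁻¹ᵁ V) (merRes le_top f.1 * toMer X _ b) := by
    rw [← hd.2.2.1.eq_mul_inv_iff.1 hd.2.2.2]
    exact MerSubsheaf.IsGeneratedOn.mul (fun x hx => MerSubsheaf.stalk_principal f.1 x) hb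
  -- The product `f * b` generates the effective divisor `D'`, so it is a function.
  obtain ⟨a, ha⟩ := exists_toMer_eq (merRes le_top f.1 * toMer X _ b) fun x =>
    MerSubsheaf.isEffective_iff.1 hd.1 x.1 (by
      rw [hD' x.1 x.2]
      exact Submodule.mem_span_singleton_self _)
  exact ⟨V, hy, a, b, hV, hfree, (hd.isCartier (MerSubsheaf.isCartier_principal f)).isRegularSection
    (ha ▸ hD'), hd.2.2.1.isRegularSection hb, ha.symm⟩

/-- The norm of an invertible section of `𝒦_X`. -/
lemma exists_normMer {D' E : GDiv X} {f : (merSections X ⊤)ˣ}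
    (hd : IsEffectiveDifference (MerSubsheaf.principal f.1) D' E) :
    ∃ F : merSections Y ⊤, ∀ (V : Y.Opens) (a b : Γ(X, π ⁻¹ᵁ V)), IsAffineOpen V →
      IsFiniteFreeOver π V → IsRegularSection X _ b →
      merRes le_top f.1 * toMer X _ b = toMer X _ a →
      merRes le_top F * toMer Y V (normOn π V b) = toMer Y V (normOn π V a) := by
  choose V hy a b hV hfree ha hb h using exists_mul_toMer_eq_toMer (π := π) hd
  choose c hc using fun y => ((isUnit_germFrac_iff (normOn π (V y) (b y)) y (hy y)).2
    (isRegularSection_normOn (hV y) (hfree y) (hb y) y (hy y))).exists_right_inv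
  -- The value at `y` is `N(a) / N(b)` for the fraction chosen at `y`. It agrees with the value
  -- computed from any other fraction, so the family of values is a section of `𝒦_Y`.
  have key : ∀ (W : Y.Opens) (a' b' : Γ(X, π ⁻¹ᵁ W)), IsAffineOpen W →
      IsFiniteFreeOver π W → merRes le_top f.1 * toMer X _ b' = toMer X _ a' →
      ∀ (y : Y) (hyW : y ∈ W), germFrac Y (V y) y (hy y) (normOn π (V y) (a y)) * c y *
        germFrac Y W y hyW (normOn π W b') = germFrac Y W y hyW (normOn π W a') := by
    intro W a' b' hW hWfree h' y hyW
    rw [mul_right_comm, germFrac_normOn_mul_eq f.1 (hV y) hW (hfree y) hWfree (h y) h' (hy y) hyW,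
      mul_assoc, hc, mul_one]
  exact ⟨⟨fun y => germFrac Y (V y.1) y.1 (hy y.1) (normOn π (V y.1) (a y.1)) * c y.1, fun y =>
    ⟨V y.1, hy y.1, le_top, _, _, isRegularSection_normOn (hV y.1) (hfree y.1) (hb y.1),
      key _ _ _ (hV y.1) (hfree y.1) (h y.1)⟩⟩, fun W a' b' hW hWfree _ h' =>
        Subtype.ext (funext fun y => key W a' b' hW hWfree h' y.1 y.2)⟩

/-- The norm of `f` is invertible because the norm of `f⁻¹`, represented by `b / a` where `f` is `a
/ b`, is its inverse. -/
lemma exists_directImage_principal_eq {D' E G H : GDiv X} {f : (merSections X ⊤)ˣ}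
    (hd : IsEffectiveDifference (MerSubsheaf.principal f.1) D' E)
    (hd' : IsEffectiveDifference (MerSubsheaf.principal f⁻¹.1) G H) :
    ∃ F : (merSections Y ⊤)ˣ,
      directImage π (MerSubsheaf.principal f.1) = MerSubsheaf.principal F.1 := by
  obtain ⟨F, hF⟩ := exists_normMer (π := π) hd
  obtain ⟨F', hF'⟩ := exists_normMer (π := π) hd'
  have hFF' : F * F' = 1 := by
    ext ⟨y, hyT⟩
    obtain ⟨V, hy, a, b, hV, hfree, ha, hb, h⟩ := exists_mul_toMer_eq_toMer (π := π) hd y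
    have h' : merRes le_top f⁻¹.1 * toMer X _ a = toMer X (π ⁻¹ᵁ V) b := by
      rw [← h, ← mul_assoc, ← map_mul, Units.inv_mul, map_one, one_mul]
    have h1 : merRes le_top (F * F') * toMer Y V (normOn π V a) = toMer Y V (normOn π V a) := by
      rw [map_mul, mul_assoc, hF' V b a hV hfree ha h', hF V a b hV hfree hb h]
    have h2 : merRes le_top (F * F') = (1 : merSections Y V) :=
      (isUnit_toMer_normOn hV hfree ha).mul_right_cancel (h1.trans (one_mul _).symm)
    exact congrFun (congrArg Subtype.val h2) ⟨y, hy⟩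
  refine ⟨⟨F, F', hFF', (mul_comm _ _).trans hFF'⟩, MerSubsheaf.ext_stalk fun y => ?_⟩
  obtain ⟨V, hy, a, b, hV, hfree, ha, hb, h⟩ := exists_mul_toMer_eq_toMer (π := π) hd y
  rw [MerSubsheaf.stalk_principal]
  exact directImage_isGeneratedOn hd hV hfree hb h (fun x hx => MerSubsheaf.stalk_principal f.1 x)
    (hF V a b hV hfree hb h) y hy

end Norm

/-! ### The theorem on direct images -/

theorem mainTheorem5 {X Y : Scheme.{u}} (hX : IsPureCurve X) (hY : IsPureCurve Y) (π : X ⟶ Y)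
    [AlgebraicGeometry.IsFinite π] [AlgebraicGeometry.Flat π] :
    -- the Fitting ideal of an effective divisor is an effective divisor, and is its direct image
    (∀ D : GDiv X, D.1.IsEffective →
      (fittingSheaf π D.1).IsGenDivisor ∧ (fittingSheaf π D.1).IsEffective ∧
        directImage π D.1 = fittingSheaf π D.1) ∧
    -- every divisor is a difference `D' - E`, and the direct image does not depend on the choice
    (∀ D : GDiv X, ∃ D' E : GDiv X, IsEffectiveDifference D.1 D' E) ∧
    (∀ D D' E : GDiv X, IsEffectiveDifference D.1 D' E →
      directImage π D.1 = fittingSheaf π D'.1 * (fittingSheaf π E.1)⁻¹) ∧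
    -- the direct image of a Cartier divisor
    (∀ D : GDiv X, D.1.IsCartier →
      (directImage π D.1).IsCartier ∧ directImage π D.1⁻¹ = (directImage π D.1)⁻¹ ∧
        ∀ J : MerSubsheaf Y, IsNormDirectImage π D.1 J ↔ J = directImage π D.1) ∧
    -- additivity with respect to Cartier divisors
    (∀ D E : GDiv X, E.1.IsCartier →
      directImage π (D.1 * E.1) = directImage π D.1 * directImage π E.1) ∧
    -- restriction to open subsets
    (∀ (V : Y.Opens) (D : GDiv X),
      directImage (π ∣_ V) (D.1.restrict (π ⁻¹ᵁ V)) = (directImage π D.1).restrict V) ∧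
    -- linear equivalence
    (∀ D E : GDiv X, D.1.LinEquiv E.1 → (directImage π D.1).LinEquiv (directImage π E.1)) ∧
    -- the induced maps on `GDiv` and `GPic`
    (∃ (pushDiv : GDiv X → GDiv Y) (pushPic : GPic X → GPic Y),
      (∀ D : GDiv X, (pushDiv D).1 = directImage π D.1) ∧
        ∀ D : GDiv X, pushPic D.toGPic = (pushDiv D).toGPic) := by
  have := hY.isNoetherian
  have hdiff := hX.exists_isEffectiveDifference
  have hcd : ∀ {I : MerSubsheaf X}, I.IsCartier → ∃ D' E : GDiv X, IsEffectiveDifference I D' E :=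
    fun hI => hdiff hI.toGDiv
  have hgen : ∀ D : GDiv X, (directImage π D.1).IsGenDivisor := fun D => by
    obtain ⟨D', E, h⟩ := hdiff D
    exact isGenDivisor_directImage h
  have hlin : ∀ D E : GDiv X, D.1.LinEquiv E.1 →
      (directImage π D.1).LinEquiv (directImage π E.1) := by
    rintro D E ⟨f, hf⟩
    obtain ⟨D', E', h⟩ := hdiff D
    have hcart := MerSubsheaf.isCartier_principal f
    -- Presentations are needed for `f` and for `f⁻¹`, since the norm of the latter provides the
    -- inverse of the norm of `f`.
    obtain ⟨G, H, h'⟩ := hcd hcart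
    obtain ⟨G', H', h''⟩ := hcd (MerSubsheaf.isCartier_principal f⁻¹)
    obtain ⟨F, hF⟩ := exists_directImage_principal_eq (π := π) h' h''
    exact ⟨F, by rw [← hF, ← hf, directImage_mul h h' hcart]⟩
  refine ⟨fun D hD => ⟨isGenDivisor_fittingSheaf D.2 hD, isEffective_fittingSheaf,
    directImage_of_isEffective D.2 hD⟩, hdiff, fun D D' E h => directImage_eq h, fun D hD => ?_,
    fun D E hE => ?_, fun V D => ?_, hlin, fun D => ⟨directImage π D.1, hgen D⟩,
    Quotient.map (fun D => ⟨directImage π D.1, hgen D⟩) hlin, fun _ => rfl, fun _ => rfl⟩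
  · obtain ⟨D', E, h⟩ := hdiff D
    exact ⟨isCartier_directImage h hD, directImage_inv h hD, isNormDirectImage_iff h hD⟩
  · obtain ⟨D', E', h⟩ := hdiff D
    obtain ⟨G, H, h'⟩ := hdiff E
    exact directImage_mul h h' hE
  · obtain ⟨D', E, h⟩ := hdiff D
    exact directImage_restrict h V
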